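/- For every real number $\beta$ with $0<\beta<1$ there exists a Cantor set $E$ (that is, a set homeomorphic to the middle-third Cantor set) contained in the unit sphere $\partial\mathbb{B}^2=\{z\in\mathbb{C}^2:|z_1|^2+|z_2|^2=1\}$ of $\mathbb{C}^2$ whose polynomial hull \[ \hat E=\{z\in\mathbb{C}^2 : |p(z)|\le \max_{E}|p| \text{ for all polynomials } p\in\mathbb{C}[z_1,z_2]\} \] contains the closed ball $\{z\in\mathbb{C}^2:|z_1|^2+|z_2|^2\le\beta^2\}$ of radius $\beta$ centred at the origin. -/

import Mathlib

/-- The polynomial hull of a set `K ⊆ ℂⁿ`: the points `z` with `|p z| ≤ max_K |p|` for every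
complex polynomial `p` in `n` variables. The inequality is written as "every upper bound of `|p|`
on `K` bounds `|p z|`", which for a nonempty compact `K` is the same thing. -/
def polynomialHull {n : ℕ} (K : Set (EuclideanSpace ℂ (Fin n))) :
    Set (EuclideanSpace ℂ (Fin n)) :=
  {z | ∀ (p : MvPolynomial (Fin n) ℂ) (C : ℝ),
    (∀ w ∈ K, ‖MvPolynomial.eval (fun i => w i) p‖ ≤ C) →
      ‖MvPolynomial.eval (fun i => z i) p‖ ≤ C}

/-- A subset of a topological space is a Cantor set if, with the subspace topology, it is
homeomorphic to the middle-third Cantor set in `ℝ`. -/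
def IsCantorSet {X : Type*} [TopologicalSpace X] (E : Set X) : Prop :=
  Nonempty (E ≃ₜ cantorSet)

/-! The set `E` is a decreasing intersection of finite unions of disjoint closed tubes in the
sphere. A tube is the part of the sphere over a closed pseudohyperbolic disc of a complex direction.
At each stage the cores of the tubes have in their hull a ball of some radius `b > β`. Dividing each
tube into finitely many smaller ones, at least two, costs a factor `1 - δ`; the slack `b - β` pays
for it, so `β` survives in the limit by compactness (`mem_polynomialHull_iInter`). Tube diameters
tend to zero and every tube splits, so Brouwer's theorem (`nonempty_homeomorph_nat_to_bool`) makes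
`E` a Cantor set. One tube over the disc `|z₁| ≤ b` starts the construction.

Everything rests on `TubePair.divisible`. Rotate so that the tube lies over a disc about `ζ` in the
first coordinate. Let `w_ξ` be the second coordinate after the ball automorphism that centres the
line `z₁ = ξ`; on the sphere `1 - |w_ξ|²` is the squared pseudohyperbolic distance from `z₁` to `ξ`.
For finitely many `ξ`, unimodular `ω_ξ` and `Λ` slightly above `1`, consider `F = ∏ (1 - ω_ξ (Λ w_ξ)
^ N) * (l / w_ζ) ^ m`, with `N = s * m`. On the shrunken core `|F| ≤ 1`, because there `|Λ w_ξ| ≤ 1`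
and `|w_ζ| > l`. On the side `|w_ζ| = l''` of the region over the outer disc `|F| > 2`. So `{|F| ≤
2}` is compact in that region of the ball, and a maximum principle (`norm_le_of_compact_sublevel`)
puts the shrunken core in the hull of the trace of `{|F| ≤ 2}` on the sphere. On that trace some
factor is smaller than `θ ^ m`, so `Λ w_ξ` is exponentially close to a root `α` of `α ^ N ω_ξ = 1`.
The equation `Λ w_ξ = α` defines a complex line almost tangent to the sphere, so the trace lies in
small tubes.

Those tubes must be disjoint. For one `ξ` the roots are at least `1 / N` apart, far more than the
exponentially small widths. For distinct `ξ`, `ξ'`, a collision puts `z₁` near both circles `|Λ w_ξ|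
= 1` and `|Λ w_ξ'| = 1`, hence near one of at most two points. As `w_ξ / w_ξ'` depends on `z₁`
alone, `α / α'` then takes almost only two values, and each value of `ω_ξ'` excludes at most two
roots of unity as values of `ω_ξ`. A greedy choice (`exists_rotations`) avoids all collisions. -/

open Filter Topology MeasureTheory TopologicalSpace

/-! ### Maximum principle on holomorphic level and sublevel sets -/

/-- Through a point where the differential of a holomorphic function does not vanish passes a
nonconstant holomorphic disc inside the level set. -/
theorem exists_disc_in_level {G : ℂ × ℂ → ℂ} {v : ℂ × ℂ} (hG : AnalyticAt ℂ G v)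
    (hd : fderiv ℂ G v ≠ 0) :
    ∃ γ : ℂ → ℂ × ℂ, γ 0 = v ∧ (∀ᶠ s in 𝓝 0, DifferentiableAt ℂ γ s) ∧
      (∀ᶠ s in 𝓝 0, G (γ s) = G v) ∧ ¬ ∀ᶠ s in 𝓝 0, γ s = v := by
  set L := fderiv ℂ G v with hL
  -- A coordinate independent of `L` completes `G` to a local chart; the disc is a coordinate line
  -- of that chart.
  obtain ⟨μ, hμ⟩ : ∃ μ : ℂ × ℂ →L[ℂ] ℂ, ∀ u, L u = 0 → μ u = 0 → u = 0 := by
    have hdec : ∀ u : ℂ × ℂ, L u = u.1 * L (1, 0) + u.2 * L (0, 1) := by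
      intro u
      have : u = u.1 • ((1, 0) : ℂ × ℂ) + u.2 • ((0, 1) : ℂ × ℂ) := by ext <;> simp
      conv_lhs => rw [this]
      simp only [map_add, map_smul, smul_eq_mul]
    by_cases h1 : L (1, 0) = 0
    · have h2 : L (0, 1) ≠ 0 := by
        intro h2
        apply hd
        ext <;> simp [h1, h2]
      refine ⟨ContinuousLinearMap.fst ℂ ℂ ℂ, fun u hu hu' => ?_⟩
      rw [hdec, h1, mul_zero, zero_add] at hu
      exact Prod.ext hu' ((mul_eq_zero.mp hu).resolve_right h2)
    · refine ⟨ContinuousLinearMap.snd ℂ ℂ ℂ, fun u hu hu' => ?_⟩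
      have hu2 : u.2 = 0 := hu'
      rw [hdec, hu2, zero_mul, add_zero] at hu
      exact Prod.ext ((mul_eq_zero.mp hu).resolve_right h1) hu'
  have hinj : Function.Injective (L.prod μ : ℂ × ℂ →ₗ[ℂ] ℂ × ℂ) := by
    rw [injective_iff_map_eq_zero]
    intro u hu
    have := Prod.ext_iff.mp hu
    exact hμ u this.1 this.2
  let e : (ℂ × ℂ) ≃L[ℂ] (ℂ × ℂ) :=
    (LinearEquiv.ofInjectiveEndo (L.prod μ : ℂ × ℂ →ₗ[ℂ] ℂ × ℂ) hinj).toContinuousLinearEquiv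
  have he : (e : ℂ × ℂ →L[ℂ] ℂ × ℂ) = L.prod μ := by ext <;> rfl
  let Φ : ℂ × ℂ → ℂ × ℂ := fun u => (G u, μ u)
  have hΦ : AnalyticAt ℂ Φ v := hG.prod (μ.analyticAt v)
  have hΦ1 : HasStrictFDerivAt Φ (e : ℂ × ℂ →L[ℂ] ℂ × ℂ) v := by
    rw [he]
    exact hG.hasStrictFDerivAt.prodMk μ.hasStrictFDerivAt
  have hΦ2 : HasFDerivAt Φ (e : ℂ × ℂ →L[ℂ] ℂ × ℂ) v := hΦ1.hasFDerivAt
  have hc : ContDiffAt ℂ 1 Φ v := hΦ.contDiffAt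
  let Ψ := hc.localInverse hΦ2 one_ne_zero
  have hΨ : ContDiffAt ℂ 1 Ψ (Φ v) := hc.to_localInverse hΦ2 one_ne_zero
  have hΨv : Ψ (Φ v) = v := hc.localInverse_apply_image hΦ2 one_ne_zero
  have hr : ∀ᶠ y in 𝓝 (Φ v), Φ (Ψ y) = y :=
    (hc.hasStrictFDerivAt' hΦ2 one_ne_zero).eventually_right_inverse
  have hdΨ : ∀ᶠ y in 𝓝 (Φ v), DifferentiableAt ℂ Ψ y :=
    (hΨ.eventually (by simp)).mono fun y hy => hy.differentiableAt one_ne_zero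
  let ι : ℂ → ℂ × ℂ := fun s => (G v, μ v + s)
  have hι : Continuous ι := by fun_prop
  have hιd : Differentiable ℂ ι := by fun_prop
  have hι0 : ι 0 = Φ v := by simp [ι, Φ]
  have ht : Tendsto ι (𝓝 0) (𝓝 (Φ v)) := hι0 ▸ hι.tendsto 0
  refine ⟨Ψ ∘ ι, by simp [hι0, hΨv], ?_, ?_, ?_⟩
  · filter_upwards [ht.eventually hdΨ] with s hs using hs.comp s (hιd s)
  · filter_upwards [ht.eventually hr] with s hs
    exact congrArg Prod.fst hs
  · intro h
    have h1 : ∀ᶠ s in 𝓝 (0 : ℂ), s = 0 := by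
      filter_upwards [h, ht.eventually hr] with s hs hs'
      have h2 : μ (Ψ (ι s)) = μ v + s := congrArg Prod.snd hs'
      have h3 : Ψ (ι s) = v := hs
      rw [h3] at h2
      simpa using h2
    have h4 : ∀ᶠ s in 𝓝[≠] (0 : ℂ), s = 0 := h1.filter_mono nhdsWithin_le_nhds
    obtain ⟨s, hs, hs'⟩ := (h4.and self_mem_nhdsWithin).exists
    exact hs' hs

/-- The set of `(b, c)` for which the level set `F + b y = c` has a singular point is null. -/
theorem volume_singular_levels {F : ℂ × ℂ → ℂ} {O : Set (ℂ × ℂ)} (hF : AnalyticOnNhd ℂ F O) :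
    (volume : Measure (ℂ × ℂ)) {q | ∃ v ∈ O, F v + q.1 * v.2 = q.2 ∧
      fderiv ℂ (fun u : ℂ × ℂ => F u + q.1 * u.2) v = 0} = 0 := by
  have : (volume : Measure (ℂ × ℂ)).IsAddHaarMeasure := inferInstanceAs
    (Measure.IsAddHaarMeasure (Measure.prod (volume : Measure ℂ) (volume : Measure ℂ)))
  let Fy : ℂ × ℂ → ℂ := fun v => fderiv ℂ F v (0, 1)
  let L : ℂ × ℂ → (ℂ × ℂ →L[ℂ] ℂ) := fun v => fderiv ℂ Fy v
  let s : Set (ℂ × ℂ) := {v | v ∈ O ∧ fderiv ℂ F v = Fy v • ContinuousLinearMap.snd ℂ ℂ ℂ}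
  -- At a singular point `dF = -b dy`, so `b = -F_y` and `c = F - y F_y`: the bad pairs are values
  -- of `Ψ` on `s`. There `dF = F_y dy` cancels terms in `dΨ`, and both components become multiples
  -- of `dF_y`. So `dΨ` has rank at most one and Sard's lemma applies.
  let Ψ : ℂ × ℂ → ℂ × ℂ := fun v => (-Fy v, F v - v.2 * Fy v)
  have hFy : ∀ v ∈ O, HasFDerivAt Fy (L v) v := by
    intro v hv
    have h1 : DifferentiableAt ℂ (fderiv ℂ F) v := (hF.fderiv v hv).differentiableAt
    exact (h1.clm_apply (differentiableAt_const _)).hasFDerivAt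
  let A : ℂ × ℂ → (ℂ × ℂ →L[ℂ] ℂ × ℂ) := fun v => (-L v).prod (-(v.2 • L v))
  have hΨ : ∀ v ∈ s, HasFDerivAt Ψ (A v) v := by
    intro v hv
    have h1 := (hFy v hv.1)
    have h2 : HasFDerivAt F (Fy v • ContinuousLinearMap.snd ℂ ℂ ℂ) v := by
      rw [← hv.2]; exact (hF v hv.1).differentiableAt.hasFDerivAt
    have h3 : HasFDerivAt (fun u : ℂ × ℂ => u.2) (ContinuousLinearMap.snd ℂ ℂ ℂ) v :=
      hasFDerivAt_snd
    have h4 := h2.sub (h3.mul h1)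
    have h5 := h1.neg.prodMk h4
    refine h5.congr_fderiv ?_
    ext <;> simp [A]
  have hdet : ∀ v ∈ s, ((A v).restrictScalars ℝ).det = 0 := by
    intro v _
    have hk : ∃ u : ℂ × ℂ, u ≠ 0 ∧ L v u = 0 := by
      by_cases h : L v (1, 0) = 0
      · exact ⟨(1, 0), by simp, h⟩
      · refine ⟨(L v (0, 1), -L v (1, 0)), by simp [h], ?_⟩
        have : ((L v (0, 1), -L v (1, 0)) : ℂ × ℂ) =
            L v (0, 1) • ((1, 0) : ℂ × ℂ) + (-L v (1, 0)) • ((0, 1) : ℂ × ℂ) := by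
          ext <;> simp
        rw [this, map_add, map_smul, map_smul]
        simp only [smul_eq_mul]
        ring
    obtain ⟨u, hu0, hu⟩ := hk
    rw [ContinuousLinearMap.det, LinearMap.det_eq_zero_iff_ker_ne_bot]
    intro hbot
    apply hu0
    rw [← Submodule.mem_bot ℝ, ← hbot, LinearMap.mem_ker]
    simp [A, hu]
  have h0 : volume (Ψ '' s) = 0 :=
    addHaar_image_eq_zero_of_det_fderivWithin_eq_zero volume
      (f' := fun v => (A v).restrictScalars ℝ)
      (fun v hv => ((hΨ v hv).restrictScalars ℝ).hasFDerivWithinAt) hdet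
  refine measure_mono_null ?_ h0
  rintro ⟨b, c⟩ ⟨v, hvO, hc, hd⟩
  have h1 : HasFDerivAt (fun u : ℂ × ℂ => F u + b * u.2)
      (fderiv ℂ F v + b • ContinuousLinearMap.snd ℂ ℂ ℂ) v :=
    (hF v hvO).differentiableAt.hasFDerivAt.add
      ((hasFDerivAt_snd (𝕜 := ℂ) (p := v)).const_mul b)
  have h2 : fderiv ℂ F v + b • ContinuousLinearMap.snd ℂ ℂ ℂ = 0 := h1.fderiv.symm.trans hd
  have h3 : fderiv ℂ F v = (-b) • ContinuousLinearMap.snd ℂ ℂ ℂ := by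
    rw [eq_neg_of_add_eq_zero_left h2]; ext <;> simp
  have h4 : Fy v = -b := by simp [Fy, h3]
  refine ⟨v, ⟨hvO, by rw [h4]; exact h3⟩, ?_⟩
  simp only [Ψ, h4, Prod.mk.injEq, neg_neg, true_and]
  simp only at hc
  rw [← hc]; ring

/-- Pairs of complex numbers as points of the Euclidean plane `ℂ²`. -/
noncomputable def euclPair : (ℂ × ℂ) ≃L[ℂ] EuclideanSpace ℂ (Fin 2) :=
  LinearEquiv.toContinuousLinearEquiv
    { toFun := fun v => !₂[v.1, v.2]
      invFun := fun z => (z 0, z 1)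
      map_add' := fun u v => by ext i; fin_cases i <;> simp
      map_smul' := fun c v => by ext i; fin_cases i <;> simp
      left_inv := fun v => by simp
      right_inv := fun z => by ext i; fin_cases i <;> simp }

@[simp] theorem euclPair_apply_zero (v : ℂ × ℂ) : euclPair v 0 = v.1 := rfl

@[simp] theorem euclPair_apply_one (v : ℂ × ℂ) : euclPair v 1 = v.2 := rfl

@[simp] theorem euclPair_symm_apply (z : EuclideanSpace ℂ (Fin 2)) :
    euclPair.symm z = (z 0, z 1) := rfl

/-- A function on a compact smooth holomorphic level set inside the closed ball is bounded by its
values on the sphere. -/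
theorem norm_le_of_compact_level {G P : ℂ × ℂ → ℂ} {Y : Set (ℂ × ℂ)} {c : ℂ} {C : ℝ}
    (hY : IsCompact Y) (hG : ∀ v ∈ Y, AnalyticAt ℂ G v) (hd : ∀ v ∈ Y, fderiv ℂ G v ≠ 0)
    (hGc : ∀ v ∈ Y, G v = c) (hP : Differentiable ℂ P)
    (hball : ∀ v ∈ Y, ‖euclPair v‖ ≤ 1)
    (hloc : ∀ v ∈ Y, ‖euclPair v‖ < 1 → ∀ᶠ u in 𝓝 v, G u = c → u ∈ Y)
    (hC : ∀ v ∈ Y, ‖euclPair v‖ = 1 → ‖P v‖ ≤ C) {v₀ : ℂ × ℂ} (hv₀ : v₀ ∈ Y) : ‖P v₀‖ ≤ C := by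
  by_contra! hlt
  obtain ⟨a, haY, ha⟩ := hY.exists_isMaxOn ⟨v₀, hv₀⟩ hP.continuous.norm.continuousOn
  have hM : C < ‖P a‖ := hlt.trans_le (ha hv₀)
  have hL : IsCompact (Y ∩ {v | ‖P v‖ = ‖P a‖}) :=
    hY.inter_right (isClosed_eq hP.continuous.norm continuous_const)
  -- Among the points where `|P|` is maximal, take one farthest from the origin. On a disc through
  -- it inside `Y`, `|P|` is locally constant, so the norm also has a local maximum. Strict
  -- convexity of the Euclidean norm then makes the disc constant, a contradiction.
  obtain ⟨w, ⟨hwY, hwP⟩, hw⟩ := hL.exists_isMaxOn ⟨a, haY, rfl⟩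
    (euclPair.continuous.norm.continuousOn)
  have hwP' : ‖P w‖ = ‖P a‖ := hwP
  have hw1 : ‖euclPair w‖ < 1 := by
    refine lt_of_le_of_ne (hball w hwY) fun h => ?_
    have := hC w hwY h
    linarith
  obtain ⟨γ, hγ0, hγd, hγG, hγn⟩ := exists_disc_in_level (hG w hwY) (hd w hwY)
  have hγc : Tendsto γ (𝓝 0) (𝓝 w) := hγ0 ▸ hγd.self_of_nhds.continuousAt.tendsto
  have hγY : ∀ᶠ s in 𝓝 0, γ s ∈ Y := by
    filter_upwards [hγc.eventually (hloc w hwY hw1), hγG] with s hs hs'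
    exact hs (hs'.trans (hGc w hwY))
  have hPd : ∀ᶠ s in 𝓝 0, DifferentiableAt ℂ (P ∘ γ) s :=
    hγd.mono fun s hs => (hP _).comp s hs
  have hPm : IsLocalMax (norm ∘ (P ∘ γ)) 0 := by
    filter_upwards [hγY] with s hs
    simp only [Function.comp, hγ0, hwP']
    exact ha hs
  have hPc := Complex.norm_eventually_eq_of_isLocalMax hPd hPm
  have hEd : ∀ᶠ s in 𝓝 0, DifferentiableAt ℂ (euclPair ∘ γ) s :=
    hγd.mono fun s hs => euclPair.differentiableAt.comp s hs
  have hEm : IsLocalMax (norm ∘ (euclPair ∘ γ)) 0 := by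
    filter_upwards [hγY, hPc] with s hs hs'
    simp only [Function.comp, hγ0] at hs' ⊢
    exact hw ⟨hs, hs'.trans hwP'⟩
  apply hγn
  filter_upwards [Complex.eventually_eq_of_isLocalMax_norm hEd hEm] with s hs
  simpa [hγ0] using hs

/-- The part of a compact holomorphic sublevel set in the closed unit ball is controlled by its
trace on the sphere. -/
theorem norm_le_of_compact_sublevel {F P : ℂ × ℂ → ℂ} {O : Set (ℂ × ℂ)} {C : ℝ} (hO : IsOpen O)
    (hF : AnalyticOnNhd ℂ F O) (hP : Differentiable ℂ P)
    (hK : IsCompact {v | v ∈ O ∧ ‖F v‖ ≤ 2 ∧ ‖euclPair v‖ ≤ 1})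
    (hC : ∀ v ∈ O, ‖F v‖ ≤ 2 → ‖euclPair v‖ = 1 → ‖P v‖ ≤ C)
    {v₀ : ℂ × ℂ} (hv₀ : v₀ ∈ O) (hF₀ : ‖F v₀‖ ≤ 1) (hb₀ : ‖euclPair v₀‖ ≤ 1) : ‖P v₀‖ ≤ C := by
  by_contra! hlt
  have hb : ‖euclPair v₀‖ < 1 := by
    refine lt_of_le_of_ne hb₀ fun h => ?_
    have := hC v₀ hv₀ (hF₀.trans one_le_two) h
    linarith
  -- generic slopes
  have hN : ∀ᵐ b : ℂ, ∀ᵐ c : ℂ, ∀ v ∈ O, F v + b * v.2 = c →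
      fderiv ℂ (fun u : ℂ × ℂ => F u + b * u.2) v ≠ 0 := by
    have h1 : ∀ᵐ q : ℂ × ℂ, ∀ v ∈ O, F v + q.1 * v.2 = q.2 →
        fderiv ℂ (fun u : ℂ × ℂ => F u + q.1 * u.2) v ≠ 0 := by
      refine measure_mono_null ?_ (volume_singular_levels hF)
      intro q hq
      simp only [Set.mem_compl_iff, Set.mem_ofPred_eq, not_forall, not_not, exists_prop] at hq
      obtain ⟨v, hv, h1, h2⟩ := hq
      exact ⟨v, hv, h1, h2⟩
    exact Measure.ae_ae_of_ae_prod h1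
  have hgood : ∀ η > (0 : ℝ), ∀ b₀ : ℂ, ∃ b : ℂ, b ≠ b₀ ∧ ‖b‖ < η ∧ ∀ᵐ c : ℂ, ∀ v ∈ O,
      F v + b * v.2 = c → fderiv ℂ (fun u : ℂ × ℂ => F u + b * u.2) v ≠ 0 := by
    intro η hη b₀
    have hne : ∃ᶠ b in ae (volume : Measure ℂ), b ∈ Metric.ball (0 : ℂ) η \ {b₀} := by
      rw [frequently_ae_iff]
      refine (Metric.isOpen_ball.sdiff isClosed_singleton).measure_ne_zero volume ?_
      by_cases h : b₀ = 0
      · refine ⟨((η / 2 : ℝ) : ℂ), ?_, ?_⟩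
        · simp [abs_of_pos hη, hη]
        · simp [h, hη.ne']
      · exact ⟨0, by simpa using hη, by simpa using Ne.symm h⟩
    obtain ⟨b, hb, hb'⟩ := (hne.and_eventually hN).exists
    exact ⟨b, hb.2, by simpa using hb.1, hb'⟩
  -- for a generic slope the perturbed function is constant along a line
  have hkey : ∀ b : ℂ, ‖b‖ < 1 / 4 → (∀ᵐ c : ℂ, ∀ v ∈ O,
      F v + b * v.2 = c → fderiv ℂ (fun u : ℂ × ℂ => F u + b * u.2) v ≠ 0) →
      ∀ᶠ y in 𝓝 v₀.2, F (v₀.1, y) + b * y = F v₀ + b * v₀.2 := by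
    intro b hb4 hbg
    have hι : AnalyticAt ℂ (fun y : ℂ => ((v₀.1, y) : ℂ × ℂ)) v₀.2 :=
      analyticAt_const.prod analyticAt_id
    have hg : AnalyticAt ℂ (fun y : ℂ => F (v₀.1, y) + b * y) v₀.2 :=
      ((hF v₀ hv₀).comp_of_eq hι rfl).add (analyticAt_const.mul analyticAt_id)
    rcases hg.eventually_constant_or_nhds_le_map_nhds with h | h
    · exact h
    exfalso
    have hFc : ContinuousAt F v₀ := (hF v₀ hv₀).continuousAt
    have hnear : ∀ᶠ u in 𝓝 v₀, u ∈ O ∧ C < ‖P u‖ ∧ ‖euclPair u‖ < 1 ∧ ‖F u‖ < 5 / 4 := by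
      refine (hO.eventually_mem hv₀).and (((hP.continuous.norm.tendsto v₀).eventually_const_lt
        hlt).and (((euclPair.continuous.norm.tendsto v₀).eventually_lt_const hb).and ?_))
      exact hFc.norm.eventually_lt_const (by linarith)
    have hT := (hι.continuousAt : Tendsto _ _ (𝓝 v₀)).eventually hnear
    have hT2 := h (image_mem_map hT)
    -- If the slice is not constant it is open at `v₀.2`. Regular values are dense, so one is
    -- attained so close to `v₀` that `|P| > C` still holds there.
    obtain ⟨c, ⟨y, ⟨hyO, hyP, hyb, hyF⟩, hyc⟩, hc⟩ :=
      mem_closure_iff_nhds.mp ((Measure.dense_of_ae hbg) (F (v₀.1, v₀.2) + b * v₀.2)) _ hT2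
    have hsnd : ∀ v : ℂ × ℂ, ‖v.2‖ ≤ ‖euclPair v‖ := fun v =>
      PiLp.norm_apply_le (euclPair v) 1
    -- The slope bound `1 / 4` is the budget: `|F| < 5 / 4` near `v₀` gives `|c| ≤ 3 / 2`, and then
    -- `|F| ≤ 2` on the whole level set in the ball, which makes it compact.
    have hcn : ‖c‖ ≤ 3 / 2 := by
      rw [← hyc]
      have h1 : ‖y‖ ≤ 1 := (hsnd (v₀.1, y)).trans hyb.le
      calc ‖F (v₀.1, y) + b * y‖ ≤ ‖F (v₀.1, y)‖ + ‖b‖ * ‖y‖ := by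
            rw [← norm_mul]; exact norm_add_le _ _
        _ ≤ 5 / 4 + 1 / 4 * 1 := by gcongr
        _ ≤ 3 / 2 := by norm_num
    let Y : Set (ℂ × ℂ) := {v | v ∈ O ∧ ‖euclPair v‖ ≤ 1 ∧ F v + b * v.2 = c}
    have hYF : ∀ v ∈ Y, ‖F v‖ ≤ 2 := by
      rintro v ⟨-, hv1, hv2⟩
      have h1 : ‖v.2‖ ≤ 1 := (hsnd v).trans hv1
      rw [eq_sub_of_add_eq hv2]
      calc ‖c - b * v.2‖ ≤ ‖c‖ + ‖b‖ * ‖v.2‖ := by rw [← norm_mul]; exact norm_sub_le _ _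
        _ ≤ 3 / 2 + 1 / 4 * 1 := by gcongr
        _ ≤ 2 := by norm_num
    have hYc : IsCompact Y := by
      have hcont : ContinuousOn (fun v : ℂ × ℂ => F v + b * v.2)
          {v | v ∈ O ∧ ‖F v‖ ≤ 2 ∧ ‖euclPair v‖ ≤ 1} :=
        (hF.continuousOn.mono fun v hv => hv.1).add (by fun_prop)
      have h1 := hcont.preimage_isClosed_of_isClosed hK.isClosed (isClosed_singleton (x := c))
      convert hK.of_isClosed_subset h1 Set.inter_subset_left using 1
      ext v
      exact ⟨fun hv => ⟨⟨hv.1, hYF v hv, hv.2.1⟩, hv.2.2⟩, fun hv => ⟨hv.1.1, hv.1.2.2, hv.2⟩⟩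
    have hGa : ∀ v ∈ Y, AnalyticAt ℂ (fun u : ℂ × ℂ => F u + b * u.2) v := fun v hv =>
      (hF v hv.1).add (analyticAt_const.mul analyticAt_snd)
    have := norm_le_of_compact_level (C := C) hYc hGa (fun v hv => hc v hv.1 hv.2.2)
      (fun v hv => hv.2.2) hP (fun v hv => hv.2.1)
      (fun v hv hv1 => by
        filter_upwards [hO.eventually_mem hv.1,
          (euclPair.continuous.norm.tendsto v).eventually_lt_const hv1] with u hu hu' hu''
        exact ⟨hu, hu'.le, hu''⟩)
      (fun v hv => hC v hv.1 (hYF v hv)) (v₀ := (v₀.1, y)) ⟨hyO, hyb.le, hyc⟩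
    exact absurd this (not_le.mpr hyP)
  obtain ⟨b₁, -, hb₁, hg₁⟩ := hgood (1 / 4) (by norm_num) 0
  obtain ⟨b₂, hne, hb₂, hg₂⟩ := hgood (1 / 4) (by norm_num) b₁
  have h4 : ∀ᶠ y in 𝓝[≠] v₀.2, F (v₀.1, y) + b₁ * y = F v₀ + b₁ * v₀.2 ∧
      F (v₀.1, y) + b₂ * y = F v₀ + b₂ * v₀.2 :=
    ((hkey b₁ hb₁ hg₁).and (hkey b₂ hb₂ hg₂)).filter_mono nhdsWithin_le_nhds
  obtain ⟨y, ⟨hy1, hy2⟩, hy3⟩ := (h4.and self_mem_nhdsWithin).exists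
  -- Two distinct generic slopes cannot both make `F + b y` constant along the same line.
  have : (b₂ - b₁) * (y - v₀.2) = 0 := by linear_combination hy2 - hy1
  rcases mul_eq_zero.mp this with h | h
  · exact hne (sub_eq_zero.mp h)
  · exact hy3 (sub_eq_zero.mp h)

/-! ### Brouwer's characterisation of the Cantor space -/

section CantorSpace

variable {X : Type*} [TopologicalSpace X]

/-- The clopen cell at depth `n` reached by following the choices `a`, when at depth `k` the cell
`U` is divided by `sp k U`. -/
def clopenCell (sp : ℕ → Clopens X → Clopens X) (a : ℕ → Bool) : ℕ → Clopens X
  | 0 => ⊤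
  | n + 1 => if a n then clopenCell sp a n ⊓ sp n (clopenCell sp a n)
      else clopenCell sp a n \ sp n (clopenCell sp a n)

open Classical in
/-- The clopen cell at depth `n` containing `x`. -/
noncomputable def clopenCellOf (sp : ℕ → Clopens X → Clopens X) (x : X) : ℕ → Clopens X
  | 0 => ⊤
  | n + 1 => if x ∈ sp n (clopenCellOf sp x n) then clopenCellOf sp x n ⊓ sp n (clopenCellOf sp x n)
      else clopenCellOf sp x n \ sp n (clopenCellOf sp x n)

open Classical in
/-- The sequence of choices leading to `x`. -/
noncomputable def clopenAddress (sp : ℕ → Clopens X → Clopens X) (x : X) (n : ℕ) : Bool :=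
  decide (x ∈ sp n (clopenCellOf sp x n))

open Classical in
theorem clopenCellOf_eq (sp : ℕ → Clopens X → Clopens X) (x : X) (n : ℕ) :
    clopenCellOf sp x n = clopenCell sp (clopenAddress sp x) n := by
  induction n with
  | zero => rfl
  | succ n ih =>
    simp only [clopenCellOf, clopenCell, ← ih]
    by_cases h : x ∈ sp n (clopenCellOf sp x n)
    · rw [if_pos h, if_pos (show clopenAddress sp x n = true from decide_eq_true h)]
    · rw [if_neg h, if_neg (by rw [clopenAddress, decide_eq_false h]; simp)]

theorem mem_clopenCellOf (sp : ℕ → Clopens X → Clopens X) (x : X) (n : ℕ) :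
    x ∈ clopenCellOf sp x n := by
  induction n with
  | zero => exact Set.mem_univ x
  | succ n ih =>
    simp only [clopenCellOf]
    split_ifs with h
    · exact ⟨ih, h⟩
    · exact ⟨ih, h⟩

theorem clopenCell_succ_le (sp : ℕ → Clopens X → Clopens X) (a : ℕ → Bool) (n : ℕ) :
    clopenCell sp a (n + 1) ≤ clopenCell sp a n := by
  simp only [clopenCell]
  split_ifs
  · exact inf_le_left
  · exact sdiff_le

theorem clopenCell_congr (sp : ℕ → Clopens X → Clopens X) {a b : ℕ → Bool} {n : ℕ}
    (h : ∀ m < n, a m = b m) : clopenCell sp a n = clopenCell sp b n := by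
  induction n with
  | zero => rfl
  | succ n ih =>
    simp only [clopenCell, ih fun m hm => h m (hm.trans n.lt_succ_self), h n n.lt_succ_self]

open Classical in
-- The two halves of a split are disjoint, so membership in a cell forces every earlier choice.
theorem clopenAddress_eq_of_mem (sp : ℕ → Clopens X → Clopens X) {x : X} {a : ℕ → Bool} {n : ℕ}
    (h : x ∈ clopenCell sp a n) : ∀ m < n, clopenAddress sp x m = a m := by
  induction n with
  | zero => intro m hm; exact absurd hm (Nat.not_lt_zero m)
  | succ n ih =>
    have ih' := ih (clopenCell_succ_le sp a n h)
    intro m hm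
    rcases Nat.lt_succ_iff_lt_or_eq.mp hm with hm | rfl
    · exact ih' m hm
    · have hcell : clopenCellOf sp x m = clopenCell sp a m := by
        rw [clopenCellOf_eq]; exact clopenCell_congr sp ih'
      simp only [clopenCell] at h
      rw [← hcell] at h
      split_ifs at h with ha
      · rw [ha]; exact decide_eq_true h.2
      · rw [Bool.not_eq_true] at ha; rw [ha]; exact decide_eq_false h.2

/-- **Brouwer's theorem**: a nonempty compact metrizable totally disconnected space without isolated
points is homeomorphic to the Cantor space. -/
theorem nonempty_homeomorph_nat_to_bool [CompactSpace X] [T2Space X] [SecondCountableTopology X]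
    [TotallyDisconnectedSpace X] [Nonempty X] (hX : ∀ x : X, ¬ IsOpen ({x} : Set X)) :
    Nonempty (X ≃ₜ (ℕ → Bool)) := by
  have : Countable (Clopens X) := Clopens.countable_iff_secondCountable.mpr inferInstance
  obtain ⟨C, hC⟩ := exists_surjective_nat (Clopens X)
  -- At depth `n` the `n`-th clopen set is used whenever it really cuts the cell; since `C`
  -- enumerates all clopen sets, any two points are eventually separated. Otherwise any proper cut
  -- will do, so that no cell becomes empty and every address is realised.
  have hsplit : ∀ (n : ℕ) (U : Clopens X), ∃ V : Clopens X,
      (U ≠ ⊥ → U ⊓ V ≠ ⊥ ∧ U \ V ≠ ⊥) ∧ (U ⊓ C n ≠ ⊥ → U \ C n ≠ ⊥ → V = C n) := by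
    intro n U
    by_cases h : U ⊓ C n ≠ ⊥ ∧ U \ C n ≠ ⊥
    · exact ⟨C n, fun _ => h, fun _ _ => rfl⟩
    by_cases hU : U = ⊥
    · exact ⟨⊥, fun h => absurd hU h, fun h1 h2 => absurd ⟨h1, h2⟩ h⟩
    have hne : ∃ x, x ∈ U := by
      by_contra! hx
      exact hU (Clopens.ext (Set.eq_empty_iff_forall_notMem.mpr hx))
    obtain ⟨x, hx⟩ := hne
    have hy : ∃ y ∈ U, y ≠ x := by
      by_contra! hy
      apply hX x
      convert U.isClopen.isOpen
      ext y
      exact ⟨fun h => by rw [Set.mem_singleton_iff.mp h]; exact hx, fun h => hy y h⟩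
    obtain ⟨y, hyU, hyx⟩ := hy
    obtain ⟨V, hV, hxV, hVy⟩ := compact_exists_isClopen_in_isOpen
      (isOpen_compl_singleton (x := y)) (show x ∈ ({y} : Set X)ᶜ from hyx.symm)
    refine ⟨⟨V, hV⟩, fun _ => ⟨fun h0 => ?_, fun h0 => ?_⟩, fun h1 h2 => absurd ⟨h1, h2⟩ h⟩
    · have : x ∈ U ⊓ ⟨V, hV⟩ := ⟨hx, hxV⟩
      rw [h0] at this; exact this
    · have : y ∈ U \ ⟨V, hV⟩ := ⟨hyU, fun hyV => hVy hyV rfl⟩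
      rw [h0] at this; exact this
  choose sp hsp1 hsp2 using hsplit
  have hne : ∀ a n, clopenCell sp a n ≠ ⊥ := by
    intro a n
    induction n with
    | zero =>
      intro h
      obtain ⟨x⟩ := ‹Nonempty X›
      have : x ∈ clopenCell sp a 0 := Set.mem_univ x
      rw [h] at this; exact this
    | succ n ih =>
      simp only [clopenCell]
      split_ifs
      · exact (hsp1 n _ ih).1
      · exact (hsp1 n _ ih).2
  have hcont : Continuous (clopenAddress sp) := by
    refine continuous_pi fun n => ?_
    rw [continuous_discrete_rng]
    intro b
    rw [isOpen_iff_mem_nhds]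
    intro x hx
    have hx' : clopenAddress sp x n = b := hx
    have hmem : x ∈ clopenCell sp (clopenAddress sp x) (n + 1) := by
      rw [← clopenCellOf_eq]; exact mem_clopenCellOf sp x _
    filter_upwards [(clopenCell sp (clopenAddress sp x) (n + 1)).isClopen.isOpen.mem_nhds hmem]
      with y hy
    exact (clopenAddress_eq_of_mem sp hy n n.lt_succ_self).trans hx'
  have hmem : ∀ x n, x ∈ clopenCell sp (clopenAddress sp x) n := fun x n => by
    rw [← clopenCellOf_eq]; exact mem_clopenCellOf sp x n
  have hinj : Function.Injective (clopenAddress sp) := by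
    intro x y hxy
    by_contra hne'
    obtain ⟨V, hV, hxV, hVy⟩ := compact_exists_isClopen_in_isOpen
      (isOpen_compl_singleton (x := y)) (show x ∈ ({y} : Set X)ᶜ from hne')
    obtain ⟨k, hk⟩ := hC ⟨V, hV⟩
    have hxk : x ∈ C k := by rw [hk]; exact hxV
    have hyk : y ∉ C k := by rw [hk]; exact fun h => hVy h rfl
    have hx := hmem x
    have hy := hmem y
    rw [← hxy] at hy
    have hs := hsp2 k (clopenCell sp (clopenAddress sp x) k)
      (fun h => by
        have : x ∈ clopenCell sp (clopenAddress sp x) k ⊓ C k := ⟨hx k, hxk⟩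
        rw [h] at this; exact this)
      (fun h => by
        have : y ∈ clopenCell sp (clopenAddress sp x) k \ C k := ⟨hy k, hyk⟩
        rw [h] at this; exact this)
    have hx1 := hx (k + 1)
    have hy1 := hy (k + 1)
    simp only [clopenCell, hs] at hx1 hy1
    split_ifs at hx1 hy1
    · exact hyk hy1.2
    · exact hx1.2 hxk
  have hsurj : Function.Surjective (clopenAddress sp) := by
    intro a
    have := IsCompact.nonempty_iInter_of_sequence_nonempty_isCompact_isClosed
      (fun n => (clopenCell sp a n : Set X)) (fun n => clopenCell_succ_le sp a n)
      (fun n => by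
        by_contra h
        exact hne a n (Clopens.ext (Set.not_nonempty_iff_eq_empty.mp h)))
      (clopenCell sp a 0).isClopen.isClosed.isCompact
      (fun n => (clopenCell sp a n).isClopen.isClosed)
    obtain ⟨x, hx⟩ := this
    refine ⟨x, funext fun n => ?_⟩
    exact clopenAddress_eq_of_mem sp (Set.mem_iInter.mp hx (n + 1)) n n.lt_succ_self
  exact ⟨hcont.homeoOfEquivCompactToT2 (f := Equiv.ofBijective _ ⟨hinj, hsurj⟩)⟩

end CantorSpace

/-! ### Polynomial hulls: linear images and decreasing intersections -/

section Hull

variable {n : ℕ}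

theorem polynomialHull_mono {K K' : Set (EuclideanSpace ℂ (Fin n))} (h : K ⊆ K') :
    polynomialHull K ⊆ polynomialHull K' :=
  fun _ hz p C hC => hz p C fun _ hw => hC _ (h hw)

theorem polynomialHull_subset_of_subset {K K' : Set (EuclideanSpace ℂ (Fin n))}
    (h : K ⊆ polynomialHull K') : polynomialHull K ⊆ polynomialHull K' :=
  fun _ hz p C hC => hz p C fun _ hw => h hw p C hC

theorem exists_mvPolynomial_comp_linear
    (L : EuclideanSpace ℂ (Fin n) →ₗ[ℂ] EuclideanSpace ℂ (Fin n)) (p : MvPolynomial (Fin n) ℂ) :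
    ∃ q : MvPolynomial (Fin n) ℂ, ∀ z : EuclideanSpace ℂ (Fin n),
      MvPolynomial.eval (fun i => z i) q = MvPolynomial.eval (fun i => L z i) p := by
  refine ⟨MvPolynomial.bind₁ (fun i => ∑ j, MvPolynomial.C (L (EuclideanSpace.single j 1) i) *
    MvPolynomial.X j) p, fun z => ?_⟩
  have hz : z = ∑ j, z j • EuclideanSpace.single j (1 : ℂ) := by
    ext i; simp [Finset.sum_apply, Pi.single_apply]
  have h1 : ∀ i, L z i = ∑ j, L (EuclideanSpace.single j 1) i * z j := by
    intro i
    conv_lhs => rw [hz]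
    simp [mul_comm]
  rw [← MvPolynomial.coe_aeval_eq_eval, ← MvPolynomial.coe_aeval_eq_eval]
  simp only [RingHom.coe_coe]
  rw [MvPolynomial.aeval_bind₁]
  congr 1
  simp [h1]

theorem mem_polynomialHull_image (L : EuclideanSpace ℂ (Fin n) →ₗ[ℂ] EuclideanSpace ℂ (Fin n))
    {K : Set (EuclideanSpace ℂ (Fin n))} {z : EuclideanSpace ℂ (Fin n)}
    (hz : z ∈ polynomialHull K) : L z ∈ polynomialHull (L '' K) := by
  intro p C hC
  obtain ⟨q, hq⟩ := exists_mvPolynomial_comp_linear L p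
  rw [← hq]
  refine hz q C fun w hw => ?_
  rw [hq]
  exact hC _ ⟨w, hw, rfl⟩

theorem continuous_eval_euclidean (p : MvPolynomial (Fin n) ℂ) :
    Continuous fun z : EuclideanSpace ℂ (Fin n) => MvPolynomial.eval (fun i => z i) p :=
  (MvPolynomial.continuous_eval p).comp (by fun_prop)

/-- If `|p z|` exceeded the bound by `ε`, then for some positive `η < ε` the compact sets `K k ∩
{|p| ≥ C + η}` would be nonempty and nested. A common point would contradict the bound on the
intersection. -/
theorem mem_polynomialHull_iInter {K : ℕ → Set (EuclideanSpace ℂ (Fin n))}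
    (hK : ∀ k, IsCompact (K k)) (hanti : ∀ k, K (k + 1) ⊆ K k) {z : EuclideanSpace ℂ (Fin n)}
    (hz : ∀ k, z ∈ polynomialHull (K k)) : z ∈ polynomialHull (⋂ k, K k) := by
  intro p C hC
  refine le_of_forall_pos_lt_add fun ε hε => ?_
  by_contra! hlt
  have hc := (continuous_eval_euclidean p).norm
  obtain ⟨η, hη0, hηε⟩ := exists_between hε
  have hne : (⋂ k, K k ∩ {w | C + η ≤ ‖MvPolynomial.eval (fun i => w i) p‖}).Nonempty := by
    refine IsCompact.nonempty_iInter_of_sequence_nonempty_isCompact_isClosed _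
      (fun k => Set.inter_subset_inter_left _ (hanti k)) (fun k => ?_)
      ((hK 0).inter_right (isClosed_le continuous_const hc))
      (fun k => (hK k).isClosed.inter (isClosed_le continuous_const hc))
    by_contra hemp
    have := hz k p (C + η) fun w hw => by
      by_contra! hw'
      exact hemp ⟨w, hw, hw'.le⟩
    linarith
  obtain ⟨w, hw⟩ := hne
  have hw' := Set.mem_iInter.mp hw
  have h1 := hC w (Set.mem_iInter.mpr fun k => (hw' k).1)
  have h2 : C + η ≤ _ := (hw' 0).2
  linarith

theorem polynomialHull_empty : polynomialHull (∅ : Set (EuclideanSpace ℂ (Fin n))) = ∅ := by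
  ext z
  refine ⟨fun hz => ?_, fun hz => hz.elim⟩
  have := hz 0 (-1) (by simp)
  simp at this
  linarith

end Hull

/-! ### Tubes in the sphere -/

section Tubes

/-- The part of the unit sphere lying over a closed pseudohyperbolic disc with centre `ζ` and
radius `ρ` under the projection to the complex direction `p`. -/
def sphereTube (p : EuclideanSpace ℂ (Fin 2)) (ζ : ℂ) (ρ : ℝ) : Set (EuclideanSpace ℂ (Fin 2)) :=
  {z | ‖z‖ = 1 ∧ ‖inner ℂ p z - ζ‖ ≤ ρ * ‖1 - (starRingEnd ℂ) ζ * inner ℂ p z‖}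

/-- A pair of concentric solid tori in the unit sphere of `ℂ²`. -/
structure TubePair where
  dir : EuclideanSpace ℂ (Fin 2)
  center : ℂ
  r : ℝ
  R : ℝ
  norm_dir : ‖dir‖ = 1
  norm_center : ‖center‖ < 1
  r_pos : 0 < r
  r_lt : r < R
  R_lt : R < 1

/-- The smaller torus. -/
def TubePair.core (T : TubePair) : Set (EuclideanSpace ℂ (Fin 2)) :=
  sphereTube T.dir T.center T.r

/-- The larger torus. -/
def TubePair.outer (T : TubePair) : Set (EuclideanSpace ℂ (Fin 2)) :=
  sphereTube T.dir T.center T.R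

theorem sphereTube_mono (p : EuclideanSpace ℂ (Fin 2)) (ζ : ℂ) {ρ ρ' : ℝ} (h : ρ ≤ ρ') :
    sphereTube p ζ ρ ⊆ sphereTube p ζ ρ' := fun _ hz =>
  ⟨hz.1, hz.2.trans (mul_le_mul_of_nonneg_right h (norm_nonneg _))⟩

theorem TubePair.core_subset_outer (T : TubePair) : T.core ⊆ T.outer :=
  sphereTube_mono _ _ T.r_lt.le

theorem isCompact_sphereTube (p : EuclideanSpace ℂ (Fin 2)) (ζ : ℂ) (ρ : ℝ) :
    IsCompact (sphereTube p ζ ρ) := by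
  have h : IsClosed {z : EuclideanSpace ℂ (Fin 2) |
      ‖inner ℂ p z - ζ‖ ≤ ρ * ‖1 - (starRingEnd ℂ) ζ * inner ℂ p z‖} :=
    isClosed_le (by fun_prop) (by fun_prop)
  have h2 : sphereTube p ζ ρ = Metric.sphere 0 1 ∩ {z : EuclideanSpace ℂ (Fin 2) |
      ‖inner ℂ p z - ζ‖ ≤ ρ * ‖1 - (starRingEnd ℂ) ζ * inner ℂ p z‖} := by
    ext z
    exact ⟨fun h => ⟨by simpa using h.1, h.2⟩, fun h => ⟨by simpa using h.1, h.2⟩⟩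
  rw [h2]
  exact (isCompact_sphere 0 1).inter_right h

theorem TubePair.outer_nonempty (T : TubePair) : T.outer.Nonempty := by
  have hs : 0 ≤ 1 - ‖T.center‖ ^ 2 := by nlinarith [T.norm_center, norm_nonneg T.center]
  -- A unit vector orthogonal to the direction: adding the right multiple of it to `center • dir`
  -- gives a point of the sphere lying exactly over the centre.
  set q : EuclideanSpace ℂ (Fin 2) := !₂[-(starRingEnd ℂ) (T.dir 1), (starRingEnd ℂ) (T.dir 0)]
    with hq
  have hpq : inner ℂ T.dir q = 0 := by
    simp [PiLp.inner_apply, Fin.sum_univ_two, hq]; ring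
  have hqn : ‖q‖ = 1 := by
    have h1 := T.norm_dir
    rw [EuclideanSpace.norm_eq] at h1 ⊢
    simpa [hq, Fin.sum_univ_two, add_comm] using h1
  have hin : inner ℂ T.dir (T.center • T.dir + (Real.sqrt (1 - ‖T.center‖ ^ 2) : ℂ) • q)
      = T.center := by
    rw [inner_add_right, inner_smul_right, inner_smul_right, hpq, inner_self_eq_norm_sq_to_K,
      T.norm_dir]
    simp
  refine ⟨T.center • T.dir + (Real.sqrt (1 - ‖T.center‖ ^ 2) : ℂ) • q, ?_, ?_⟩
  · have h := norm_add_sq_eq_norm_sq_add_norm_sq_of_inner_eq_zero (𝕜 := ℂ) (T.center • T.dir)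
      ((Real.sqrt (1 - ‖T.center‖ ^ 2) : ℂ) • q)
      (by rw [inner_smul_left, inner_smul_right, hpq]; simp)
    rw [norm_smul, norm_smul, T.norm_dir, hqn, Complex.norm_real, Real.norm_eq_abs,
      abs_of_nonneg (Real.sqrt_nonneg _)] at h
    have h2 := Real.mul_self_sqrt hs
    have h3 : ‖T.center • T.dir + (Real.sqrt (1 - ‖T.center‖ ^ 2) : ℂ) • q‖ ^ 2 = 1 := by
      nlinarith
    exact (pow_eq_one_iff_of_nonneg (norm_nonneg _) two_ne_zero).mp h3
  · rw [hin]
    simp only [sub_self, norm_zero]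
    exact mul_nonneg (T.r_pos.trans T.r_lt).le (norm_nonneg _)

end Tubes

/-! ### Refinement of stages and the limit Cantor set -/

/-- A finite family of disjoint tubes whose cores have a ball of radius greater than `β` in their
polynomial hull. -/
def IsTubeStage (β : ℝ) (𝒮 : Set TubePair) : Prop :=
  𝒮.Finite ∧ 𝒮.PairwiseDisjoint TubePair.outer ∧
    ∃ b, β < b ∧ Metric.closedBall 0 b ⊆ polynomialHull (⋃ T ∈ 𝒮, T.core)

/-- The tube `T` can be replaced by finitely many small disjoint tubes inside it, at the cost of
shrinking its core by a factor `1 - δ`, for all small `δ`. -/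
def TubePair.Divisible (T : TubePair) : Prop :=
  ∃ δ₀ > (0 : ℝ), ∀ δ, 0 < δ → δ < δ₀ → ∀ ε > (0 : ℝ), ∃ 𝒮 : Set TubePair,
    𝒮.Finite ∧ 𝒮.Nontrivial ∧ 𝒮.PairwiseDisjoint TubePair.outer ∧
    (∀ T' ∈ 𝒮, T'.outer ⊆ T.outer ∧ ∀ z ∈ T'.outer, ∀ w ∈ T'.outer, dist z w ≤ ε) ∧
    ∀ z ∈ T.core, ((1 - δ : ℝ) : ℂ) • z ∈ polynomialHull (⋃ T' ∈ 𝒮, T'.core)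

/-- Scaling by `1 - δ` is linear, so it carries the hull of the old cores into the hull of the
scaled cores, and these lie in the hull of the new cores. The radius drops to `(1 - δ) b`, still
above `β` for small `δ`; finiteness of the stage gives one `δ` for all tubes. -/
theorem IsTubeStage.exists_refinement {β : ℝ} (hdiv : ∀ T : TubePair, T.Divisible)
    {𝒮 : Set TubePair} (h𝒮 : IsTubeStage β 𝒮) {ε : ℝ} (hε : 0 < ε) :
    ∃ 𝒮' : Set TubePair, IsTubeStage β 𝒮' ∧
      (∀ T' ∈ 𝒮', ∃ T ∈ 𝒮, T'.outer ⊆ T.outer) ∧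
      (∀ T' ∈ 𝒮', ∀ z ∈ T'.outer, ∀ w ∈ T'.outer, dist z w ≤ ε) ∧
      ∀ T ∈ 𝒮, ∃ T₁ ∈ 𝒮', ∃ T₂ ∈ 𝒮', T₁ ≠ T₂ ∧ T₁.outer ⊆ T.outer ∧ T₂.outer ⊆ T.outer := by
  obtain ⟨hfin, hdisj, b, hb, hball⟩ := h𝒮
  choose δ₀ hδ₀ hsub using hdiv
  obtain ⟨δ, hδ, hδ1, hδb, hδT⟩ : ∃ δ : ℝ, 0 < δ ∧ δ < 1 ∧ β < (1 - δ) * b ∧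
      ∀ T ∈ 𝒮, δ < δ₀ T := by
    have h1 : ∀ᶠ δ : ℝ in 𝓝[>] 0, 0 < δ := self_mem_nhdsWithin
    have h2 : ∀ᶠ δ : ℝ in 𝓝[>] 0, δ < 1 :=
      (eventually_lt_nhds one_pos).filter_mono nhdsWithin_le_nhds
    have h3 : ∀ᶠ δ : ℝ in 𝓝[>] 0, β < (1 - δ) * b := by
      have : Tendsto (fun δ : ℝ => (1 - δ) * b) (𝓝 0) (𝓝 ((1 - 0) * b)) :=
        Continuous.tendsto (by fun_prop) 0
      exact (this.eventually_const_lt (by simpa using hb)).filter_mono nhdsWithin_le_nhds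
    have h4 : ∀ᶠ δ : ℝ in 𝓝[>] 0, ∀ T ∈ 𝒮, δ < δ₀ T :=
      (hfin.eventually_all.mpr fun T _ => eventually_lt_nhds (hδ₀ T)).filter_mono
        nhdsWithin_le_nhds
    obtain ⟨δ, ⟨⟨h1, h2⟩, h3⟩, h4⟩ := (((h1.and h2).and h3).and h4).exists
    exact ⟨δ, h1, h2, h3, h4⟩
  have hsub' : ∀ T : TubePair, ∃ 𝒮' : Set TubePair, T ∈ 𝒮 → 𝒮'.Finite ∧ 𝒮'.Nontrivial ∧
      𝒮'.PairwiseDisjoint TubePair.outer ∧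
      (∀ T' ∈ 𝒮', T'.outer ⊆ T.outer ∧ ∀ z ∈ T'.outer, ∀ w ∈ T'.outer, dist z w ≤ ε) ∧
      ∀ z ∈ T.core, ((1 - δ : ℝ) : ℂ) • z ∈ polynomialHull (⋃ T' ∈ 𝒮', T'.core) := by
    intro T
    by_cases hT : T ∈ 𝒮
    · obtain ⟨𝒮', h⟩ := hsub T δ hδ (hδT T hT) ε hε
      exact ⟨𝒮', fun _ => h⟩
    · exact ⟨∅, fun h => absurd h hT⟩
  choose ch hch using hsub'
  refine ⟨⋃ T ∈ 𝒮, ch T, ⟨hfin.biUnion fun T hT => (hch T hT).1, ?_, (1 - δ) * b, hδb, ?_⟩,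
    ?_, ?_, ?_⟩
  · intro A hA B hB hAB
    simp only [Set.mem_iUnion, exists_prop] at hA hB
    obtain ⟨T, hT, hAT⟩ := hA
    obtain ⟨T', hT', hBT⟩ := hB
    by_cases h : T = T'
    · subst h
      exact (hch T hT).2.2.1 hAT hBT hAB
    · exact Set.disjoint_of_subset ((hch T hT).2.2.2.1 A hAT).1 ((hch T' hT').2.2.2.1 B hBT).1
        (hdisj hT hT' h)
  · intro z hz
    have hδ' : ((1 - δ : ℝ) : ℂ) ≠ 0 := by
      rw [Complex.ofReal_ne_zero]; linarith
    set L : EuclideanSpace ℂ (Fin 2) →ₗ[ℂ] EuclideanSpace ℂ (Fin 2) :=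
      ((1 - δ : ℝ) : ℂ) • LinearMap.id with hL
    set z' := ((1 - δ : ℝ) : ℂ)⁻¹ • z with hz'
    have hzz : L z' = z := by
      simp only [hL, hz', LinearMap.smul_apply, LinearMap.id_apply, smul_smul]
      rw [mul_inv_cancel₀ hδ', one_smul]
    have hz'b : z' ∈ Metric.closedBall (0 : EuclideanSpace ℂ (Fin 2)) b := by
      rw [mem_closedBall_zero_iff] at hz ⊢
      rw [hz', norm_smul, norm_inv, Complex.norm_real, Real.norm_eq_abs,
        abs_of_pos (by linarith), inv_mul_le_iff₀ (by linarith)]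
      exact hz
    rw [← hzz]
    refine polynomialHull_subset_of_subset ?_ (mem_polynomialHull_image L (hball hz'b))
    rintro _ ⟨w, hw, rfl⟩
    simp only [Set.mem_iUnion, exists_prop] at hw
    obtain ⟨T, hT, hwT⟩ := hw
    refine polynomialHull_mono ?_ ((hch T hT).2.2.2.2 w hwT)
    exact Set.biUnion_mono (Set.subset_biUnion_of_mem (u := ch) hT) fun _ _ => subset_rfl
  · intro A hA
    simp only [Set.mem_iUnion, exists_prop] at hA
    obtain ⟨T, hT, hAT⟩ := hA
    exact ⟨T, hT, ((hch T hT).2.2.2.1 A hAT).1⟩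
  · intro A hA
    simp only [Set.mem_iUnion, exists_prop] at hA
    obtain ⟨T, hT, hAT⟩ := hA
    exact ((hch T hT).2.2.2.1 A hAT).2
  · intro T hT
    obtain ⟨A, hA, B, hB, hAB⟩ := (hch T hT).2.1
    exact ⟨A, Set.mem_biUnion hT hA, B, Set.mem_biUnion hT hB, hAB,
      ((hch T hT).2.2.2.1 A hA).1, ((hch T hT).2.2.2.1 B hB).1⟩

/-- A tube around the complex line `z₂`-axis has a large ball in its hull. -/
theorem exists_isTubeStage {β : ℝ} (hβ0 : 0 < β) (hβ1 : β < 1) :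
    ∃ 𝒮 : Set TubePair, IsTubeStage β 𝒮 := by
  obtain ⟨b, hb, hb1⟩ := exists_between hβ1
  obtain ⟨R, hR, hR1⟩ := exists_between hb1
  let T : TubePair :=
    { dir := EuclideanSpace.single 0 1
      center := 0
      r := b
      R := R
      norm_dir := by simp
      norm_center := by simp
      r_pos := hβ0.trans hb
      r_lt := hR
      R_lt := hR1 }
  refine ⟨{T}, Set.finite_singleton T, Set.pairwiseDisjoint_singleton _ _, b, hb, ?_⟩
  intro z hz p C hC
  rw [mem_closedBall_zero_iff] at hz
  simp only [Set.mem_singleton_iff, Set.iUnion_iUnion_eq_left] at hC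
  have hz0 : ‖z 0‖ ≤ b := (PiLp.norm_apply_le z 0).trans hz
  have hnz : ‖z‖ ^ 2 = ‖z 0‖ ^ 2 + ‖z 1‖ ^ 2 := by
    rw [EuclideanSpace.norm_sq_eq, Fin.sum_univ_two]
  set ρ := Real.sqrt (1 - ‖z 0‖ ^ 2) with hρ
  have hpos : 0 < 1 - ‖z 0‖ ^ 2 := by nlinarith [norm_nonneg (z 0)]
  have hρ0 : 0 < ρ := Real.sqrt_pos.mpr hpos
  have hρ2 : ρ ^ 2 = 1 - ‖z 0‖ ^ 2 := Real.sq_sqrt hpos.le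
  -- On the vertical disc through `z`, the boundary circle lies on the sphere over the same first
  -- coordinate, hence in the core; the one-variable maximum principle suffices.
  let f : ℂ → ℂ := fun y => MvPolynomial.eval (fun i => euclPair (z 0, y) i) p
  have hf : Differentiable ℂ f := by
    have h1 : ∀ y, AnalyticAt ℂ (fun y : ℂ => MvPolynomial.aeval (fun i => euclPair (z 0, y) i) p) y :=
      fun y => AnalyticAt.aeval_mvPolynomial (fun i => by
        fin_cases i
        · exact analyticAt_const
        · exact analyticAt_id) p
    exact fun y => (h1 y).differentiableAt
  have hzf : MvPolynomial.eval (fun i => z i) p = f (z 1) := by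
    simp only [f]
    congr 1
    congr 1
    ext i; fin_cases i <;> rfl
  rw [hzf]
  refine Complex.norm_le_of_forall_mem_frontier_norm_le (U := Metric.ball 0 ρ)
    Metric.isBounded_ball hf.diffContOnCl (fun y hy => hC (euclPair (z 0, y)) ?_) ?_
  · rw [frontier_ball _ hρ0.ne', mem_sphere_zero_iff_norm] at hy
    constructor
    · have h2 : ‖euclPair (z 0, y)‖ ^ 2 = 1 := by
        rw [EuclideanSpace.norm_sq_eq, Fin.sum_univ_two]
        simp only [euclPair_apply_zero, euclPair_apply_one, hy, hρ2]
        ring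
      exact (pow_eq_one_iff_of_nonneg (norm_nonneg _) two_ne_zero).mp h2
    · simpa [T, EuclideanSpace.inner_single_left] using hz0
  · rw [closure_ball _ hρ0.ne', mem_closedBall_zero_iff]
    apply Real.le_sqrt_of_sq_le
    nlinarith [norm_nonneg z]

/-- If every tube is divisible there are Cantor sets in the sphere with large hull. -/
theorem exists_isCantorSet_of_divisible (hdiv : ∀ T : TubePair, T.Divisible) {β : ℝ}
    (hβ0 : 0 < β) (hβ1 : β < 1) :
    ∃ E : Set (EuclideanSpace ℂ (Fin 2)), IsCantorSet E ∧
      E ⊆ Metric.sphere (0 : EuclideanSpace ℂ (Fin 2)) 1 ∧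
      Metric.closedBall (0 : EuclideanSpace ℂ (Fin 2)) β ⊆ polynomialHull E := by
  have hstep : ∀ (n : ℕ) (s : {𝒮 // IsTubeStage β 𝒮}), ∃ s' : {𝒮 // IsTubeStage β 𝒮},
      (∀ T' ∈ s'.1, ∃ T ∈ s.1, T'.outer ⊆ T.outer) ∧
      (∀ T' ∈ s'.1, ∀ z ∈ T'.outer, ∀ w ∈ T'.outer, dist z w ≤ 1 / (n + 1 : ℝ)) ∧
      ∀ T ∈ s.1, ∃ T₁ ∈ s'.1, ∃ T₂ ∈ s'.1, T₁ ≠ T₂ ∧ T₁.outer ⊆ T.outer ∧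
        T₂.outer ⊆ T.outer := by
    intro n s
    obtain ⟨𝒮', h, h'⟩ := s.2.exists_refinement hdiv (Nat.one_div_pos_of_nat (n := n))
    exact ⟨⟨𝒮', h⟩, h'⟩
  choose next hnext1 hnext2 hnext3 using hstep
  obtain ⟨𝒮₀, h𝒮₀⟩ := exists_isTubeStage hβ0 hβ1
  let st : ℕ → {𝒮 // IsTubeStage β 𝒮} := fun n => Nat.rec ⟨𝒮₀, h𝒮₀⟩ next n
  have hst : ∀ n, st (n + 1) = next n (st n) := fun n => rfl
  let K : ℕ → Set (EuclideanSpace ℂ (Fin 2)) := fun n => ⋃ T ∈ (st n).1, T.outer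
  have hKc : ∀ n, IsCompact (K n) := fun n =>
    (st n).2.1.isCompact_biUnion fun T _ => isCompact_sphereTube _ _ _
  have hKa : ∀ n, K (n + 1) ⊆ K n := by
    intro n z hz
    simp only [K, Set.mem_iUnion, exists_prop] at hz ⊢
    obtain ⟨T', hT', hz⟩ := hz
    obtain ⟨T, hT, hTT⟩ := hnext1 n (st n) T' hT'
    exact ⟨T, hT, hTT hz⟩
  have hKh : ∀ n, Metric.closedBall 0 β ⊆ polynomialHull (K n) := by
    intro n
    obtain ⟨-, -, b, hb, hball⟩ := (st n).2
    refine (Metric.closedBall_subset_closedBall hb.le).trans (hball.trans (polynomialHull_mono ?_))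
    exact Set.biUnion_mono subset_rfl fun T _ => T.core_subset_outer
  set E := ⋂ n, K n with hE
  have hhull : Metric.closedBall 0 β ⊆ polynomialHull E := fun z hz =>
    mem_polynomialHull_iInter hKc hKa fun n => hKh n hz
  have hEc : IsCompact E := (hKc 0).of_isClosed_subset
    (isClosed_iInter fun n => (hKc n).isClosed) (Set.iInter_subset _ 0)
  have hEne : E.Nonempty := by
    rw [Set.nonempty_iff_ne_empty]
    intro h
    have := hhull (Metric.mem_closedBall_self hβ0.le)
    rw [h, polynomialHull_empty] at this
    exact this
  -- every tube of the construction meets the limit set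
  have hmeet : ∀ n, ∀ T ∈ (st n).1, (T.outer ∩ E).Nonempty := by
    intro n T hT
    have hsq : ∀ k, (T.outer ∩ K (n + k)).Nonempty := by
      intro k
      have : ∃ T' ∈ (st (n + k)).1, T'.outer ⊆ T.outer := by
        induction k with
        | zero => exact ⟨T, hT, subset_rfl⟩
        | succ k ih =>
          obtain ⟨T', hT', hTT⟩ := ih
          obtain ⟨T₁, hT₁, -, -, -, h, -⟩ := hnext3 (n + k) (st (n + k)) T' hT'
          exact ⟨T₁, hT₁, h.trans hTT⟩
      obtain ⟨T', hT', hTT⟩ := this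
      obtain ⟨z, hz⟩ := T'.outer_nonempty
      exact ⟨z, hTT hz, Set.mem_biUnion hT' hz⟩
    have hne := IsCompact.nonempty_iInter_of_sequence_nonempty_isCompact_isClosed
      (fun k => T.outer ∩ K (n + k)) (fun k => Set.inter_subset_inter_right _ (hKa (n + k))) hsq
      ((isCompact_sphereTube _ _ _).inter (hKc n))
      (fun k => (isCompact_sphereTube _ _ _).isClosed.inter (hKc _).isClosed)
    obtain ⟨z, hz⟩ := hne
    have hz' := Set.mem_iInter.mp hz
    have hanti : Antitone K := antitone_nat_of_succ_le hKa
    exact ⟨z, (hz' 0).1, Set.mem_iInter.mpr fun k => hanti (Nat.le_add_left k n) (hz' k).2⟩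
  have hcell : ∀ n, ∀ x ∈ E, ∃ T ∈ (st n).1, x ∈ T.outer := fun n x hx => by
    have := Set.mem_iInter.mp hx n
    simpa only [K, Set.mem_iUnion, exists_prop] using this
  -- Two disjoint children of each tube both meet `E`, so no point of `E` is isolated.
  have hne1 : ∀ n, ∀ T ∈ (st n).1, ∀ x ∈ E, x ∈ T.outer → ∃ y ∈ E, y ∈ T.outer ∧ y ≠ x := by
    intro n T hT x hx hxT
    obtain ⟨T₁, hT₁, T₂, hT₂, h12, hs1, hs2⟩ := hnext3 n (st n) T hT
    have hd : Disjoint T₁.outer T₂.outer := (st (n + 1)).2.2.1 hT₁ hT₂ h12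
    by_cases hx1 : x ∈ T₁.outer
    · obtain ⟨y, hy, hyE⟩ := hmeet (n + 1) T₂ hT₂
      exact ⟨y, hyE, hs2 hy, fun h => Set.disjoint_left.mp hd hx1 (h ▸ hy)⟩
    · obtain ⟨y, hy, hyE⟩ := hmeet (n + 1) T₁ hT₁
      exact ⟨y, hyE, hs1 hy, fun h => hx1 (h ▸ hy)⟩
  refine ⟨E, ?_, ?_, hhull⟩
  · have : CompactSpace E := isCompact_iff_compactSpace.mp hEc
    have : Nonempty E := hEne.to_subtype
    have hclopen : ∀ n, ∀ T ∈ (st n).1, IsClopen ((↑) ⁻¹' T.outer : Set E) := by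
      intro n T hT
      have hcl : ∀ T : TubePair, IsClosed ((↑) ⁻¹' T.outer : Set E) := fun T =>
        (isCompact_sphereTube _ _ _).isClosed.preimage continuous_subtype_val
      refine ⟨hcl T, ?_⟩
      rw [← isClosed_compl_iff]
      have : ((↑) ⁻¹' T.outer : Set E)ᶜ = ⋃ T' ∈ (st n).1 \ {T}, ((↑) ⁻¹' T'.outer : Set E) := by
        ext x
        simp only [Set.mem_compl_iff, Set.mem_preimage, Set.mem_iUnion, exists_prop]
        constructor
        · intro hx
          obtain ⟨T', hT', hxT'⟩ := hcell n x x.2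
          exact ⟨T', ⟨hT', fun h => hx (h ▸ hxT')⟩, hxT'⟩
        · rintro ⟨T', ⟨hT', hne⟩, hxT'⟩ hxT
          exact Set.disjoint_left.mp ((st n).2.2.1 hT hT' (Ne.symm hne)) hxT hxT'
      rw [this]
      exact ((st n).2.1.subset Set.sdiff_subset).isClosed_biUnion fun T' _ => hcl T'
    have hTS : TotallySeparatedSpace E := by
      rw [totallySeparatedSpace_iff_exists_isClopen]
      intro x y hxy
      obtain ⟨n, hn⟩ := exists_nat_one_div_lt (dist_pos.mpr hxy)
      obtain ⟨T, hT, hxT⟩ := hcell (n + 1) x x.2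
      refine ⟨_, hclopen (n + 1) T hT, hxT, fun hyT => ?_⟩
      have := hnext2 n (st n) T hT x hxT y hyT
      exact absurd this (not_le.mpr hn)
    have hiso : ∀ x : E, ¬ IsOpen ({x} : Set E) := by
      intro x hx
      obtain ⟨ε, hε, hball⟩ := Metric.isOpen_iff.mp hx x rfl
      obtain ⟨n, hn⟩ := exists_nat_one_div_lt hε
      obtain ⟨T, hT, hxT⟩ := hcell (n + 1) x x.2
      obtain ⟨y, hyE, hyT, hyx⟩ := hne1 (n + 1) T hT x x.2 hxT
      have hd := hnext2 n (st n) T hT y hyT x hxT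
      have : (⟨y, hyE⟩ : E) ∈ ({x} : Set E) := hball (lt_of_le_of_lt hd hn)
      exact hyx (congrArg Subtype.val this)
    obtain ⟨e⟩ := nonempty_homeomorph_nat_to_bool hiso
    exact ⟨e.trans cantorSetHomeomorphNatToBool.symm⟩
  · intro z hz
    obtain ⟨T, -, hzT⟩ := hcell 0 z hz
    rw [mem_sphere_zero_iff_norm]
    exact hzT.1

/-! ### Separation of roots and a greedy choice -/

section Roots

theorem norm_pow_sub_pow_le_mul {u v : ℂ} (hu : ‖u‖ ≤ 1) (hv : ‖v‖ ≤ 1) (n : ℕ) :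
    ‖u ^ n - v ^ n‖ ≤ n * ‖u - v‖ := by
  induction n with
  | zero => simp
  | succ n ih =>
    have h : u ^ (n + 1) - v ^ (n + 1) = u * (u ^ n - v ^ n) + (u - v) * v ^ n := by ring
    rw [h]
    calc ‖u * (u ^ n - v ^ n) + (u - v) * v ^ n‖
        ≤ ‖u‖ * ‖u ^ n - v ^ n‖ + ‖u - v‖ * ‖v‖ ^ n := by
          rw [← norm_pow, ← norm_mul, ← norm_mul]; exact norm_add_le _ _
      _ ≤ 1 * (n * ‖u - v‖) + ‖u - v‖ * 1 := by
          gcongr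
          exact pow_le_one₀ (norm_nonneg _) hv
      _ = ((n + 1 : ℕ) : ℝ) * ‖u - v‖ := by push_cast; ring

/-- The powers of `u` sum to zero, so `∑ (1 - u ^ i) = n`, while each term is at most `n * ‖u - 1‖`.
The bound is crude, but only its polynomial size in `n` matters. -/
theorem one_div_le_norm_sub_one_of_pow_eq_one {u : ℂ} {n : ℕ} (hn : n ≠ 0) (hu : u ^ n = 1)
    (h1 : u ≠ 1) : 1 / (n : ℝ) ≤ ‖u - 1‖ := by
  have hn' : (0 : ℝ) < n := Nat.cast_pos.mpr (Nat.pos_of_ne_zero hn)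
  have hnu : ‖u‖ = 1 := by
    have h2 := congrArg norm hu
    rw [norm_pow, norm_one] at h2
    exact (pow_eq_one_iff_of_nonneg (norm_nonneg _) hn).mp h2
  have hs : ∑ i ∈ Finset.range n, u ^ i = 0 := by
    have := geom_sum_mul u n
    rw [hu, sub_self] at this
    exact (mul_eq_zero.mp this).resolve_right (sub_ne_zero.mpr h1)
  have h2 : ∑ i ∈ Finset.range n, (1 - u ^ i) = (n : ℂ) := by
    rw [Finset.sum_sub_distrib, hs]; simp
  have h3 : (n : ℝ) ≤ n * (n * ‖u - 1‖) := by
    calc (n : ℝ) = ‖∑ i ∈ Finset.range n, (1 - u ^ i)‖ := by rw [h2]; simp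
      _ ≤ ∑ i ∈ Finset.range n, ‖1 - u ^ i‖ := norm_sum_le _ _
      _ ≤ ∑ i ∈ Finset.range n, n * ‖u - 1‖ := by
          refine Finset.sum_le_sum fun i hi => ?_
          have := norm_pow_sub_pow_le_mul (u := 1) (v := u) (by simp) hnu.le i
          rw [one_pow, norm_sub_rev 1 u] at this
          refine this.trans ?_
          gcongr
          exact_mod_cast (Finset.mem_range.mp hi).le
      _ = n * (n * ‖u - 1‖) := by simp
  rw [div_le_iff₀ hn']
  have := le_of_mul_le_mul_left (by linarith : (n : ℝ) * 1 ≤ n * (n * ‖u - 1‖)) hn'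
  linarith

theorem one_div_le_norm_sub_of_pow_eq {u v : ℂ} {n : ℕ} (hn : n ≠ 0) (hv : ‖v‖ = 1)
    (hu : u ^ n = v ^ n) (h1 : u ≠ v) : 1 / (n : ℝ) ≤ ‖u - v‖ := by
  have hv0 : v ≠ 0 := norm_ne_zero_iff.mp (by rw [hv]; exact one_ne_zero)
  have := one_div_le_norm_sub_one_of_pow_eq_one (u := u / v) hn
    (by rw [div_pow, hu, div_self (pow_ne_zero _ hv0)])
    (fun h => h1 ((div_eq_one_iff_eq hv0).mp h))
  rwa [div_sub_one hv0, norm_div, hv, div_one] at this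

/-- Divide `y` by the `n`-th root `exp (log u / n)` of `u = ω * y ^ n`; since `u` is close to `1`,
this divisor is within a multiple of `e` of `1`, uniformly in `n`. -/
theorem exists_root_near {ω y : ℂ} {n : ℕ} {e : ℝ} (hn : n ≠ 0) (hω : ‖ω‖ = 1) (he : e ≤ 1 / 2)
    (h : ‖1 - ω * y ^ n‖ < e) : ∃ α : ℂ, α ^ n * ω = 1 ∧ ‖α‖ = 1 ∧ ‖y - α‖ ≤ 4 * e := by
  have hn1 : (1 : ℝ) ≤ n := by exact_mod_cast Nat.one_le_iff_ne_zero.mpr hn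
  have hnC : (n : ℂ) ≠ 0 := Nat.cast_ne_zero.mpr hn
  have hω0 : ω ≠ 0 := norm_ne_zero_iff.mp (by rw [hω]; exact one_ne_zero)
  set u := ω * y ^ n with hu
  have hu1 : ‖u - 1‖ < e := by rwa [norm_sub_rev]
  have hu0 : u ≠ 0 := by
    rintro h0
    rw [h0] at hu1
    simp at hu1
    linarith
  have hlog : ‖Complex.log u‖ ≤ 3 / 2 * ‖u - 1‖ := by
    have := Complex.norm_log_one_add_half_le_self (z := u - 1) (hu1.le.trans he)
    rwa [add_sub_cancel] at this
  set l := Complex.log u / n with hl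
  have hln : ‖l‖ ≤ 3 / 2 * e := by
    rw [hl, norm_div, Complex.norm_natCast]
    calc ‖Complex.log u‖ / n ≤ ‖Complex.log u‖ / 1 := by gcongr
      _ ≤ 3 / 2 * e := by rw [div_one]; linarith
  have hexp : Complex.exp l ^ n = u := by
    rw [← Complex.exp_nat_mul, hl, mul_div_cancel₀ _ hnC, Complex.exp_log hu0]
  have hα : (y / Complex.exp l) ^ n * ω = 1 := by
    rw [div_pow, hexp, hu, div_mul_eq_mul_div, mul_comm (y ^ n), div_self hu0]
  have hα1 : ‖y / Complex.exp l‖ = 1 := by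
    have h2 := congrArg norm hα
    rw [norm_mul, hω, mul_one, norm_pow, norm_one] at h2
    exact (pow_eq_one_iff_of_nonneg (norm_nonneg _) hn).mp h2
  refine ⟨y / Complex.exp l, hα, hα1, ?_⟩
  have h3 : y - y / Complex.exp l = (y / Complex.exp l) * (Complex.exp l - 1) := by
    field_simp [Complex.exp_ne_zero]
  rw [h3, norm_mul, hα1, one_mul]
  have h4 := Complex.norm_exp_sub_one_le (x := l) (by linarith)
  have : 0 ≤ e := (norm_nonneg _).trans hu1.le
  linarith

/-- Greedy choice: each index already treated excludes at most `k` values for the next one. -/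
theorem exists_avoiding_assignment {ι κ : Type*} (t : Finset ι) (U : Finset κ)
    (bad : ι → ι → κ → κ → Prop) (k : ℕ) (hsymm : ∀ i j a b, bad i j a b → bad j i b a)
    (hbad : ∀ i ∈ t, ∀ j ∈ t, i ≠ j → ∀ b ∈ U, ∃ s : Finset κ, s.card ≤ k ∧
      ∀ a ∈ U, bad i j a b → a ∈ s) (hU : k * t.card < U.card) :
    ∃ ω : ι → κ, (∀ i ∈ t, ω i ∈ U) ∧ ∀ i ∈ t, ∀ j ∈ t, i ≠ j → ¬ bad i j (ω i) (ω j) := by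
  classical
  induction t using Finset.induction_on with
  | empty =>
    obtain ⟨a, -⟩ : U.Nonempty := Finset.card_pos.mp (by omega)
    exact ⟨fun _ => a, by simp, by simp⟩
  | insert i t hi ih =>
    rw [Finset.card_insert_of_notMem hi] at hU
    obtain ⟨ω, hωU, hω⟩ := ih
      (fun a ha b hb => hbad a (Finset.mem_insert_of_mem ha) b (Finset.mem_insert_of_mem hb))
      (lt_of_le_of_lt (Nat.mul_le_mul_left k (Nat.le_succ _)) hU)
    have hch : ∀ j, ∃ s : Finset κ, j ∈ t → s.card ≤ k ∧ ∀ a ∈ U, bad i j a (ω j) → a ∈ s := by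
      intro j
      by_cases hj : j ∈ t
      · obtain ⟨s, hs⟩ := hbad i (Finset.mem_insert_self i t) j (Finset.mem_insert_of_mem hj)
          (fun h => hi (h ▸ hj)) (ω j) (hωU j hj)
        exact ⟨s, fun _ => hs⟩
      · exact ⟨∅, fun h => absurd h hj⟩
    choose s hs using hch
    have hcard : (t.biUnion s).card < U.card := by
      refine lt_of_le_of_lt ?_ hU
      calc (t.biUnion s).card ≤ ∑ j ∈ t, (s j).card := Finset.card_biUnion_le
        _ ≤ ∑ j ∈ t, k := Finset.sum_le_sum fun j hj => (hs j hj).1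
        _ ≤ k * (t.card + 1) := by simp [mul_comm]; exact Nat.mul_le_mul_left k (Nat.le_succ _)
    obtain ⟨a, haU, has⟩ := Finset.exists_mem_notMem_of_card_lt_card hcard
    have hai : ∀ j ∈ t, ¬ bad i j a (ω j) := fun j hj hb =>
      has (Finset.mem_biUnion.mpr ⟨j, hj, (hs j hj).2 a haU hb⟩)
    have hup : ∀ j ∈ t, Function.update ω i a j = ω j := fun j hj =>
      Function.update_of_ne (fun h => hi (by rw [← h]; exact hj)) _ _
    refine ⟨Function.update ω i a, fun j hj => ?_, fun j hj l hl hjl => ?_⟩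
    · rcases Finset.mem_insert.mp hj with rfl | hj
      · simpa using haU
      · rw [hup j hj]; exact hωU j hj
    · rcases Finset.mem_insert.mp hj with hj' | hj <;> rcases Finset.mem_insert.mp hl with hl' | hl
      · exact absurd (hj'.trans hl'.symm) hjl
      · rw [hup l hl, hj', Function.update_self]; exact hai l hl
      · rw [hup j hj, hl', Function.update_self]; exact fun h => hai j hj (hsymm _ _ _ _ h)
      · rw [hup j hj, hup l hl]; exact hω j hj l hl hjl

end Roots

/-! ### The Möbius coordinate on the ball and the sphere -/

section Hyperbolic

/-- The second coordinate after the ball automorphism moving the complex line `z₁ = ξ` to the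
`z₂`-axis. -/
noncomputable def moebiusCoord (ξ : ℂ) (v : ℂ × ℂ) : ℂ :=
  Real.sqrt (1 - ‖ξ‖ ^ 2) * v.2 / (1 - (starRingEnd ℂ) ξ * v.1)

theorem norm_euclPair_sq (v : ℂ × ℂ) : ‖euclPair v‖ ^ 2 = ‖v.1‖ ^ 2 + ‖v.2‖ ^ 2 := by
  rw [EuclideanSpace.norm_sq_eq, Fin.sum_univ_two]; rfl

theorem norm_one_sub_conj_mul_sq (ξ x : ℂ) :
    ‖1 - (starRingEnd ℂ) ξ * x‖ ^ 2 = ‖x - ξ‖ ^ 2 + (1 - ‖x‖ ^ 2) * (1 - ‖ξ‖ ^ 2) := by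
  rw [Complex.sq_norm, Complex.sq_norm, Complex.sq_norm, Complex.sq_norm]
  simp only [Complex.normSq_apply, Complex.sub_re, Complex.sub_im, Complex.mul_re, Complex.mul_im,
    Complex.conj_re, Complex.conj_im, Complex.one_re, Complex.one_im]
  ring

theorem one_sub_norm_le_norm_one_sub {ξ x : ℂ} (hx : ‖x‖ ≤ 1) :
    1 - ‖ξ‖ ≤ ‖1 - (starRingEnd ℂ) ξ * x‖ := by
  have h1 := norm_sub_norm_le (1 : ℂ) ((starRingEnd ℂ) ξ * x)
  rw [norm_one, norm_mul, RCLike.norm_conj] at h1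
  nlinarith [norm_nonneg ξ]

theorem one_sub_conj_mul_ne_zero {ξ x : ℂ} (hξ : ‖ξ‖ < 1) (hx : ‖x‖ ≤ 1) :
    1 - (starRingEnd ℂ) ξ * x ≠ 0 := by
  rw [← norm_pos_iff]
  linarith [one_sub_norm_le_norm_one_sub (ξ := ξ) hx]

theorem norm_one_sub_conj_mul_le {ξ x : ℂ} (hξ : ‖ξ‖ ≤ 1) (hx : ‖x‖ ≤ 1) :
    ‖1 - (starRingEnd ℂ) ξ * x‖ ≤ 2 := by
  have h1 := norm_sub_le (1 : ℂ) ((starRingEnd ℂ) ξ * x)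
  rw [norm_one, norm_mul, RCLike.norm_conj] at h1
  nlinarith [norm_nonneg ξ, norm_nonneg x]

theorem norm_moebiusCoord_sq {ξ : ℂ} (hξ : ‖ξ‖ ≤ 1) (v : ℂ × ℂ) :
    ‖moebiusCoord ξ v‖ ^ 2 =
      (1 - ‖ξ‖ ^ 2) * ‖v.2‖ ^ 2 / ‖1 - (starRingEnd ℂ) ξ * v.1‖ ^ 2 := by
  have h : 0 ≤ 1 - ‖ξ‖ ^ 2 := by nlinarith [norm_nonneg ξ]
  rw [moebiusCoord, norm_div, norm_mul, Complex.norm_real, Real.norm_eq_abs,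
    abs_of_nonneg (Real.sqrt_nonneg _), div_pow, mul_pow, Real.sq_sqrt h]

theorem norm_fst_le_norm_euclPair (v : ℂ × ℂ) : ‖v.1‖ ≤ ‖euclPair v‖ := PiLp.norm_apply_le (euclPair v) 0

/-- From `|v₂|² ≤ ρ² (1 - |v₁|²)` and the identity for `|1 - ξ̄ x|²`. With `ρ = 1 - δ` it bounds
every `w_ξ` on the shrunken core independently of `ξ`. -/
theorem norm_moebiusCoord_le {ξ : ℂ} (hξ : ‖ξ‖ < 1) {v : ℂ × ℂ} {ρ : ℝ} (hρ : ρ ≤ 1)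
    (hv : ‖euclPair v‖ ≤ ρ) : ‖moebiusCoord ξ v‖ ≤ ρ := by
  have hρ0 : 0 ≤ ρ := (norm_nonneg _).trans hv
  have hx : ‖v.1‖ ≤ 1 := (norm_fst_le_norm_euclPair v).trans (hv.trans hρ)
  have hD := norm_pos_iff.mpr (one_sub_conj_mul_ne_zero hξ hx)
  refine le_of_sq_le_sq ?_ hρ0
  rw [norm_moebiusCoord_sq hξ.le, div_le_iff₀ (by positivity), norm_one_sub_conj_mul_sq]
  have h1 : ‖v.1‖ ^ 2 + ‖v.2‖ ^ 2 ≤ ρ ^ 2 := by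
    rw [← norm_euclPair_sq]; exact pow_le_pow_left₀ (norm_nonneg _) hv 2
  have h2 : 0 < 1 - ‖ξ‖ ^ 2 := by nlinarith [norm_nonneg ξ]
  have h3 : ‖v.2‖ ^ 2 ≤ ρ ^ 2 * (1 - ‖v.1‖ ^ 2) := by
    have : ρ ^ 2 * ‖v.1‖ ^ 2 ≤ 1 * ‖v.1‖ ^ 2 := by
      gcongr
      exact pow_le_one₀ hρ0 hρ
    linarith
  have h4 : 0 ≤ ρ ^ 2 * ‖v.1 - ξ‖ ^ 2 := by positivity
  nlinarith [mul_le_mul_of_nonneg_left h3 h2.le]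

theorem norm_moebiusCoord_sq_of_sphere {ξ : ℂ} (hξ : ‖ξ‖ < 1) {v : ℂ × ℂ}
    (hv : ‖euclPair v‖ = 1) : ‖moebiusCoord ξ v‖ ^ 2 =
      (1 - ‖ξ‖ ^ 2) * (1 - ‖v.1‖ ^ 2) / ‖1 - (starRingEnd ℂ) ξ * v.1‖ ^ 2 := by
  have h1 := norm_euclPair_sq v
  rw [hv] at h1
  rw [norm_moebiusCoord_sq hξ.le, show ‖v.2‖ ^ 2 = 1 - ‖v.1‖ ^ 2 by linarith]

/-- On the sphere `|w_ξ|²` is one minus the squared pseudohyperbolic distance. So tubes are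
superlevel sets of `|w_ξ|`, a form that also makes sense inside the ball. -/
theorem norm_sub_le_mul_iff_of_sphere {ξ : ℂ} (hξ : ‖ξ‖ < 1) {v : ℂ × ℂ} (hv : ‖euclPair v‖ = 1)
    {ρ : ℝ} (hρ : 0 ≤ ρ) : ‖v.1 - ξ‖ ≤ ρ * ‖1 - (starRingEnd ℂ) ξ * v.1‖ ↔
      1 - ρ ^ 2 ≤ ‖moebiusCoord ξ v‖ ^ 2 := by
  have hx : ‖v.1‖ ≤ 1 := (norm_fst_le_norm_euclPair v).trans hv.le
  have hD := norm_pos_iff.mpr (one_sub_conj_mul_ne_zero hξ hx)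
  rw [norm_moebiusCoord_sq_of_sphere hξ hv, le_div_iff₀ (by positivity),
    ← sq_le_sq₀ (norm_nonneg _) (by positivity), mul_pow]
  have := norm_one_sub_conj_mul_sq ξ v.1
  constructor <;> intro h <;> nlinarith

theorem eq_of_one_le_norm_moebiusCoord {ξ : ℂ} (hξ : ‖ξ‖ < 1) {v : ℂ × ℂ}
    (hv : ‖euclPair v‖ ≤ 1) (h : 1 ≤ ‖moebiusCoord ξ v‖) : v.1 = ξ ∧ ‖euclPair v‖ = 1 := by
  have hv1 : ‖euclPair v‖ = 1 := le_antisymm hv (by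
    by_contra! hlt
    exact absurd (norm_moebiusCoord_le hξ hv le_rfl) (not_le.mpr (hlt.trans_le h)))
  refine ⟨?_, hv1⟩
  have := (norm_sub_le_mul_iff_of_sphere hξ hv1 le_rfl).mpr (by nlinarith)
  rw [zero_mul] at this
  exact sub_eq_zero.mp (norm_le_zero_iff.mp this)

theorem norm_lt_one_of_norm_sub_le {ζ x : ℂ} {ρ : ℝ} (hζ : ‖ζ‖ < 1) (hρ0 : 0 ≤ ρ) (hρ : ρ < 1)
    (hx : ‖x‖ ≤ 1) (h : ‖x - ζ‖ ≤ ρ * ‖1 - (starRingEnd ℂ) ζ * x‖) : ‖x‖ < 1 := by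
  refine lt_of_le_of_ne hx fun h1 => ?_
  have h2 := norm_one_sub_conj_mul_sq ζ x
  rw [h1] at h2
  have hD := norm_pos_iff.mpr (one_sub_conj_mul_ne_zero hζ hx)
  have h3 := pow_le_pow_left₀ (norm_nonneg _) h 2
  have h4 : ρ ^ 2 < 1 := by nlinarith
  have h5 : 0 < ‖1 - (starRingEnd ℂ) ζ * x‖ ^ 2 := by positivity
  rw [mul_pow] at h3
  nlinarith

end Hyperbolic

/-! ### The peak product and its compact sublevel set -/

section Peak

theorem continuousAt_moebiusCoord {ξ : ℂ} {v : ℂ × ℂ} (h : 1 - (starRingEnd ℂ) ξ * v.1 ≠ 0) :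
    ContinuousAt (fun q : ℂ × (ℂ × ℂ) => moebiusCoord q.1 q.2) (ξ, v) := by
  unfold moebiusCoord
  refine ContinuousAt.div ?_ ?_ h
  · fun_prop
  · have : Continuous fun q : ℂ × (ℂ × ℂ) => 1 - (starRingEnd ℂ) q.1 * q.2.1 := by fun_prop
    exact this.continuousAt

theorem analyticAt_moebiusCoord {ξ : ℂ} {v : ℂ × ℂ} (h : 1 - (starRingEnd ℂ) ξ * v.1 ≠ 0) :
    AnalyticAt ℂ (moebiusCoord ξ) v := by
  unfold moebiusCoord
  exact (analyticAt_const.mul analyticAt_snd).div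
    (analyticAt_const.sub (analyticAt_const.mul analyticAt_fst)) h

theorem isCompact_euclPair_ball : IsCompact {v : ℂ × ℂ | ‖euclPair v‖ ≤ 1} := by
  have h : {v : ℂ × ℂ | ‖euclPair v‖ ≤ 1} =
      euclPair.toHomeomorph ⁻¹' Metric.closedBall 0 1 := by
    ext v
    simp
  rw [h]
  exact euclPair.toHomeomorph.isCompact_preimage.mpr (isCompact_closedBall 0 1)

/-- Scaling by `1 - δ` multiplies the numerator of `w_ζ` by `1 - δ` and the modulus of the
denominator by at most `1 + δ / (1 - ‖ζ‖)`; both factors tend to `1`. -/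
theorem exists_moebiusCoord_shrink {ζ : ℂ} (hζ : ‖ζ‖ < 1) {l l' : ℝ} (hl' : 0 < l') (hl : l' < l) :
    ∃ δ₀ > (0 : ℝ), ∀ δ, 0 < δ → δ < δ₀ → δ < 1 ∧ ∀ v : ℂ × ℂ, ‖euclPair v‖ = 1 →
      l ≤ ‖moebiusCoord ζ v‖ → l' ≤ ‖moebiusCoord ζ (((1 - δ : ℝ) : ℂ) • v)‖ := by
  have hev : ∀ᶠ δ : ℝ in 𝓝 0, l' * (1 + δ / (1 - ‖ζ‖)) < (1 - δ) * l := by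
    have h1 : Tendsto (fun δ : ℝ => l' * (1 + δ / (1 - ‖ζ‖))) (𝓝 0)
        (𝓝 (l' * (1 + 0 / (1 - ‖ζ‖)))) := by
      apply Continuous.tendsto; fun_prop
    have h2 : Tendsto (fun δ : ℝ => (1 - δ) * l) (𝓝 0) (𝓝 ((1 - 0) * l)) := by
      apply Continuous.tendsto; fun_prop
    exact h1.eventually_lt h2 (by simpa using hl)
  obtain ⟨δ₀, hδ₀, h⟩ := Metric.eventually_nhds_iff.mp (hev.and (eventually_lt_nhds one_pos))
  refine ⟨δ₀, hδ₀, fun δ hδ hlt => ?_⟩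
  obtain ⟨h1, h2⟩ := h (y := δ) (by rwa [Real.dist_0_eq_abs, abs_of_pos hδ])
  refine ⟨h2, fun v hv hlv => ?_⟩
  have hx : ‖v.1‖ ≤ 1 := (norm_fst_le_norm_euclPair v).trans hv.le
  have hζ' : 0 < 1 - ‖ζ‖ := by linarith
  have hs : ‖((1 - δ : ℝ) : ℂ)‖ = 1 - δ := by
    rw [Complex.norm_real, Real.norm_eq_abs, abs_of_pos (by linarith)]
  set D := 1 - (starRingEnd ℂ) ζ * v.1 with hD
  set D' := 1 - (starRingEnd ℂ) ζ * (((1 - δ : ℝ) : ℂ) * v.1) with hD'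
  have hDpos : 0 < ‖D‖ := norm_pos_iff.mpr (one_sub_conj_mul_ne_zero hζ hx)
  have hDlow : 1 - ‖ζ‖ ≤ ‖D‖ := one_sub_norm_le_norm_one_sub hx
  have hD'pos : 0 < ‖D'‖ := norm_pos_iff.mpr (one_sub_conj_mul_ne_zero hζ (by
    rw [norm_mul, hs]; nlinarith [norm_nonneg v.1]))
  have hDD : ‖D'‖ ≤ ‖D‖ * (1 + δ / (1 - ‖ζ‖)) := by
    have e : D' = D + δ * ((starRingEnd ℂ) ζ * v.1) := by
      rw [hD, hD']; push_cast; ring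
    have h3 : ‖(δ : ℂ) * ((starRingEnd ℂ) ζ * v.1)‖ ≤ δ := by
      rw [norm_mul, norm_mul, RCLike.norm_conj, Complex.norm_real, Real.norm_eq_abs, abs_of_pos hδ]
      have : ‖ζ‖ * ‖v.1‖ ≤ 1 := mul_le_one₀ hζ.le (norm_nonneg _) hx
      nlinarith
    have h4 : δ ≤ ‖D‖ * (δ / (1 - ‖ζ‖)) := by
      rw [mul_div_assoc', le_div_iff₀ hζ']
      nlinarith
    rw [e, mul_add, mul_one]
    exact (norm_add_le _ _).trans (by linarith)
  have hw : ‖moebiusCoord ζ (((1 - δ : ℝ) : ℂ) • v)‖ * ‖D'‖ =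
      (1 - δ) * (‖moebiusCoord ζ v‖ * ‖D‖) := by
    unfold moebiusCoord
    simp only [Prod.smul_fst, Prod.smul_snd, smul_eq_mul]
    rw [← hD, ← hD', norm_div, norm_div, div_mul_cancel₀ _ hDpos.ne', div_mul_cancel₀ _ hD'pos.ne',
      mul_left_comm, norm_mul, hs]
  by_contra! hcon
  have h5 : ‖moebiusCoord ζ (((1 - δ : ℝ) : ℂ) • v)‖ * ‖D'‖ ≤
      l' * (‖D‖ * (1 + δ / (1 - ‖ζ‖))) :=
    mul_le_mul hcon.le hDD (norm_nonneg _) hl'.le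
  have h6 : (1 - δ) * (l * ‖D‖) ≤ (1 - δ) * (‖moebiusCoord ζ v‖ * ‖D‖) := by
    have : 0 ≤ 1 - δ := by linarith
    gcongr
  nlinarith

/-- In the closed ball `|w_ξ| = 1` happens only on the sphere over `ξ`, where `hl` gives `|w_ζ| >
l`. Compactness turns the strict inequality into a uniform `a < 1`. -/
theorem exists_moebiusCoord_lt_one {C : Set ℂ} (hC : IsCompact C) (hC1 : ∀ ξ ∈ C, ‖ξ‖ < 1) {ζ : ℂ}
    (hζ : ‖ζ‖ < 1) {l : ℝ}
    (hl : ∀ v : ℂ × ℂ, ‖euclPair v‖ = 1 → v.1 ∈ C → l < ‖moebiusCoord ζ v‖) :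
    ∃ a : ℝ, 0 ≤ a ∧ a < 1 ∧ ∀ ξ ∈ C, ∀ v : ℂ × ℂ, ‖euclPair v‖ ≤ 1 → ‖moebiusCoord ζ v‖ ≤ l →
      ‖moebiusCoord ξ v‖ ≤ a := by
  have hcζ : ContinuousOn (fun v => ‖moebiusCoord ζ v‖) {v : ℂ × ℂ | ‖euclPair v‖ ≤ 1} :=
    fun v hv => (analyticAt_moebiusCoord (one_sub_conj_mul_ne_zero hζ
      ((norm_fst_le_norm_euclPair v).trans hv))).continuousAt.norm.continuousWithinAt
  have hK : IsCompact ({v : ℂ × ℂ | ‖euclPair v‖ ≤ 1} ∩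
      (fun v => ‖moebiusCoord ζ v‖) ⁻¹' Set.Iic l) :=
    isCompact_euclPair_ball.of_isClosed_subset (hcζ.preimage_isClosed_of_isClosed
      isCompact_euclPair_ball.isClosed isClosed_Iic) Set.inter_subset_left
  have hP := hC.prod hK
  have hcont : ContinuousOn (fun q : ℂ × (ℂ × ℂ) => ‖moebiusCoord q.1 q.2‖)
      (C ×ˢ ({v : ℂ × ℂ | ‖euclPair v‖ ≤ 1} ∩ (fun v => ‖moebiusCoord ζ v‖) ⁻¹' Set.Iic l)) :=
    fun q hq => (continuousAt_moebiusCoord (one_sub_conj_mul_ne_zero (hC1 _ hq.1)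
      ((norm_fst_le_norm_euclPair q.2).trans hq.2.1))).norm.continuousWithinAt
  rcases Set.eq_empty_or_nonempty
      (C ×ˢ ({v : ℂ × ℂ | ‖euclPair v‖ ≤ 1} ∩ (fun v => ‖moebiusCoord ζ v‖) ⁻¹' Set.Iic l))
    with he | hne
  · refine ⟨0, le_rfl, one_pos, fun ξ hξ v hv hvl => ?_⟩
    have : (ξ, v) ∈ C ×ˢ ({v : ℂ × ℂ | ‖euclPair v‖ ≤ 1} ∩
      (fun v => ‖moebiusCoord ζ v‖) ⁻¹' Set.Iic l) := ⟨hξ, hv, hvl⟩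
    rw [he] at this
    exact this.elim
  · obtain ⟨q, hq, hmax⟩ := hP.exists_isMaxOn hne hcont
    refine ⟨‖moebiusCoord q.1 q.2‖, norm_nonneg _, ?_, fun ξ hξ v hv hvl => ?_⟩
    · by_contra! h1
      obtain ⟨h2, h3⟩ := eq_of_one_le_norm_moebiusCoord (hC1 _ hq.1) hq.2.1 h1
      exact absurd (hl q.2 h3 (by rw [h2]; exact hq.1)) (not_lt.mpr hq.2.2)
    · exact isMaxOn_iff.mp hmax (ξ, v) ⟨hξ, hv, hvl⟩

/-- On the sphere over `ξ` one has `|w_ξ| = 1 > 1 / μ`. This is an open condition on the first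
coordinate, so finitely many `ξ` suffice. -/
theorem exists_finset_cover {C : Set ℂ} (hC : IsCompact C) (hC1 : ∀ ξ ∈ C, ‖ξ‖ < 1) {μ : ℝ}
    (hμ : 1 < μ) : ∃ t : Finset ℂ, (∀ ξ ∈ t, ξ ∈ C) ∧ ∀ v : ℂ × ℂ, ‖euclPair v‖ = 1 → v.1 ∈ C →
      ∃ ξ ∈ t, 1 < μ * ‖moebiusCoord ξ v‖ := by
  obtain ⟨t, ht, hcov⟩ := hC.elim_nhds_subcover
    (fun ξ => {x : ℂ | ‖1 - (starRingEnd ℂ) ξ * x‖ ^ 2 < μ ^ 2 * ((1 - ‖ξ‖ ^ 2) * (1 - ‖x‖ ^ 2))})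
    (fun ξ hξ => by
      refine IsOpen.mem_nhds (isOpen_lt (by fun_prop) (by fun_prop)) ?_
      have h1 : 0 < 1 - ‖ξ‖ ^ 2 := by nlinarith [hC1 ξ hξ, norm_nonneg ξ]
      rw [Set.mem_ofPred_eq, norm_one_sub_conj_mul_sq, sub_self, norm_zero]
      have h2 : 0 < (1 - ‖ξ‖ ^ 2) * (1 - ‖ξ‖ ^ 2) := by positivity
      have h3 : 1 < μ ^ 2 := by nlinarith
      have h4 := mul_lt_mul_of_pos_right h3 h2
      linarith)
  refine ⟨t, ht, fun v hv hvC => ?_⟩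
  obtain ⟨ξ, hξ, hx⟩ := Set.mem_iUnion₂.mp (hcov hvC)
  refine ⟨ξ, hξ, ?_⟩
  rw [Set.mem_ofPred_eq] at hx
  have hξ1 := hC1 ξ (ht ξ hξ)
  have hD := norm_pos_iff.mpr (one_sub_conj_mul_ne_zero hξ1
    ((norm_fst_le_norm_euclPair v).trans hv.le))
  have hμ0 : 0 < μ := by linarith
  refine lt_of_pow_lt_pow_left₀ 2 (by positivity) ?_
  rw [mul_pow, norm_moebiusCoord_sq_of_sphere hξ1 hv, one_pow, ← mul_div_assoc,
    one_lt_div (by positivity)]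
  exact hx

/-- The function whose bounded sublevel set joins the points near the origin to small tubes. -/
noncomputable def peakProduct (t : Finset ℂ) (ω : ℂ → ℂ) (Λ l : ℝ) (ζ : ℂ) (N m : ℕ)
    (v : ℂ × ℂ) : ℂ :=
  (∏ ξ ∈ t, (1 - ω ξ * (Λ * moebiusCoord ξ v) ^ N)) * (l / moebiusCoord ζ v) ^ m

theorem norm_peakProduct (t : Finset ℂ) (ω : ℂ → ℂ) (Λ : ℝ) {l : ℝ} (hl : 0 ≤ l) (ζ : ℂ)
    (N m : ℕ) (v : ℂ × ℂ) : ‖peakProduct t ω Λ l ζ N m v‖ =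
      (∏ ξ ∈ t, ‖1 - ω ξ * (Λ * moebiusCoord ξ v) ^ N‖) * (l / ‖moebiusCoord ζ v‖) ^ m := by
  rw [peakProduct, norm_mul, norm_prod, norm_pow, norm_div, Complex.norm_real, Real.norm_eq_abs,
    abs_of_nonneg hl]

theorem analyticAt_peakProduct {t : Finset ℂ} {ω : ℂ → ℂ} {Λ l : ℝ} {ζ : ℂ} {N m : ℕ}
    {v : ℂ × ℂ} (hζ : 1 - (starRingEnd ℂ) ζ * v.1 ≠ 0)
    (ht : ∀ ξ ∈ t, 1 - (starRingEnd ℂ) ξ * v.1 ≠ 0) (hw : moebiusCoord ζ v ≠ 0) :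
    AnalyticAt ℂ (peakProduct t ω Λ l ζ N m) v := by
  unfold peakProduct
  refine AnalyticAt.mul ?_ ((analyticAt_const.div (analyticAt_moebiusCoord hζ) hw).pow m)
  refine Finset.analyticAt_fun_prod _ fun ξ hξ => ?_
  exact analyticAt_const.sub (analyticAt_const.mul
    ((analyticAt_const.mul (analyticAt_moebiusCoord (ht ξ hξ))).pow N))

theorem norm_one_sub_mul_pow_ge {ω y : ℂ} {ν : ℝ} {N : ℕ} (hω : ‖ω‖ = 1) (hν : ν ≤ 1)
    (hy : ‖y‖ ≤ ν) (hN : N ≠ 0) : 1 - ν ≤ ‖1 - ω * y ^ N‖ := by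
  have h1 := norm_sub_norm_le (1 : ℂ) (ω * y ^ N)
  rw [norm_one, norm_mul, hω, one_mul, norm_pow] at h1
  have h2 : ‖y‖ ^ N ≤ ‖y‖ := pow_le_of_le_one (norm_nonneg _) (hy.trans hν) hN
  linarith

/-- On `|w_ζ| = l''` each factor is at least `1 - ν`, so `hside` gives `|F| > 2`. The set `{|F| ≤
2}` therefore stays away from the side and is compact in the ball, which is what the maximum
principle for sublevel sets requires. -/
theorem mem_polynomialHull_of_peakProduct {t : Finset ℂ} {ω : ℂ → ℂ} {Λ l l'' ν : ℝ} {ζ : ℂ}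
    {N m : ℕ} {K : Set (ℂ × ℂ)} (hζ : ‖ζ‖ < 1) (ht : ∀ ξ ∈ t, ‖ξ‖ < 1) (hω : ∀ ξ ∈ t, ‖ω ξ‖ = 1)
    (hl : 0 < l) (hl'' : 0 < l'') (hν : ν ≤ 1) (hN : N ≠ 0) (hΛ : 0 ≤ Λ)
    (hbump : ∀ ξ ∈ t, ∀ v : ℂ × ℂ, ‖euclPair v‖ ≤ 1 → ‖moebiusCoord ζ v‖ ≤ l'' →
      Λ * ‖moebiusCoord ξ v‖ ≤ ν)
    (hside : 2 < (1 - ν) ^ t.card * (l / l'') ^ m)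
    (hK : ∀ v : ℂ × ℂ, ‖euclPair v‖ = 1 → l'' < ‖moebiusCoord ζ v‖ →
      ‖peakProduct t ω Λ l ζ N m v‖ ≤ 2 → v ∈ K)
    {v₀ : ℂ × ℂ} (hv₀ : ‖euclPair v₀‖ ≤ 1) (hw₀ : l'' < ‖moebiusCoord ζ v₀‖)
    (hF₀ : ‖peakProduct t ω Λ l ζ N m v₀‖ ≤ 1) :
    euclPair v₀ ∈ polynomialHull (euclPair '' K) := by
  intro p C hC
  set D : ℂ → ℂ × ℂ → ℂ := fun ξ v => 1 - (starRingEnd ℂ) ξ * v.1 with hD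
  have hDc : ∀ ξ, Continuous (D ξ) := fun ξ => by simp only [hD]; fun_prop
  set U : Set (ℂ × ℂ) := {v | D ζ v ≠ 0 ∧ ∀ ξ ∈ t, D ξ v ≠ 0} with hU
  have hUo : IsOpen U := by
    have : U = {v | D ζ v ≠ 0} ∩ ⋂ ξ ∈ t, {v | D ξ v ≠ 0} := by
      ext v; simp [hU]
    rw [this]
    exact (isOpen_ne_fun (hDc ζ) continuous_const).inter
      (isOpen_biInter_finset fun ξ _ => isOpen_ne_fun (hDc ξ) continuous_const)
  have hBU : ∀ v : ℂ × ℂ, ‖euclPair v‖ ≤ 1 → v ∈ U := fun v hv =>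
    have hx := (norm_fst_le_norm_euclPair v).trans hv
    ⟨one_sub_conj_mul_ne_zero hζ hx, fun ξ hξ => one_sub_conj_mul_ne_zero (ht ξ hξ) hx⟩
  have hwU : ContinuousOn (fun v => ‖moebiusCoord ζ v‖) U := fun v hv =>
    (analyticAt_moebiusCoord hv.1).continuousAt.norm.continuousWithinAt
  have hO : IsOpen (U ∩ (fun v => ‖moebiusCoord ζ v‖) ⁻¹' Set.Ioi l'') :=
    hwU.isOpen_inter_preimage hUo isOpen_Ioi
  have hF : AnalyticOnNhd ℂ (peakProduct t ω Λ l ζ N m)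
      (U ∩ (fun v => ‖moebiusCoord ζ v‖) ⁻¹' Set.Ioi l'') := fun v hv =>
    analyticAt_peakProduct hv.1.1 hv.1.2 (norm_pos_iff.mp (hl''.trans hv.2))
  have hP : Differentiable ℂ fun v : ℂ × ℂ => MvPolynomial.eval (fun i => euclPair v i) p := by
    intro v
    have h1 : ∀ i : Fin 2, AnalyticAt ℂ (fun v : ℂ × ℂ => euclPair v i) v := by
      intro i
      fin_cases i
      · simpa using analyticAt_fst
      · simpa using analyticAt_snd
    have h2 := AnalyticAt.aeval_mvPolynomial h1 p
    exact h2.differentiableAt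
  have hcl : IsCompact ({v : ℂ × ℂ | ‖euclPair v‖ ≤ 1} ∩
      (fun v => ‖moebiusCoord ζ v‖) ⁻¹' Set.Ici l'') :=
    isCompact_euclPair_ball.of_isClosed_subset ((hwU.mono hBU).preimage_isClosed_of_isClosed
      isCompact_euclPair_ball.isClosed isClosed_Ici) Set.inter_subset_left
  have hFc : ContinuousOn (fun v => ‖peakProduct t ω Λ l ζ N m v‖) ({v : ℂ × ℂ | ‖euclPair v‖ ≤ 1} ∩
      (fun v => ‖moebiusCoord ζ v‖) ⁻¹' Set.Ici l'') := fun v hv =>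
    (analyticAt_peakProduct (hBU v hv.1).1 (hBU v hv.1).2
      (norm_pos_iff.mp (hl''.trans_le hv.2))).continuousAt.norm.continuousWithinAt
  have hbd : ∀ v : ℂ × ℂ, ‖euclPair v‖ ≤ 1 → ‖moebiusCoord ζ v‖ = l'' →
      2 < ‖peakProduct t ω Λ l ζ N m v‖ := by
    intro v hv hvl
    rw [norm_peakProduct _ _ _ hl.le, hvl]
    refine hside.trans_le ?_
    gcongr
    rw [← Finset.prod_const]
    refine Finset.prod_le_prod (fun _ _ => by linarith) fun ξ hξ => ?_
    refine norm_one_sub_mul_pow_ge (hω ξ hξ) hν ?_ hN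
    rw [norm_mul, Complex.norm_real, Real.norm_eq_abs, abs_of_nonneg hΛ]
    exact hbump ξ hξ v hv hvl.le
  have hcomp : IsCompact {v | v ∈ U ∩ (fun v => ‖moebiusCoord ζ v‖) ⁻¹' Set.Ioi l'' ∧
      ‖peakProduct t ω Λ l ζ N m v‖ ≤ 2 ∧ ‖euclPair v‖ ≤ 1} := by
    refine Eq.subst (motive := IsCompact) ?_ (hcl.of_isClosed_subset (hFc.preimage_isClosed_of_isClosed
      hcl.isClosed (isClosed_Iic (a := (2 : ℝ)))) Set.inter_subset_left)
    ext v
    simp only [Set.mem_inter_iff, Set.mem_preimage, Set.mem_Ici, Set.mem_Iic, Set.mem_Ioi,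
      Set.mem_ofPred_eq]
    constructor
    · rintro ⟨⟨h4, h2⟩, h3⟩
      refine ⟨⟨hBU v h4, lt_of_le_of_ne h2 fun heq => ?_⟩, h3, h4⟩
      exact absurd (hbd v h4 heq.symm) (not_lt.mpr h3)
    · rintro ⟨⟨-, h2⟩, h3, h4⟩
      exact ⟨⟨h4, h2.le⟩, h3⟩
  exact norm_le_of_compact_sublevel hO hF hP hcomp
    (fun v hv hv2 hv1 => hC _ ⟨v, hK v hv1 hv.2 hv2, rfl⟩) ⟨hBU v₀ hv₀, hw₀⟩ hF₀ hv₀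

end Peak

/-! ### Choice of the parameters of the peak product -/

section PeakFamily

/-- Suppose all factors are at least `θ ^ m`. If `|w_ζ| ≤ l'`, the power of `l / w_ζ` alone makes
`|F| > 4`. If `|w_ζ| > l'`, a covering `ξ` gives a factor of size at least `μ ^ (s m) / 2`, which
outweighs both the other factors and the possibly small power; then `|F| > 2`. -/
theorem exists_factor_lt_of_norm_peakProduct_le {t : Finset ℂ} {ω : ℂ → ℂ} {Λ l l' μ θ : ℝ} {ζ : ℂ}
    {s m : ℕ} {v : ℂ × ℂ} (hω : ∀ ξ ∈ t, ‖ω ξ‖ = 1) (hζ : ‖ζ‖ < 1) (hv : ‖euclPair v‖ = 1)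
    (hl : 0 < l) (hl' : 0 < l') (hw : 0 < ‖moebiusCoord ζ v‖) (hθ : 0 < θ) (hθ1 : θ ≤ 1)
    (hμ : 1 ≤ μ) (hμs : l / l' ≤ μ ^ s * l) (hμm : 2 ≤ (μ ^ s) ^ m)
    (hH : 4 < (θ ^ t.card * (l / l')) ^ m)
    (hcov : l' ≤ ‖moebiusCoord ζ v‖ → ∃ ξ ∈ t, μ ≤ ‖Λ * moebiusCoord ξ v‖)
    (hF : ‖peakProduct t ω Λ l ζ (s * m) m v‖ ≤ 2) :
    ∃ ξ ∈ t, ‖1 - ω ξ * (Λ * moebiusCoord ξ v) ^ (s * m)‖ < θ ^ m := by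
  by_contra! hcon
  rw [norm_peakProduct _ _ _ hl.le] at hF
  have hθm : (θ ^ m) ^ t.card = (θ ^ t.card) ^ m := by rw [← pow_mul, ← pow_mul, mul_comm]
  rcases le_or_gt (‖moebiusCoord ζ v‖) l' with hcase | hcase
  · have h1 : (θ ^ m) ^ t.card ≤ ∏ ξ ∈ t, ‖1 - ω ξ * (Λ * moebiusCoord ξ v) ^ (s * m)‖ := by
      rw [← Finset.prod_const]
      exact Finset.prod_le_prod (fun _ _ => by positivity) hcon
    have h2 : (l / l') ^ m ≤ (l / ‖moebiusCoord ζ v‖) ^ m := by gcongr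
    have h3 := mul_le_mul h1 h2 (by positivity) ((by positivity : (0 : ℝ) ≤ _).trans h1)
    rw [hθm, ← mul_pow] at h3
    linarith
  · obtain ⟨ξ, hξ, hy⟩ := hcov hcase.le
    have h0 : (μ ^ s) ^ m / 2 ≤ ‖1 - ω ξ * (Λ * moebiusCoord ξ v) ^ (s * m)‖ := by
      have h1 := norm_sub_norm_le (ω ξ * (Λ * moebiusCoord ξ v) ^ (s * m)) 1
      rw [norm_one, norm_mul, hω ξ hξ, one_mul, norm_pow, norm_sub_rev] at h1
      have h2 : (μ ^ s) ^ m ≤ ‖Λ * moebiusCoord ξ v‖ ^ (s * m) := by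
        rw [← pow_mul]; gcongr
      linarith
    have h1 : (μ ^ s) ^ m / 2 * (θ ^ m) ^ t.card ≤
        ∏ ξ ∈ t, ‖1 - ω ξ * (Λ * moebiusCoord ξ v) ^ (s * m)‖ := by
      rw [← Finset.mul_prod_erase t _ hξ]
      refine mul_le_mul h0 ?_ (by positivity) (norm_nonneg _)
      calc (θ ^ m) ^ t.card ≤ (θ ^ m) ^ (t.erase ξ).card :=
            pow_le_pow_of_le_one (by positivity) (pow_le_one₀ hθ.le hθ1)
              (Finset.card_le_card (Finset.erase_subset _ _))
        _ ≤ _ := by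
            rw [← Finset.prod_const]
            exact Finset.prod_le_prod (fun _ _ => by positivity)
              fun η hη => hcon η (Finset.mem_of_mem_erase hη)
    have h2 : l ^ m ≤ (l / ‖moebiusCoord ζ v‖) ^ m := by
      gcongr
      rw [le_div_iff₀ hw]
      have := norm_moebiusCoord_le hζ le_rfl hv.le
      nlinarith
    have h3 := mul_le_mul h1 h2 (by positivity) ((by positivity : (0 : ℝ) ≤ _).trans h1)
    have h4 : (θ ^ t.card * (l / l')) ^ m ≤ (θ ^ t.card * (μ ^ s * l)) ^ m := by gcongr
    have h5 : (θ ^ t.card * (μ ^ s * l)) ^ m = (μ ^ s) ^ m * (θ ^ t.card) ^ m * l ^ m := by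
      rw [mul_pow, mul_pow]; ring
    rw [hθm] at h3
    linarith

theorem exists_peak_family {ζ : ℂ} (hζ : ‖ζ‖ < 1) {r R : ℝ} (hr : 0 < r) (hrR : r < R)
    (hR : R < 1) : ∃ δ₀ > (0 : ℝ), ∀ δ, 0 < δ → δ < δ₀ → ∀ Λ₀ > (1 : ℝ),
    ∃ (Λ ν θ : ℝ) (t : Finset ℂ) (s : ℕ), 1 < Λ ∧ Λ < Λ₀ ∧ ν < 1 ∧ 0 < θ ∧ θ < 1 ∧ s ≠ 0 ∧
      t.Nonempty ∧ (∀ ξ ∈ t, ‖ξ‖ < 1) ∧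
      (∀ ξ ∈ t, ∀ v : ℂ × ℂ, ‖euclPair v‖ = 1 → ν < ‖Λ * moebiusCoord ξ v‖ →
        ‖v.1 - ζ‖ ≤ R * ‖1 - (starRingEnd ℂ) ζ * v.1‖) ∧
      ∀ᶠ m : ℕ in atTop, ∀ ω : ℂ → ℂ, (∀ ξ ∈ t, ‖ω ξ‖ = 1) → ∀ v : ℂ × ℂ, ‖euclPair v‖ = 1 →
        ‖v.1 - ζ‖ ≤ r * ‖1 - (starRingEnd ℂ) ζ * v.1‖ →
        euclPair (((1 - δ : ℝ) : ℂ) • v) ∈ polynomialHull (euclPair '' {v : ℂ × ℂ |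
          ‖euclPair v‖ = 1 ∧ ∃ ξ ∈ t, ‖1 - ω ξ * (Λ * moebiusCoord ξ v) ^ (s * m)‖ < θ ^ m}) := by
  classical
  obtain ⟨r₂, hr₂, hr₂R⟩ := exists_between hrR
  have hr₂0 : 0 < r₂ := hr.trans hr₂
  have hrr : ∀ {a b : ℝ}, 0 < a → a < b → b < 1 → Real.sqrt (1 - b ^ 2) < Real.sqrt (1 - a ^ 2) :=
    fun ha hab hb => Real.sqrt_lt_sqrt (by nlinarith) (by nlinarith)
  have hsq : ∀ {a : ℝ}, 0 < a → a < 1 → Real.sqrt (1 - a ^ 2) ^ 2 = 1 - a ^ 2 :=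
    fun ha hb => Real.sq_sqrt (by nlinarith)
  have hiff : ∀ {a : ℝ} {v : ℂ × ℂ}, 0 < a → a < 1 → ‖euclPair v‖ = 1 →
      (‖v.1 - ζ‖ ≤ a * ‖1 - (starRingEnd ℂ) ζ * v.1‖ ↔
        Real.sqrt (1 - a ^ 2) ≤ ‖moebiusCoord ζ v‖) := by
    intro a v ha ha1 hv
    have h := sq_le_sq₀ (Real.sqrt_nonneg (1 - a ^ 2)) (norm_nonneg (moebiusCoord ζ v))
    rw [hsq ha ha1] at h
    exact (norm_sub_le_mul_iff_of_sphere hζ hv ha.le).trans h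
  -- Levels of `|w_ζ|`, increasing inwards: `l''` outer side, `l'` edge of the region covered by the
  -- points of `t`, `l` the normalisation in `F`, `l₁` a lower bound on the shrunken core, and `√(1
  -- - r²)` on the core.
  set l'' := Real.sqrt (1 - R ^ 2) with hl''
  set l' := Real.sqrt (1 - r₂ ^ 2) with hl'
  have hl''0 : 0 < l'' := Real.sqrt_pos.mpr (by nlinarith)
  have hl''l' : l'' < l' := hrr hr₂0 hr₂R hR
  have hl'0 : 0 < l' := hl''0.trans hl''l'
  obtain ⟨l, hl'l, hl⟩ := exists_between (hrr hr hr₂ (hr₂R.trans hR))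
  obtain ⟨l₁, hll₁, hl₁⟩ := exists_between hl
  have hl0 : 0 < l := hl'0.trans hl'l
  have hl₁0 : 0 < l₁ := hl0.trans hll₁
  obtain ⟨δ₀, hδ₀, hshrink⟩ := exists_moebiusCoord_shrink hζ hl₁0 hl₁
  refine ⟨δ₀, hδ₀, fun δ hδ hδδ₀ Λ₀ hΛ₀ => ?_⟩
  obtain ⟨hδ1, hshrink⟩ := hshrink δ hδ hδδ₀
  set C : Set ℂ := {x | ‖x‖ ≤ 1 ∧ ‖x - ζ‖ ≤ r₂ * ‖1 - (starRingEnd ℂ) ζ * x‖} with hCdef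
  have hCc : IsCompact C := by
    refine (isCompact_closedBall (0 : ℂ) 1).of_isClosed_subset ?_ fun x hx => by simpa using hx.1
    have h1 : IsClosed {x : ℂ | ‖x‖ ≤ 1} := isClosed_le (by fun_prop) (by fun_prop)
    have h2 : IsClosed {x : ℂ | ‖x - ζ‖ ≤ r₂ * ‖1 - (starRingEnd ℂ) ζ * x‖} :=
      isClosed_le (by fun_prop) (by fun_prop)
    exact h1.inter h2
  have hC1 : ∀ ξ ∈ C, ‖ξ‖ < 1 := fun ξ hξ =>
    norm_lt_one_of_norm_sub_le hζ hr₂0.le (hr₂R.trans hR) hξ.1 hξ.2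
  have hζC : ζ ∈ C := ⟨hζ.le, by simp; positivity⟩
  have hCiff : ∀ {v : ℂ × ℂ}, ‖euclPair v‖ = 1 → (v.1 ∈ C ↔ l' ≤ ‖moebiusCoord ζ v‖) :=
    fun {v} hv => by
      rw [← hiff hr₂0 (hr₂R.trans hR) hv]
      exact ⟨fun h => h.2, fun h => ⟨(norm_fst_le_norm_euclPair v).trans hv.le, h⟩⟩
  obtain ⟨a, ha0, ha1, ha⟩ := exists_moebiusCoord_lt_one hCc hC1 hζ (l := l'')
    fun v hv hvC => hl''l'.trans_le ((hCiff hv).mp hvC)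
  -- The scale is `Λ = μ²`: one factor `μ` is spent on the cover, so that `|Λ w_ξ| ≥ μ` for some
  -- `ξ`. Meanwhile `Λ (1 - δ) < 1` keeps the factors at most `2` on the shrunken core, and `ν = Λ a
  -- < 1` bounds `|Λ w_ξ|` at the side.
  obtain ⟨μ, hμ1, hμΛ, hμδ, hμa⟩ : ∃ μ : ℝ, 1 < μ ∧ μ ^ 2 < Λ₀ ∧ μ ^ 2 * (1 - δ) < 1 ∧
      μ ^ 2 * a < 1 := by
    have hT : Tendsto (fun μ : ℝ => μ ^ 2) (𝓝[>] 1) (𝓝 1) := by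
      have : Tendsto (fun μ : ℝ => μ ^ 2) (𝓝 1) (𝓝 (1 ^ 2)) := (continuous_pow 2).tendsto 1
      rw [one_pow] at this
      exact this.mono_left nhdsWithin_le_nhds
    have h1 : ∀ᶠ μ : ℝ in 𝓝[>] 1, 1 < μ := self_mem_nhdsWithin
    exact (h1.and ((hT.eventually_lt_const hΛ₀).and (((hT.mul_const (1 - δ)).eventually_lt_const
      (by linarith)).and ((hT.mul_const a).eventually_lt_const (by linarith))))).exists
  have hμ0 : 0 < μ := by linarith
  obtain ⟨t₀, ht₀, hcov⟩ := exists_finset_cover hCc hC1 hμ1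
  set t := insert ζ t₀ with ht
  have htC : ∀ ξ ∈ t, ξ ∈ C := by
    intro ξ hξ
    rcases Finset.mem_insert.mp hξ with h | h
    · exact h ▸ hζC
    · exact ht₀ ξ h
  have hG : 1 < l / l' := (one_lt_div hl'0).mpr hl'l
  -- The ratio `s` of the exponents makes growth of a large factor beat the decay of `(l / w_ζ) ^
  -- m`: `μ ^ s * l ≥ l / l'`.
  obtain ⟨s, hs⟩ := pow_unbounded_of_one_lt (1 / l') hμ1
  have hl'1 : l' < 1 := (Real.sqrt_lt' one_pos).mpr (by nlinarith)
  have hs0 : s ≠ 0 := by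
    rintro rfl
    rw [pow_zero, div_lt_iff₀ hl'0] at hs
    linarith
  -- All factors of size `θ ^ m` together must not cancel the gain `(l / l') ^ m`.
  obtain ⟨θ, hθ0, hθ1, hθG⟩ : ∃ θ : ℝ, 0 < θ ∧ θ < 1 ∧ 1 < θ ^ t.card * (l / l') := by
    have hT : Tendsto (fun θ : ℝ => θ ^ t.card * (l / l')) (𝓝[<] 1) (𝓝 (1 ^ t.card * (l / l'))) :=
      (((continuous_pow t.card).tendsto 1).mono_left nhdsWithin_le_nhds).mul_const _
    have h1 : ∀ᶠ θ : ℝ in 𝓝[<] 1, θ < 1 := self_mem_nhdsWithin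
    have h0 : ∀ᶠ θ : ℝ in 𝓝[<] 1, 0 < θ :=
      (eventually_gt_nhds one_pos).filter_mono nhdsWithin_le_nhds
    exact (h0.and (h1.and (hT.eventually_const_lt (by simpa using hG)))).exists
  have hΛ1 : 1 < μ ^ 2 := one_lt_pow₀ hμ1 two_ne_zero
  have hnormΛ : ∀ (ξ : ℂ) (v : ℂ × ℂ), ‖((μ ^ 2 : ℝ) : ℂ) * moebiusCoord ξ v‖ =
      μ ^ 2 * ‖moebiusCoord ξ v‖ := fun ξ v => by
    rw [norm_mul, Complex.norm_real, Real.norm_eq_abs, abs_of_pos (by positivity)]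
  refine ⟨μ ^ 2, μ ^ 2 * a, θ, t, s, hΛ1, hμΛ, hμa, hθ0, hθ1, hs0, Finset.insert_nonempty _ _,
    fun ξ hξ => hC1 ξ (htC ξ hξ), fun ξ hξ v hv hlt => ?_, ?_⟩
  · rw [hiff (hr.trans hrR) hR hv]
    by_contra! hcon
    rw [hnormΛ] at hlt
    have := ha ξ (htC ξ hξ) v hv.le hcon.le
    nlinarith
  have hE1 : ∀ᶠ m : ℕ in atTop, 2 ^ t.card * (l / l₁) ^ m < 1 := by
    have h := (tendsto_pow_atTop_nhds_zero_of_lt_one (by positivity)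
      ((div_lt_one hl₁0).mpr hll₁)).const_mul ((2 : ℝ) ^ t.card)
    exact h.eventually_lt_const (by simp)
  have hE2 : ∀ᶠ m : ℕ in atTop, 2 < (1 - μ ^ 2 * a) ^ t.card * (l / l'') ^ m :=
    ((tendsto_pow_atTop_atTop_of_one_lt ((one_lt_div hl''0).mpr
      (hl''l'.trans hl'l))).const_mul_atTop (by
        have : 0 < 1 - μ ^ 2 * a := by linarith
        positivity)).eventually_gt_atTop 2
  have hE3 : ∀ᶠ m : ℕ in atTop, 4 < (θ ^ t.card * (l / l')) ^ m :=
    (tendsto_pow_atTop_atTop_of_one_lt hθG).eventually_gt_atTop 4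
  have hE4 : ∀ᶠ m : ℕ in atTop, 2 ≤ (μ ^ s) ^ m :=
    (tendsto_pow_atTop_atTop_of_one_lt (one_lt_pow₀ hμ1 hs0)).eventually_ge_atTop 2
  filter_upwards [hE1, hE2, hE3, hE4, eventually_ne_atTop 0] with m h1 h2 h3 h4 hm0 ω hω v hv hvr
  have hvl := hshrink v hv ((hiff hr (hrR.trans hR) hv).mp hvr)
  have hs1 : ‖((1 - δ : ℝ) : ℂ)‖ = 1 - δ := by
    rw [Complex.norm_real, Real.norm_eq_abs, abs_of_pos (by linarith)]
  have hball : ‖euclPair (((1 - δ : ℝ) : ℂ) • v)‖ = 1 - δ := by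
    rw [map_smul, norm_smul, hv, hs1, mul_one]
  refine mem_polynomialHull_of_peakProduct (t := t) (ω := ω) (Λ := μ ^ 2) (l := l) (l'' := l'')
    (ν := μ ^ 2 * a) (ζ := ζ) (N := s * m) (m := m) hζ (fun ξ hξ => hC1 ξ (htC ξ hξ)) hω hl0 hl''0
    hμa.le (mul_ne_zero hs0 hm0) (by positivity) (fun ξ hξ u hu hul => ?_) h2
    (fun u hu hul hF => ?_) (by rw [hball]; linarith) ?_ ?_
  · exact mul_le_mul_of_nonneg_left (ha ξ (htC ξ hξ) u hu hul) (by positivity)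
  · refine ⟨hu, exists_factor_lt_of_norm_peakProduct_le hω hζ hu hl0 hl'0 (hl''0.trans hul) hθ0
      hθ1.le hμ1.le ?_ h4 h3 (fun hcase => ?_) hF⟩
    · calc l / l' = 1 / l' * l := by ring
        _ ≤ μ ^ s * l := by gcongr
    · obtain ⟨ξ, hξ, hy⟩ := hcov u hu ((hCiff hu).mpr hcase)
      refine ⟨ξ, Finset.mem_insert_of_mem hξ, ?_⟩
      rw [hnormΛ]
      nlinarith
  · linarith
  · rw [norm_peakProduct _ _ _ hl0.le]
    refine le_trans ?_ h1.le
    have hmain : ∏ ξ ∈ t, ‖1 - ω ξ * (((μ ^ 2 : ℝ) : ℂ) *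
        moebiusCoord ξ (((1 - δ : ℝ) : ℂ) • v)) ^ (s * m)‖ ≤ 2 ^ t.card := by
      rw [← Finset.prod_const]
      refine Finset.prod_le_prod (fun _ _ => norm_nonneg _) fun ξ hξ => ?_
      refine (norm_sub_le _ _).trans ?_
      rw [norm_one, norm_mul, hω ξ hξ, one_mul, norm_pow, hnormΛ]
      have h5 := norm_moebiusCoord_le (hC1 ξ (htC ξ hξ)) (by linarith) hball.le
      have h6 : (μ ^ 2 * ‖moebiusCoord ξ (((1 - δ : ℝ) : ℂ) • v)‖) ^ (s * m) ≤ 1 :=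
        pow_le_one₀ (by positivity) ((mul_le_mul_of_nonneg_left h5 (by positivity)).trans hμδ.le)
      linarith
    have h7 : (l / ‖moebiusCoord ζ (((1 - δ : ℝ) : ℂ) • v)‖) ^ m ≤ (l / l₁) ^ m :=
      pow_le_pow_left₀ (by positivity) (div_le_div_of_nonneg_left hl0.le hl₁0 hvl) m
    exact mul_le_mul hmain h7 (by positivity) (by positivity)

end PeakFamily

/-! ### Collisions of two sheets: the ratio of the roots clusters -/

section Cluster

/-- Subtracting the two circle equations fixes the component `p` of `x - c` along the line of
centres; either equation then fixes `q²`, and `hs` fixes the sign of `q`. Recovering `q` from `q²`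
is why the distance is only of order `√e`, as for nearly tangent circles. -/
theorem norm_sub_sq_le_of_circles {c c' x x' : ℂ} {b b' e : ℝ} (he : e ≤ 1) (hc : ‖c‖ ≤ 1)
    (hc' : ‖c'‖ ≤ 1) (hx : ‖x‖ ≤ 1) (hx' : ‖x'‖ ≤ 1)
    (h1 : |‖x‖ ^ 2 - 2 * ((starRingEnd ℂ) c * x).re - b| ≤ e)
    (h2 : |‖x‖ ^ 2 - 2 * ((starRingEnd ℂ) c' * x).re - b'| ≤ e)
    (h3 : |‖x'‖ ^ 2 - 2 * ((starRingEnd ℂ) c * x').re - b| ≤ e)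
    (h4 : |‖x'‖ ^ 2 - 2 * ((starRingEnd ℂ) c' * x').re - b'| ≤ e)
    (hs : 0 ≤ ((starRingEnd ℂ) (c - c') * (x - c)).im ↔
      0 ≤ ((starRingEnd ℂ) (c - c') * (x' - c)).im) :
    ‖c - c'‖ ^ 2 * ‖x - x'‖ ^ 2 ≤ 28 * e := by
  set d := c - c' with hd
  set p := ((starRingEnd ℂ) d * (x - c)).re with hp
  set q := ((starRingEnd ℂ) d * (x - c)).im with hq
  set p' := ((starRingEnd ℂ) d * (x' - c)).re with hp'
  set q' := ((starRingEnd ℂ) d * (x' - c)).im with hq'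
  have he0 : 0 ≤ e := (abs_nonneg _).trans h1
  have hd2 : ‖d‖ ≤ 2 := (norm_sub_le _ _).trans (by linarith)
  have hpq : p ^ 2 + q ^ 2 = ‖d‖ ^ 2 * ‖x - c‖ ^ 2 := by
    rw [← mul_pow, ← RCLike.norm_conj d, ← norm_mul, Complex.sq_norm, Complex.normSq_apply, hp, hq]
    ring
  have hpq' : p' ^ 2 + q' ^ 2 = ‖d‖ ^ 2 * ‖x' - c‖ ^ 2 := by
    rw [← mul_pow, ← RCLike.norm_conj d, ← norm_mul, Complex.sq_norm, Complex.normSq_apply, hp',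
      hq']
    ring
  have hu : ∀ z : ℂ, ‖z - c‖ ^ 2 = ‖z‖ ^ 2 - 2 * ((starRingEnd ℂ) c * z).re + ‖c‖ ^ 2 := by
    intro z
    simp only [Complex.sq_norm, Complex.normSq_apply, Complex.sub_re, Complex.sub_im,
      Complex.mul_re, Complex.conj_re, Complex.conj_im]
    ring
  have hpp : 2 * (p - p') = (‖x‖ ^ 2 - 2 * ((starRingEnd ℂ) c' * x).re - b') -
      (‖x‖ ^ 2 - 2 * ((starRingEnd ℂ) c * x).re - b) -
      (‖x'‖ ^ 2 - 2 * ((starRingEnd ℂ) c' * x').re - b') +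
      (‖x'‖ ^ 2 - 2 * ((starRingEnd ℂ) c * x').re - b) := by
    rw [hp, hp', hd]
    simp only [Complex.sub_re, Complex.sub_im, Complex.mul_re, map_sub, Complex.conj_re,
      Complex.conj_im]
    ring
  rw [abs_le] at h1 h2 h3 h4
  have hpp' : |p - p'| ≤ 2 * e := abs_le.mpr ⟨by linarith, by linarith⟩
  have hpb : ∀ z : ℂ, ‖z‖ ≤ 1 → |((starRingEnd ℂ) d * (z - c)).re| ≤ 4 := by
    intro z hz
    refine (Complex.abs_re_le_norm _).trans ?_
    rw [norm_mul, RCLike.norm_conj]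
    have : ‖z - c‖ ≤ 2 := (norm_sub_le _ _).trans (by linarith)
    nlinarith [norm_nonneg d, norm_nonneg (z - c)]
  have hp4 : |p + p'| ≤ 8 := (abs_add_le _ _).trans (by linarith [hpb x hx, hpb x' hx'])
  have hsum : |(p - p') * (p + p')| ≤ 2 * e * 8 := by
    rw [abs_mul]; gcongr
  have huu : |‖x - c‖ ^ 2 - ‖x' - c‖ ^ 2| ≤ 2 * e := by
    rw [hu, hu]
    exact abs_le.mpr ⟨by linarith, by linarith⟩
  have hdu : |‖d‖ ^ 2 * (‖x - c‖ ^ 2 - ‖x' - c‖ ^ 2)| ≤ 4 * (2 * e) := by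
    rw [abs_mul, abs_of_nonneg (by positivity)]
    gcongr
    nlinarith [norm_nonneg d]
  have hqq : |q ^ 2 - q' ^ 2| ≤ 24 * e := by
    rw [abs_le] at hdu hsum
    exact abs_le.mpr ⟨by nlinarith, by nlinarith⟩
  -- For `q`, `q'` on the same side of zero, `(q - q')² ≤ |q² - q'²|`.
  have hqd : (q - q') ^ 2 ≤ 24 * e := by
    refine le_trans ?_ hqq
    rw [← abs_of_nonneg (sq_nonneg (q - q')), sq, abs_mul,
      show q ^ 2 - q' ^ 2 = (q - q') * (q + q') by ring, abs_mul]
    refine mul_le_mul_of_nonneg_left ?_ (abs_nonneg _)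
    rcases le_or_gt 0 q with h | h
    · have h' := hs.mp h
      rw [abs_of_nonneg (add_nonneg h h')]
      exact abs_le.mpr ⟨by linarith, by linarith⟩
    · have h' : q' < 0 := not_le.mp fun h'' => absurd (hs.mpr h'') (not_le.mpr h)
      rw [abs_of_neg (show q + q' < 0 by linarith)]
      exact abs_le.mpr ⟨by linarith, by linarith⟩
  have hpd : (p - p') ^ 2 ≤ 4 * e := by
    rw [← sq_abs]
    refine (pow_le_pow_left₀ (abs_nonneg _) hpp' 2).trans ?_
    have : e * e ≤ e := mul_le_of_le_one_left he0 he
    linarith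
  have hfin : ‖d‖ ^ 2 * ‖x - x'‖ ^ 2 = (p - p') ^ 2 + (q - q') ^ 2 := by
    rw [← mul_pow, ← RCLike.norm_conj d, ← norm_mul, Complex.sq_norm, Complex.normSq_apply, hp, hq,
      hp', hq']
    simp only [Complex.sub_re, Complex.sub_im, Complex.mul_re, Complex.mul_im]
    ring
  rw [hfin]
  linarith

/-- The coefficient of `|x|²` in the equation of the circle over which `Λ * moebiusCoord ξ` is
unimodular on the unit sphere. -/
noncomputable def circleCoeff (Λ : ℝ) (ξ : ℂ) : ℝ := Λ ^ 2 * (1 - ‖ξ‖ ^ 2) + ‖ξ‖ ^ 2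

theorem one_le_circleCoeff {Λ : ℝ} (hΛ : 1 ≤ Λ) {ξ : ℂ} (hξ : ‖ξ‖ ≤ 1) :
    1 ≤ circleCoeff Λ ξ := by
  have h1 : 0 ≤ 1 - ‖ξ‖ ^ 2 := by nlinarith [norm_nonneg ξ]
  have h2 : 1 ≤ Λ ^ 2 := by nlinarith
  unfold circleCoeff
  nlinarith

/-- These are the centres of the circles `|Λ w_ξ| = 1`. The coefficient decreases as `‖ξ‖` grows, so
the modulus of the centre determines `‖ξ‖`, and then the centre determines `ξ`. -/
theorem div_circleCoeff_injOn {Λ : ℝ} (hΛ : 1 < Λ) {ξ ξ' : ℂ} (hξ : ‖ξ‖ < 1) (hξ' : ‖ξ'‖ < 1)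
    (h : ξ / circleCoeff Λ ξ = ξ' / circleCoeff Λ ξ') : ξ = ξ' := by
  have key : ∀ {a b : ℂ}, ‖a‖ < 1 → ‖b‖ < 1 → a / circleCoeff Λ a = b / circleCoeff Λ b →
      ‖b‖ ≤ ‖a‖ := by
    intro a b ha hb hab
    have hA := one_le_circleCoeff hΛ.le ha.le
    have hB := one_le_circleCoeff hΛ.le hb.le
    have h1 := congrArg norm hab
    rw [norm_div, norm_div, Complex.norm_real, Complex.norm_real, Real.norm_eq_abs,
      Real.norm_eq_abs, abs_of_pos (by linarith), abs_of_pos (by linarith),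
      div_eq_div_iff (by linarith) (by linarith)] at h1
    by_contra! hlt
    have h2 : circleCoeff Λ b ≤ circleCoeff Λ a := by
      unfold circleCoeff
      have h3 : ‖a‖ ^ 2 ≤ ‖b‖ ^ 2 := pow_le_pow_left₀ (norm_nonneg _) hlt.le 2
      have h4 : 1 ≤ Λ ^ 2 := by nlinarith
      nlinarith
    nlinarith [norm_nonneg a]
  have hn : ‖ξ‖ = ‖ξ'‖ := le_antisymm (key hξ' hξ h.symm) (key hξ hξ' h)
  have hA := one_le_circleCoeff hΛ.le hξ.le
  have hAA : circleCoeff Λ ξ' = circleCoeff Λ ξ := by unfold circleCoeff; rw [hn]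
  rw [hAA] at h
  exact (div_left_inj' (Complex.ofReal_ne_zero.mpr (by linarith))).mp h

/-- Expanding `|Λ w_ξ|² = 1` on the sphere gives a circle in the first coordinate. The constant is
`3 * 4`: `||y|² - 1| ≤ 3 e`, multiplied by `|1 - ξ̄ x|² ≤ 4`. -/
theorem circle_approx {Λ : ℝ} (hΛ : 1 < Λ) {ξ : ℂ} (hξ : ‖ξ‖ < 1) {v : ℂ × ℂ}
    (hv : ‖euclPair v‖ = 1) {α : ℂ} (hα : ‖α‖ = 1) {e : ℝ} (he : e ≤ 1)
    (h : ‖Λ * moebiusCoord ξ v - α‖ ≤ e) :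
    |‖v.1‖ ^ 2 - 2 * ((starRingEnd ℂ) (ξ / circleCoeff Λ ξ) * v.1).re -
      (Λ ^ 2 * (1 - ‖ξ‖ ^ 2) - 1) / circleCoeff Λ ξ| ≤ 12 * e := by
  have hA := one_le_circleCoeff hΛ.le hξ.le
  have hA0 : 0 < circleCoeff Λ ξ := by linarith
  have hx : ‖v.1‖ ≤ 1 := (norm_fst_le_norm_euclPair v).trans hv.le
  have hD := norm_pos_iff.mpr (one_sub_conj_mul_ne_zero hξ hx)
  have hD2 := norm_one_sub_conj_mul_le hξ.le hx
  set D := ‖1 - (starRingEnd ℂ) ξ * v.1‖ with hDdef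
  set y := (Λ : ℂ) * moebiusCoord ξ v with hy
  have hy2 : ‖y‖ ^ 2 * D ^ 2 = Λ ^ 2 * ((1 - ‖ξ‖ ^ 2) * (1 - ‖v.1‖ ^ 2)) := by
    rw [hy, norm_mul, Complex.norm_real, mul_pow, norm_moebiusCoord_sq_of_sphere hξ hv,
      Real.norm_eq_abs, sq_abs, ← hDdef]
    field_simp
  have he0 : 0 ≤ e := (norm_nonneg _).trans h
  have hyn : |‖y‖ - 1| ≤ e := by
    rw [← hα]; exact (abs_norm_sub_norm_le _ _).trans h
  have hy1 : |‖y‖ ^ 2 - 1| ≤ 3 * e := by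
    rw [show ‖y‖ ^ 2 - 1 = (‖y‖ - 1) * (‖y‖ + 1) by ring, abs_mul]
    have : |‖y‖ + 1| ≤ 3 := by
      rw [abs_of_nonneg (by positivity)]
      linarith [(abs_le.mp hyn).2]
    rw [mul_comm]
    gcongr
  have hc : ((starRingEnd ℂ) (ξ / circleCoeff Λ ξ) * v.1).re =
      ((starRingEnd ℂ) ξ * v.1).re / circleCoeff Λ ξ := by
    rw [map_div₀, Complex.conj_ofReal, div_mul_eq_mul_div, Complex.div_ofReal_re]
  have hDsq : D ^ 2 = 1 - 2 * ((starRingEnd ℂ) ξ * v.1).re + ‖ξ‖ ^ 2 * ‖v.1‖ ^ 2 := by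
    rw [hDdef]
    simp only [Complex.sq_norm, Complex.normSq_apply, Complex.sub_re, Complex.sub_im,
      Complex.mul_re, Complex.mul_im, Complex.conj_re, Complex.conj_im, Complex.one_re,
      Complex.one_im]
    ring
  have hmain : ‖v.1‖ ^ 2 - 2 * ((starRingEnd ℂ) (ξ / circleCoeff Λ ξ) * v.1).re -
      (Λ ^ 2 * (1 - ‖ξ‖ ^ 2) - 1) / circleCoeff Λ ξ =
      -((‖y‖ ^ 2 - 1) * D ^ 2) / circleCoeff Λ ξ := by
    rw [hc, sub_mul, hy2, one_mul, hDsq]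
    field_simp
    unfold circleCoeff
    ring
  rw [hmain, abs_div, abs_neg, abs_mul, abs_of_pos hA0, abs_of_nonneg (sq_nonneg D)]
  refine (div_le_self (by positivity) hA).trans ?_
  have : D ^ 2 ≤ 4 := by nlinarith
  calc |‖y‖ ^ 2 - 1| * D ^ 2 ≤ 3 * e * 4 := by gcongr
    _ = 12 * e := by ring

/-- The second coordinate cancels in `w_ξ / w_ξ'`, so `α / α'` is nearly a function of the first
coordinate. -/
theorem norm_div_sub_moebius_quotient_le {Λ : ℝ} {ξ ξ' : ℂ} (hξ : ‖ξ‖ < 1)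
    (hξ' : ‖ξ'‖ < 1) {v : ℂ × ℂ} (hv : ‖euclPair v‖ = 1) {α α' : ℂ} (hα' : ‖α'‖ = 1) {e : ℝ}
    (h : ‖Λ * moebiusCoord ξ v - α‖ ≤ e) (h' : ‖Λ * moebiusCoord ξ' v - α'‖ ≤ e) :
    ‖α / α' - Real.sqrt (1 - ‖ξ‖ ^ 2) / Real.sqrt (1 - ‖ξ'‖ ^ 2) *
      ((1 - (starRingEnd ℂ) ξ' * v.1) / (1 - (starRingEnd ℂ) ξ * v.1))‖ ≤
    e + Real.sqrt (1 - ‖ξ‖ ^ 2) / Real.sqrt (1 - ‖ξ'‖ ^ 2) * (2 / (1 - ‖ξ‖)) * e := by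
  have hx : ‖v.1‖ ≤ 1 := (norm_fst_le_norm_euclPair v).trans hv.le
  have hD := one_sub_conj_mul_ne_zero hξ hx
  have hD' := one_sub_conj_mul_ne_zero hξ' hx
  have hs' : 0 < Real.sqrt (1 - ‖ξ'‖ ^ 2) :=
    Real.sqrt_pos.mpr (by nlinarith [norm_nonneg ξ'])
  set k := Real.sqrt (1 - ‖ξ‖ ^ 2) / Real.sqrt (1 - ‖ξ'‖ ^ 2) with hk
  have hk0 : 0 ≤ k := by positivity
  set g := (k : ℂ) * ((1 - (starRingEnd ℂ) ξ' * v.1) / (1 - (starRingEnd ℂ) ξ * v.1)) with hg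
  have hα'0 : α' ≠ 0 := norm_ne_zero_iff.mp (by rw [hα']; exact one_ne_zero)
  have hyy : moebiusCoord ξ v = g * moebiusCoord ξ' v := by
    have : (Real.sqrt (1 - ‖ξ'‖ ^ 2) : ℂ) ≠ 0 := Complex.ofReal_ne_zero.mpr hs'.ne'
    rw [hg, hk]
    unfold moebiusCoord
    push_cast
    generalize 1 - (starRingEnd ℂ) ξ * v.1 = D at hD ⊢
    generalize 1 - (starRingEnd ℂ) ξ' * v.1 = D' at hD' ⊢
    field_simp
  have hgn : ‖g‖ ≤ k * (2 / (1 - ‖ξ‖)) := by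
    rw [hg, norm_mul, Complex.norm_real, Real.norm_eq_abs, abs_of_nonneg hk0, norm_div]
    have h1 : 0 < 1 - ‖ξ‖ := by linarith
    gcongr
    · exact norm_one_sub_conj_mul_le hξ'.le hx
    · exact one_sub_norm_le_norm_one_sub hx
  have hcast : (Real.sqrt (1 - ‖ξ‖ ^ 2) : ℂ) / Real.sqrt (1 - ‖ξ'‖ ^ 2) = (k : ℂ) := by
    rw [hk]; push_cast; rfl
  rw [hcast, ← hg]
  have heq : α / α' - g = ((α - Λ * moebiusCoord ξ v) +
      g * (Λ * moebiusCoord ξ' v - α')) / α' := by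
    rw [hyy]
    field_simp
    ring
  rw [heq, norm_div, hα', div_one]
  refine (norm_add_le _ _).trans ?_
  rw [norm_mul, norm_sub_rev]
  gcongr

theorem norm_moebius_quotient_sub_le {ξ ξ' x x' : ℂ} (hξ : ‖ξ‖ < 1) (hξ' : ‖ξ'‖ < 1)
    (hx : ‖x‖ ≤ 1) (hx' : ‖x'‖ ≤ 1) :
    ‖(1 - (starRingEnd ℂ) ξ' * x) / (1 - (starRingEnd ℂ) ξ * x) -
      (1 - (starRingEnd ℂ) ξ' * x') / (1 - (starRingEnd ℂ) ξ * x')‖ ≤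
    2 / (1 - ‖ξ‖) ^ 2 * ‖x - x'‖ := by
  have hD := one_sub_conj_mul_ne_zero hξ hx
  have hD' := one_sub_conj_mul_ne_zero hξ hx'
  have h1 := one_sub_norm_le_norm_one_sub (ξ := ξ) hx
  have h2 := one_sub_norm_le_norm_one_sub (ξ := ξ) hx'
  have h0 : 0 < 1 - ‖ξ‖ := by linarith
  rw [div_sub_div _ _ hD hD', show (1 - (starRingEnd ℂ) ξ' * x) * (1 - (starRingEnd ℂ) ξ * x') -
    (1 - (starRingEnd ℂ) ξ * x) * (1 - (starRingEnd ℂ) ξ' * x') =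
    (starRingEnd ℂ) (ξ - ξ') * (x - x') by rw [map_sub]; ring, norm_div, norm_mul, norm_mul,
    RCLike.norm_conj, div_mul_eq_mul_div, sq]
  have h3 : ‖ξ - ξ'‖ ≤ 2 := (norm_sub_le _ _).trans (by linarith)
  gcongr

/-- `S` tells on which side of the line of centres the first coordinate lies, that is, which of the
two intersection points of the circles is near. The constant `19` comes from `28 * 12 ≤ 19²`. -/
theorem exists_ratio_cluster {Λ : ℝ} (hΛ : 1 < Λ) {ξ ξ' : ℂ} (hξ : ‖ξ‖ < 1) (hξ' : ‖ξ'‖ < 1)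
    (hne : ξ ≠ ξ') : ∃ C > (0 : ℝ), ∃ S : ℂ → Prop, ∀ e : ℝ, 0 ≤ e → e ≤ 1 / 12 →
    ∀ v v' : ℂ × ℂ, ‖euclPair v‖ = 1 → ‖euclPair v'‖ = 1 → (S v.1 ↔ S v'.1) →
    ∀ α α' β β' : ℂ, ‖α‖ = 1 → ‖α'‖ = 1 → ‖β‖ = 1 → ‖β'‖ = 1 →
    ‖Λ * moebiusCoord ξ v - α‖ ≤ e → ‖Λ * moebiusCoord ξ' v - α'‖ ≤ e →
    ‖Λ * moebiusCoord ξ v' - β‖ ≤ e → ‖Λ * moebiusCoord ξ' v' - β'‖ ≤ e →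
    ‖α / α' - β / β'‖ ≤ C * Real.sqrt e := by
  set c := ξ / circleCoeff Λ ξ with hc
  set c' := ξ' / circleCoeff Λ ξ' with hc'
  have hd : 0 < ‖c - c'‖ :=
    norm_pos_iff.mpr (sub_ne_zero.mpr fun h => hne (div_circleCoeff_injOn hΛ hξ hξ' h))
  have hc1 : ∀ {a : ℂ}, ‖a‖ < 1 → ‖a / circleCoeff Λ a‖ ≤ 1 := by
    intro a ha
    have hA := one_le_circleCoeff hΛ.le ha.le
    rw [norm_div, Complex.norm_real, Real.norm_eq_abs, abs_of_pos (by linarith),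
      div_le_one (by linarith)]
    linarith
  set k := Real.sqrt (1 - ‖ξ‖ ^ 2) / Real.sqrt (1 - ‖ξ'‖ ^ 2) with hk
  have hk0 : 0 ≤ k := by positivity
  have h0 : 0 < 1 - ‖ξ‖ := by linarith
  have hcast : (Real.sqrt (1 - ‖ξ‖ ^ 2) : ℂ) / Real.sqrt (1 - ‖ξ'‖ ^ 2) = (k : ℂ) := by
    rw [hk]; push_cast; rfl
  refine ⟨2 * (1 + k * (2 / (1 - ‖ξ‖))) + k * (2 / (1 - ‖ξ‖) ^ 2 * (19 / ‖c - c'‖)),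
    by positivity, fun x => 0 ≤ ((starRingEnd ℂ) (c - c') * (x - c)).im, ?_⟩
  intro e he0 he v v' hv hv' hS α α' β β' hα hα' hβ hβ' h1 h2 h3 h4
  have hx : ‖v.1‖ ≤ 1 := (norm_fst_le_norm_euclPair v).trans hv.le
  have hx' : ‖v'.1‖ ≤ 1 := (norm_fst_le_norm_euclPair v').trans hv'.le
  have he1 : e ≤ 1 := by linarith
  have hcl := norm_sub_sq_le_of_circles (e := 12 * e) (by linarith) (hc1 hξ) (hc1 hξ') hx hx'
    (circle_approx hΛ hξ hv hα he1 h1) (circle_approx hΛ hξ' hv hα' he1 h2)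
    (circle_approx hΛ hξ hv' hβ he1 h3) (circle_approx hΛ hξ' hv' hβ' he1 h4) hS
  rw [← hc, ← hc'] at hcl
  have hxx : ‖v.1 - v'.1‖ ≤ 19 / ‖c - c'‖ * Real.sqrt e := by
    rw [div_mul_eq_mul_div, le_div_iff₀ hd]
    refine le_of_sq_le_sq ?_ (by positivity)
    rw [mul_pow, mul_pow, Real.sq_sqrt he0]
    linarith
  have hes : e ≤ Real.sqrt e := by
    refine Real.le_sqrt_of_sq_le ?_
    nlinarith
  have hA := norm_div_sub_moebius_quotient_le hξ hξ' hv hα' h1 h2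
  have hB := norm_div_sub_moebius_quotient_le hξ hξ' hv' hβ' h3 h4
  rw [hcast, ← hk] at hA hB
  have hC := norm_moebius_quotient_sub_le hξ hξ' hx hx'
  set g := (1 - (starRingEnd ℂ) ξ' * v.1) / (1 - (starRingEnd ℂ) ξ * v.1)
  set g' := (1 - (starRingEnd ℂ) ξ' * v'.1) / (1 - (starRingEnd ℂ) ξ * v'.1)
  have hsplit : α / α' - β / β' = (α / α' - k * g) - (β / β' - k * g') + k * (g - g') := by ring
  rw [hsplit]
  refine (norm_add_le _ _).trans ((add_le_add (norm_sub_le _ _) le_rfl).trans ?_)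
  rw [norm_mul (k : ℂ), Complex.norm_real, Real.norm_eq_abs, abs_of_nonneg hk0]
  have h5 : e + k * (2 / (1 - ‖ξ‖)) * e ≤ (1 + k * (2 / (1 - ‖ξ‖))) * Real.sqrt e := by
    rw [← one_add_mul]; gcongr
  have h6 : k * ‖g - g'‖ ≤ k * (2 / (1 - ‖ξ‖) ^ 2 * (19 / ‖c - c'‖ * Real.sqrt e)) :=
    mul_le_mul_of_nonneg_left (hC.trans (by gcongr)) hk0
  calc ‖α / α' - k * g‖ + ‖β / β' - k * g'‖ + k * ‖g - g'‖ ≤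
      (1 + k * (2 / (1 - ‖ξ‖))) * Real.sqrt e + (1 + k * (2 / (1 - ‖ξ‖))) * Real.sqrt e +
      k * (2 / (1 - ‖ξ‖) ^ 2 * (19 / ‖c - c'‖ * Real.sqrt e)) := by linarith
    _ = _ := by ring

end Cluster

/-! ### Rotations that keep the sheets apart -/

section Rotations

/-- Tubes around the roots of unity on the sheets of `ξ` and `ξ'`, rotated by `a` and `b`, meet. -/
def SheetsCollide (Λ : ℝ) (N : ℕ) (e : ℝ) (ξ ξ' a b : ℂ) : Prop :=
  ∃ (v : ℂ × ℂ) (α α' : ℂ), ‖euclPair v‖ = 1 ∧ ‖α‖ = 1 ∧ ‖α'‖ = 1 ∧ α ^ N * a = 1 ∧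
    α' ^ N * b = 1 ∧ ‖Λ * moebiusCoord ξ v - α‖ ≤ e ∧ ‖Λ * moebiusCoord ξ' v - α'‖ ≤ e

theorem SheetsCollide.symm {Λ : ℝ} {N : ℕ} {e : ℝ} {ξ ξ' a b : ℂ}
    (h : SheetsCollide Λ N e ξ ξ' a b) : SheetsCollide Λ N e ξ' ξ b a := by
  obtain ⟨v, α, α', h1, h2, h3, h4, h5, h6, h7⟩ := h
  exact ⟨v, α', α, h1, h3, h2, h5, h4, h7, h6⟩

/-- A collision gives `(α / α') ^ N = b / a`. On one side of the line of centres the ratios agree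
within `C √e`, so the values `b / a` agree within `N C √e < 1 / Q`. Distinct `Q`-th roots of unity
are at least `1 / Q` apart, so each side allows only one `a`. -/
theorem exists_card_le_two_of_sheetsCollide {Λ : ℝ} (hΛ : 1 < Λ) {ξ ξ' : ℂ} (hξ : ‖ξ‖ < 1)
    (hξ' : ‖ξ'‖ < 1) (hne : ξ ≠ ξ') {Q : ℕ} (hQ : Q ≠ 0) : ∃ κ > (0 : ℝ), ∀ (N : ℕ) (e : ℝ), 0 ≤ e →
    e ≤ 1 / 12 → N * Real.sqrt e < κ → ∀ U : Finset ℂ, (∀ a ∈ U, a ^ Q = 1) → ∀ b ∈ U,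
    ∃ s : Finset ℂ, s.card ≤ 2 ∧ ∀ a ∈ U, SheetsCollide Λ N e ξ ξ' a b → a ∈ s := by
  classical
  obtain ⟨C, hC, S, hS⟩ := exists_ratio_cluster hΛ hξ hξ' hne
  have hQ0 : (0 : ℝ) < Q := Nat.cast_pos.mpr (Nat.pos_of_ne_zero hQ)
  refine ⟨1 / Q / C, by positivity, fun N e he0 he hN U hU b hb => ?_⟩
  have hU1 : ∀ a ∈ U, ‖a‖ = 1 := fun a ha => by
    have h2 := congrArg norm (hU a ha)
    rw [norm_pow, norm_one] at h2
    exact (pow_eq_one_iff_of_nonneg (norm_nonneg _) hQ).mp h2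
  set W : Prop → ℂ → Prop := fun P a => ∃ (v : ℂ × ℂ) (α α' : ℂ), (S v.1 ↔ P) ∧
    ‖euclPair v‖ = 1 ∧ ‖α‖ = 1 ∧ ‖α'‖ = 1 ∧ α ^ N * a = 1 ∧
    α' ^ N * b = 1 ∧ ‖Λ * moebiusCoord ξ v - α‖ ≤ e ∧ ‖Λ * moebiusCoord ξ' v - α'‖ ≤ e with hW
  have hcard : ∀ P : Prop, (U.filter (W P)).card ≤ 1 := by
    intro P
    refine Finset.card_le_one.mpr fun a ha a' ha' => ?_
    obtain ⟨haU, v, α, α', hv1, hv2, hα, hα', hαa, hαb, hy, hy'⟩ := Finset.mem_filter.mp ha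
    obtain ⟨haU', v', β, β', hu1, hu2, hβ, hβ', hβa, hβb, hz, hz'⟩ := Finset.mem_filter.mp ha'
    have hcl := hS e he0 he v v' hv2 hu2 (hv1.trans hu1.symm) α α' β β' hα hα' hβ hβ' hy hy' hz hz'
    have hp := norm_pow_sub_pow_le_mul (u := α / α') (v := β / β')
      (by rw [norm_div, hα, hα', div_one]) (by rw [norm_div, hβ, hβ', div_one]) N
    have hne0 : ∀ {z : ℂ}, ‖z‖ = 1 → z ≠ 0 := fun hz =>
      norm_ne_zero_iff.mp (by rw [hz]; exact one_ne_zero)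
    have ha0 := hne0 (hU1 a haU)
    have ha0' := hne0 (hU1 a' haU')
    have hb0 := hne0 (hU1 b hb)
    have e1 : (α / α') ^ N = b / a := by
      rw [div_pow, eq_div_of_mul_eq ha0 hαa, eq_div_of_mul_eq hb0 hαb]
      field_simp
    have e2 : (β / β') ^ N = b / a' := by
      rw [div_pow, eq_div_of_mul_eq ha0' hβa, eq_div_of_mul_eq hb0 hβb]
      field_simp
    have e3 : b / a - b / a' = b * (a' - a) / (a * a') := by field_simp
    rw [e1, e2, e3, norm_div, norm_mul, norm_mul, hU1 a haU, hU1 a' haU', hU1 b hb, one_mul,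
      mul_one, div_one] at hp
    by_contra hcon
    have h1 := one_div_le_norm_sub_of_pow_eq hQ (hU1 a haU) ((hU a' haU').trans (hU a haU).symm)
      (fun h => hcon h.symm)
    have h2 : (N : ℝ) * ‖α / α' - β / β'‖ ≤ N * (C * Real.sqrt e) := by gcongr
    rw [lt_div_iff₀ hC] at hN
    linarith
  refine ⟨U.filter (W True) ∪ U.filter (W False),
    (Finset.card_union_le _ _).trans (Nat.add_le_add (hcard _) (hcard _)), ?_⟩
  rintro a ha ⟨v, α, α', h⟩
  rw [Finset.mem_union, Finset.mem_filter, Finset.mem_filter]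
  by_cases hSv : S v.1
  · exact Or.inl ⟨ha, v, α, α', iff_true_intro hSv, h⟩
  · exact Or.inr ⟨ha, v, α, α', iff_false_intro hSv, h⟩

/-- With `2 * t.card + 1` roots of unity available and at most two excluded per earlier point, the
greedy choice succeeds. -/
theorem exists_rotations {Λ : ℝ} (hΛ : 1 < Λ) (t : Finset ℂ) (ht : ∀ ξ ∈ t, ‖ξ‖ < 1) :
    ∃ κ > (0 : ℝ), ∀ (N : ℕ) (e : ℝ), 0 ≤ e → e ≤ 1 / 12 → N * Real.sqrt e < κ →
    ∃ ω : ℂ → ℂ, (∀ ξ ∈ t, ‖ω ξ‖ = 1) ∧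
      ∀ ξ ∈ t, ∀ ξ' ∈ t, ξ ≠ ξ' → ¬ SheetsCollide Λ N e ξ ξ' (ω ξ) (ω ξ') := by
  classical
  set Q := 2 * t.card + 1 with hQdef
  have hQ : Q ≠ 0 := by omega
  have hpair : ∀ q : ℂ × ℂ, ∃ κ > (0 : ℝ), q.1 ∈ t → q.2 ∈ t → q.1 ≠ q.2 →
      ∀ (N : ℕ) (e : ℝ), 0 ≤ e → e ≤ 1 / 12 → N * Real.sqrt e < κ →
      ∀ U : Finset ℂ, (∀ a ∈ U, a ^ Q = 1) → ∀ b ∈ U,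
      ∃ s : Finset ℂ, s.card ≤ 2 ∧ ∀ a ∈ U, SheetsCollide Λ N e q.1 q.2 a b → a ∈ s := by
    rintro ⟨ξ, ξ'⟩
    by_cases h : ξ ∈ t ∧ ξ' ∈ t ∧ ξ ≠ ξ'
    · obtain ⟨κ, hκ, hs⟩ :=
        exists_card_le_two_of_sheetsCollide hΛ (ht ξ h.1) (ht ξ' h.2.1) h.2.2 hQ
      exact ⟨κ, hκ, fun _ _ _ => hs⟩
    · exact ⟨1, one_pos, fun h1 h2 h3 => absurd ⟨h1, h2, h3⟩ h⟩
  choose κ hκ hs using hpair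
  obtain ⟨κ₀, hκ₀, hlt⟩ : ∃ κ₀ > (0 : ℝ), ∀ q ∈ t ×ˢ t, κ₀ ≤ κ q := by
    rcases (t ×ˢ t).eq_empty_or_nonempty with he | hne
    · exact ⟨1, one_pos, by simp [he]⟩
    · obtain ⟨q, -, hmin⟩ := Finset.exists_min_image (t ×ˢ t) κ hne
      exact ⟨κ q, hκ q, hmin⟩
  refine ⟨κ₀, hκ₀, fun N e he0 he hN => ?_⟩
  have hroots := (Complex.isPrimitiveRoot_exp Q hQ).card_nthRootsFinset
  have hU : ∀ a ∈ Polynomial.nthRootsFinset Q (1 : ℂ), a ^ Q = 1 := fun a ha =>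
    (Polynomial.mem_nthRootsFinset (Nat.pos_of_ne_zero hQ) 1).mp ha
  obtain ⟨ω, hω1, hω2⟩ := exists_avoiding_assignment t (Polynomial.nthRootsFinset Q (1 : ℂ))
    (SheetsCollide Λ N e) 2 (fun _ _ _ _ h => h.symm)
    (fun ξ hξ ξ' hξ' hne b hb => hs (ξ, ξ') hξ hξ' hne N e he0 he
      (hN.trans_le (hlt (ξ, ξ') (Finset.mem_product.mpr ⟨hξ, hξ'⟩))) _ hU b hb)
    (by rw [hroots]; omega)
  refine ⟨ω, fun ξ hξ => ?_, hω2⟩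
  have h2 := congrArg norm (hU _ (hω1 ξ hξ))
  rw [norm_pow, norm_one] at h2
  exact (pow_eq_one_iff_of_nonneg (norm_nonneg _) hQ).mp h2

end Rotations

/-! ### Small tubes around the sheets -/

section SheetTubes

/-- The normalisation of the direction of the tubes on the sheet of `ξ`. -/
noncomputable def sheetScale (Λ : ℝ) (ξ : ℂ) : ℝ := Real.sqrt (circleCoeff Λ ξ)

/-- The complex line through `0` and the point of the unit sphere nearest to the set where
`Λ * moebiusCoord ξ = α`. -/
noncomputable def sheetDir (Λ : ℝ) (ξ α : ℂ) : EuclideanSpace ℂ (Fin 2) :=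
  !₂[(starRingEnd ℂ) α * ξ / sheetScale Λ ξ,
    ((Λ * Real.sqrt (1 - ‖ξ‖ ^ 2) / sheetScale Λ ξ : ℝ) : ℂ)]

theorem sheetScale_sq {Λ : ℝ} (hΛ : 1 ≤ Λ) {ξ : ℂ} (hξ : ‖ξ‖ ≤ 1) :
    sheetScale Λ ξ ^ 2 = circleCoeff Λ ξ :=
  Real.sq_sqrt (by linarith [one_le_circleCoeff hΛ hξ])

theorem circleCoeff_le {Λ : ℝ} (hΛ : 1 ≤ Λ) (ξ : ℂ) : circleCoeff Λ ξ ≤ Λ ^ 2 := by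
  have h : 1 ≤ Λ ^ 2 := by nlinarith
  unfold circleCoeff
  nlinarith [sq_nonneg ‖ξ‖]

theorem one_lt_sheetScale {Λ : ℝ} (hΛ : 1 < Λ) {ξ : ℂ} (hξ : ‖ξ‖ < 1) : 1 < sheetScale Λ ξ := by
  rw [sheetScale, Real.lt_sqrt zero_le_one, one_pow, circleCoeff]
  have h1 : 0 < 1 - ‖ξ‖ ^ 2 := by nlinarith [norm_nonneg ξ]
  have h2 : 1 < Λ ^ 2 := by nlinarith
  nlinarith

theorem sheetScale_le {Λ : ℝ} (hΛ : 1 ≤ Λ) (ξ : ℂ) : sheetScale Λ ξ ≤ Λ :=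
  (Real.sqrt_le_sqrt (circleCoeff_le hΛ ξ)).trans_eq (Real.sqrt_sq (by linarith))

theorem norm_sheetDir {Λ : ℝ} (hΛ : 1 < Λ) {ξ α : ℂ} (hξ : ‖ξ‖ < 1) (hα : ‖α‖ = 1) :
    ‖sheetDir Λ ξ α‖ = 1 := by
  have hs := one_lt_sheetScale hΛ hξ
  have hs2 := sheetScale_sq hΛ.le hξ.le
  have h1 : 0 ≤ 1 - ‖ξ‖ ^ 2 := by nlinarith [norm_nonneg ξ]
  have h : ‖sheetDir Λ ξ α‖ ^ 2 = 1 := by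
    rw [EuclideanSpace.norm_sq_eq, Fin.sum_univ_two]
    simp only [sheetDir, PiLp.toLp_apply, Matrix.cons_val_zero, Matrix.cons_val_one, norm_div,
      norm_mul, RCLike.norm_conj, hα, one_mul, Complex.norm_real, Real.norm_eq_abs, div_pow, mul_pow,
      sq_abs, Real.sq_sqrt h1, hs2]
    rw [← add_div, div_eq_one_iff_eq (by rw [← hs2]; positivity), circleCoeff]
    ring
  exact (pow_eq_one_iff_of_nonneg (norm_nonneg _) two_ne_zero).mp h

/-- Clearing the denominator, `Λ w_ξ = α` is the equation of a complex line. As `|1 - ξ̄ v₁|` is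
bounded above and below, closeness of `Λ w_ξ` to `α` and membership in a tube about this line are
comparable in both directions. -/
theorem inner_sheetDir_sub {Λ : ℝ} {ξ : ℂ} (α : ℂ) (hs : sheetScale Λ ξ ≠ 0) {v : ℂ × ℂ}
    (hD : 1 - (starRingEnd ℂ) ξ * v.1 ≠ 0) :
    inner ℂ (sheetDir Λ ξ α) (euclPair v) - α / sheetScale Λ ξ =
      (1 - (starRingEnd ℂ) ξ * v.1) * (Λ * moebiusCoord ξ v - α) / sheetScale Λ ξ := by
  have hs' : (sheetScale Λ ξ : ℂ) ≠ 0 := Complex.ofReal_ne_zero.mpr hs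
  have h1 : (1 - (starRingEnd ℂ) ξ * v.1) * moebiusCoord ξ v = Real.sqrt (1 - ‖ξ‖ ^ 2) * v.2 := by
    rw [moebiusCoord, mul_div_cancel₀ _ hD]
  have h2 : (1 - (starRingEnd ℂ) ξ * v.1) * (Λ * moebiusCoord ξ v - α) =
      Λ * (Real.sqrt (1 - ‖ξ‖ ^ 2) * v.2) - α + α * (starRingEnd ℂ) ξ * v.1 := by
    rw [← h1]; ring
  rw [h2]
  simp only [PiLp.inner_apply, Fin.sum_univ_two, sheetDir, Matrix.cons_val_zero,
    Matrix.cons_val_one, euclPair_apply_zero, euclPair_apply_one, RCLike.inner_apply, map_div₀,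
    map_mul, Complex.conj_conj, Complex.conj_ofReal, Complex.ofReal_div, Complex.ofReal_mul]
  field_simp
  ring

theorem mem_sphereTube_sheetDir {Λ : ℝ} (hΛ : 1 < Λ) {ξ α : ℂ} (hξ : ‖ξ‖ < 1) (hα : ‖α‖ = 1)
    {v : ℂ × ℂ} (hv : ‖euclPair v‖ = 1) {e ρ : ℝ} (h : ‖Λ * moebiusCoord ξ v - α‖ ≤ 4 * e)
    (hρ0 : 0 ≤ ρ) (hρ : 8 * e ≤ ρ * (1 - 1 / sheetScale Λ ξ)) :
    euclPair v ∈ sphereTube (sheetDir Λ ξ α) (α / sheetScale Λ ξ) ρ := by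
  have hs := one_lt_sheetScale hΛ hξ
  have hx : ‖v.1‖ ≤ 1 := (norm_fst_le_norm_euclPair v).trans hv.le
  have hc : ‖α / sheetScale Λ ξ‖ = 1 / sheetScale Λ ξ := by
    rw [norm_div, hα, Complex.norm_real, Real.norm_eq_abs, abs_of_pos (by linarith)]
  refine ⟨hv, ?_⟩
  rw [inner_sheetDir_sub α (by linarith) (one_sub_conj_mul_ne_zero hξ hx), norm_div, norm_mul,
    Complex.norm_real, Real.norm_eq_abs, abs_of_pos (by linarith)]
  have h1 : ‖inner ℂ (sheetDir Λ ξ α) (euclPair v)‖ ≤ 1 :=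
    (norm_inner_le_norm _ _).trans (by rw [norm_sheetDir hΛ hξ hα, hv, one_mul])
  have h2 := one_sub_norm_le_norm_one_sub (ξ := α / sheetScale Λ ξ) h1
  rw [hc] at h2
  have h3 := norm_one_sub_conj_mul_le hξ.le hx
  calc ‖1 - (starRingEnd ℂ) ξ * v.1‖ * ‖Λ * moebiusCoord ξ v - α‖ / sheetScale Λ ξ
      ≤ ‖1 - (starRingEnd ℂ) ξ * v.1‖ * ‖Λ * moebiusCoord ξ v - α‖ :=
        div_le_self (by positivity) hs.le
    _ ≤ 2 * (4 * e) := by gcongr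
    _ ≤ ρ * (1 - 1 / sheetScale Λ ξ) := by linarith
    _ ≤ _ := by gcongr

theorem norm_inner_sub_le_of_mem_sphereTube {p z : EuclideanSpace ℂ (Fin 2)} {c : ℂ} {ρ : ℝ}
    (hp : ‖p‖ = 1) (hc : ‖c‖ ≤ 1) (hρ : 0 ≤ ρ) (hz : z ∈ sphereTube p c ρ) :
    ‖inner ℂ p z - c‖ ≤ 2 * ρ := by
  have h1 : ‖inner ℂ p z‖ ≤ 1 :=
    (norm_inner_le_norm _ _).trans (by rw [hp, hz.1, one_mul])
  have h2 := norm_one_sub_conj_mul_le hc h1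
  have := mul_le_mul_of_nonneg_left h2 hρ
  linarith [hz.2]

theorem norm_sub_le_of_mem_sphereTube_sheetDir {Λ : ℝ} (hΛ : 1 < Λ) {ξ α : ℂ} (hξ : ‖ξ‖ < 1)
    (hα : ‖α‖ = 1) {v : ℂ × ℂ} {ρ : ℝ} (hρ : 0 ≤ ρ)
    (h : euclPair v ∈ sphereTube (sheetDir Λ ξ α) (α / sheetScale Λ ξ) ρ) :
    ‖Λ * moebiusCoord ξ v - α‖ ≤ 2 * Λ / (1 - ‖ξ‖) * ρ := by
  have hs := one_lt_sheetScale hΛ hξ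
  have hx : ‖v.1‖ ≤ 1 := (norm_fst_le_norm_euclPair v).trans h.1.le
  have hD := one_sub_norm_le_norm_one_sub (ξ := ξ) hx
  have hc : ‖α / sheetScale Λ ξ‖ ≤ 1 := by
    rw [norm_div, hα, Complex.norm_real, Real.norm_eq_abs, abs_of_pos (by linarith)]
    exact (div_le_one (by linarith)).mpr hs.le
  have h1 := norm_inner_sub_le_of_mem_sphereTube (norm_sheetDir hΛ hξ hα) hc hρ h
  rw [inner_sheetDir_sub α (by linarith) (one_sub_conj_mul_ne_zero hξ hx), norm_div, norm_mul,
    Complex.norm_real, Real.norm_eq_abs, abs_of_pos (by linarith), div_le_iff₀ (by linarith)] at h1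
  have h0 : 0 < 1 - ‖ξ‖ := by linarith
  rw [div_mul_eq_mul_div, le_div_iff₀ h0]
  calc ‖Λ * moebiusCoord ξ v - α‖ * (1 - ‖ξ‖)
      ≤ ‖Λ * moebiusCoord ξ v - α‖ * ‖1 - (starRingEnd ℂ) ξ * v.1‖ := by gcongr
    _ = ‖1 - (starRingEnd ℂ) ξ * v.1‖ * ‖Λ * moebiusCoord ξ v - α‖ := mul_comm _ _
    _ ≤ 2 * ρ * sheetScale Λ ξ := h1
    _ ≤ 2 * ρ * Λ := by gcongr; exact sheetScale_le hΛ.le ξ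
    _ = 2 * Λ * ρ := by ring

theorem norm_sub_smul_sq_le_of_mem_sphereTube {p z : EuclideanSpace ℂ (Fin 2)} {c : ℂ} {ρ : ℝ}
    (hp : ‖p‖ = 1) (hc : ‖c‖ ≤ 1) (hρ : 0 ≤ ρ) (hz : z ∈ sphereTube p c ρ) :
    ‖z - c • p‖ ^ 2 ≤ 1 - ‖c‖ ^ 2 + 4 * ρ := by
  have h1 := norm_inner_sub_le_of_mem_sphereTube hp hc hρ hz
  set h := inner ℂ p z - c with hh
  have hin : inner ℂ (c • p) z = (starRingEnd ℂ) c * (h + c) := by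
    rw [inner_smul_left, hh, sub_add_cancel]
  have h2 : ‖z - c • p‖ ^ 2 = 1 - 2 * ((starRingEnd ℂ) c * (h + c)).re + ‖c‖ ^ 2 := by
    rw [norm_sub_rev, norm_sub_sq (𝕜 := ℂ), hin, norm_smul, hp, hz.1]
    simp only [RCLike.re_to_complex]
    ring
  have h3 : ((starRingEnd ℂ) c * (h + c)).re = ((starRingEnd ℂ) c * h).re + ‖c‖ ^ 2 := by
    rw [mul_add, Complex.add_re, mul_comm _ c, Complex.mul_conj, Complex.ofReal_re,
      Complex.normSq_eq_norm_sq]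
  have h4 : |((starRingEnd ℂ) c * h).re| ≤ 2 * ρ := by
    refine (Complex.abs_re_le_norm _).trans ?_
    rw [norm_mul, RCLike.norm_conj]
    exact (mul_le_of_le_one_left (norm_nonneg _) hc).trans h1
  rw [h2, h3]
  linarith [(abs_le.mp h4).1]

/-- The line is at distance `1 / sheetScale Λ ξ ≥ 1 / Λ` from the origin, so it meets the sphere in
a circle of squared radius at most `2 (Λ - 1)`; the tube adds at most `4 ρ`. -/
theorem dist_le_of_mem_sphereTube_sheetDir {Λ : ℝ} (hΛ : 1 < Λ) {ξ α : ℂ} (hξ : ‖ξ‖ < 1)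
    (hα : ‖α‖ = 1) {p z w : EuclideanSpace ℂ (Fin 2)} (hp : ‖p‖ = 1) {ρ ε : ℝ} (hρ : 0 ≤ ρ)
    (hε : 0 ≤ ε) (hle : 2 * (Λ - 1) + 4 * ρ ≤ (ε / 2) ^ 2)
    (hz : z ∈ sphereTube p (α / sheetScale Λ ξ) ρ)
    (hw : w ∈ sphereTube p (α / sheetScale Λ ξ) ρ) : dist z w ≤ ε := by
  have hs := one_lt_sheetScale hΛ hξ
  have hc : ‖α / sheetScale Λ ξ‖ = 1 / sheetScale Λ ξ := by
    rw [norm_div, hα, Complex.norm_real, Real.norm_eq_abs, abs_of_pos (by linarith)]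
  have hc1 : ‖α / sheetScale Λ ξ‖ ≤ 1 := by
    rw [hc]; exact (div_le_one (by linarith)).mpr hs.le
  have hc2 : 1 - ‖α / sheetScale Λ ξ‖ ^ 2 ≤ 2 * (Λ - 1) := by
    have h1 : 1 / Λ ≤ 1 / sheetScale Λ ξ :=
      one_div_le_one_div_of_le (by linarith) (sheetScale_le hΛ.le ξ)
    have h2 : 2 - Λ ≤ 1 / Λ := by
      rw [le_div_iff₀ (by linarith)]
      nlinarith [sq_nonneg (Λ - 1)]
    rw [hc]
    nlinarith [sq_nonneg (1 - 1 / sheetScale Λ ξ)]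
  have key : ∀ u ∈ sphereTube p (α / sheetScale Λ ξ) ρ, dist u ((α / sheetScale Λ ξ) • p) ≤ ε / 2 :=
    fun u hu => by
      rw [dist_eq_norm]
      refine le_of_sq_le_sq ?_ (by positivity)
      linarith [norm_sub_smul_sq_le_of_mem_sphereTube hp hc1 hρ hu]
  have := dist_triangle_right z w ((α / sheetScale Λ ξ) • p)
  linarith [key z hz, key w hw]

end SheetTubes

/-! ### Every tube is divisible -/

section Division

theorem exists_linearIsometryEquiv_inner {p : EuclideanSpace ℂ (Fin 2)} (hp : ‖p‖ = 1) :
    ∃ g : EuclideanSpace ℂ (Fin 2) ≃ₗᵢ[ℂ] EuclideanSpace ℂ (Fin 2), ∀ z, g z 0 = inner ℂ p z := by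
  have ho : Orthonormal ℂ (({0} : Set (Fin 2)).domRestrict fun _ : Fin 2 => p) :=
    ⟨fun _ => hp, fun i j hij => absurd (Subsingleton.elim i j) hij⟩
  obtain ⟨b, hb⟩ := ho.exists_orthonormalBasis_extension_of_card_eq (by simp)
  refine ⟨b.repr, fun z => ?_⟩
  rw [b.repr_apply_apply, hb 0 rfl]

theorem exists_ne_pow_mul_eq_one {ω : ℂ} (hω : ‖ω‖ = 1) {N : ℕ} (hN : 2 ≤ N) :
    ∃ α α' : ℂ, α ≠ α' ∧ α ^ N * ω = 1 ∧ α' ^ N * ω = 1 := by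
  have hω0 : ω ≠ 0 := norm_ne_zero_iff.mp (by rw [hω]; exact one_ne_zero)
  obtain ⟨α, hα⟩ := IsAlgClosed.exists_pow_nat_eq (ω⁻¹) (show 0 < N by omega)
  have hp := Complex.isPrimitiveRoot_exp N (by omega)
  have hα0 : α ≠ 0 := by
    rintro rfl
    rw [zero_pow (by omega)] at hα
    exact inv_ne_zero hω0 hα.symm
  refine ⟨α, α * Complex.exp (2 * Real.pi * Complex.I / N), fun h => ?_, ?_, ?_⟩
  · exact hp.ne_one (by omega) (mul_left_cancel₀ hα0 (by rw [← h, mul_one]))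
  · rw [hα, inv_mul_cancel₀ hω0]
  · rw [mul_pow, hp.pow_eq_one, mul_one, hα, inv_mul_cancel₀ hω0]

theorem norm_eq_one_of_pow_mul_eq_one {ω α : ℂ} (hω : ‖ω‖ = 1) {N : ℕ} (hN : N ≠ 0)
    (h : α ^ N * ω = 1) : ‖α‖ = 1 := by
  have h2 := congrArg norm h
  rw [norm_mul, hω, mul_one, norm_pow, norm_one] at h2
  exact (pow_eq_one_iff_of_nonneg (norm_nonneg _) hN).mp h2

theorem finite_pow_mul_eq_one (ω : ℂ) {N : ℕ} (hN : N ≠ 0) : {α : ℂ | α ^ N * ω = 1}.Finite := by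
  classical
  refine (Polynomial.nthRoots N ω⁻¹).toFinset.finite_toSet.subset fun α hα => ?_
  have hα' : α ^ N * ω = 1 := hα
  rw [Finset.mem_coe, Multiset.mem_toFinset, Polynomial.mem_nthRoots (Nat.pos_of_ne_zero hN)]
  exact eq_inv_of_mul_eq_one_left hα'

theorem Finset.exists_pos_forall_le {ι : Type*} (t : Finset ι) (f : ι → ℝ) :
    ∃ M > (0 : ℝ), ∀ i ∈ t, f i ≤ M := by
  classical
  obtain ⟨M, hM⟩ := (t.image f).exists_le
  exact ⟨max M 1, by positivity, fun i hi =>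
    (hM _ (Finset.mem_image_of_mem f hi)).trans (le_max_left _ _)⟩

/-- All parameters except `m` are fixed first. Tube widths decay like `θ ^ m` while root spacings
decay like `1 / (s m)`, so a large `m` meets all requirements at once. -/
theorem TubePair.divisible (T : TubePair) : T.Divisible := by
  obtain ⟨δ₀, hδ₀, hpeak⟩ := exists_peak_family T.norm_center T.r_pos T.r_lt T.R_lt
  refine ⟨δ₀, hδ₀, fun δ hδ hδδ₀ ε hε => ?_⟩
  -- `Λ < 1 + ε² / 16` keeps `2 (Λ - 1)` below `(ε / 2)²`, leaving room for the tube width in the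
  -- diameter bound.
  obtain ⟨Λ, ν, θ, t, s, hΛ, hΛε, hν, hθ0, hθ1, hs, htne, ht, hside, hhull⟩ :=
    hpeak δ hδ hδδ₀ (1 + ε ^ 2 / 16) (by linarith [pow_pos hε 2])
  -- `K θ ^ m` is a core radius wide enough to contain the trace of the sublevel set; outer radii
  -- are twice that. `M θ ^ m` bounds `|Λ w_ξ - α|` on the outer tubes.
  obtain ⟨K, hK, hKt⟩ := t.exists_pos_forall_le fun ξ => 8 / (1 - 1 / sheetScale Λ ξ)
  obtain ⟨M, hM, hMt⟩ := t.exists_pos_forall_le fun ξ => 2 * Λ / (1 - ‖ξ‖) * (2 * K)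
  obtain ⟨κ, hκ, hrot⟩ := exists_rotations hΛ t ht
  obtain ⟨g, hg⟩ := exists_linearIsometryEquiv_inner T.norm_dir
  have hθT : Tendsto (fun m : ℕ => θ ^ m) atTop (𝓝 0) :=
    tendsto_pow_atTop_nhds_zero_of_lt_one hθ0.le hθ1
  have hE3 : ∀ᶠ m : ℕ in atTop, 2 * K * θ ^ m < 1 :=
    (hθT.const_mul (2 * K)).eventually_lt_const (by simp)
  have hE4 : ∀ᶠ m : ℕ in atTop, M * θ ^ m < 1 / 12 :=
    (hθT.const_mul M).eventually_lt_const (by norm_num)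
  have hE5 : ∀ᶠ m : ℕ in atTop, ((s * m : ℕ) : ℝ) * Real.sqrt (M * θ ^ m) < κ := by
    have h := (tendsto_self_mul_const_pow_of_lt_one (Real.sqrt_nonneg θ)
      ((Real.sqrt_lt' one_pos).mpr (by simpa using hθ1))).const_mul (s * Real.sqrt M)
    rw [mul_zero] at h
    filter_upwards [h.eventually_lt_const hκ] with m hm
    have h2 : Real.sqrt (θ ^ m) = Real.sqrt θ ^ m := by
      rw [Real.sqrt_eq_iff_mul_self_eq (by positivity) (by positivity), ← mul_pow,
        Real.mul_self_sqrt hθ0.le]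
    rw [Real.sqrt_mul hM.le, h2]
    push_cast
    linarith
  have hE6 : ∀ᶠ m : ℕ in atTop, M * θ ^ m < 1 - ν :=
    (hθT.const_mul M).eventually_lt_const (by simpa using hν)
  have hE7 : ∀ᶠ m : ℕ in atTop, 4 * (2 * K) * θ ^ m < (ε / 2) ^ 2 - 2 * (Λ - 1) :=
    (hθT.const_mul (4 * (2 * K))).eventually_lt_const (by nlinarith)
  have hE8 : ∀ᶠ m : ℕ in atTop, ((s * m : ℕ) : ℝ) * (2 * (M * θ ^ m)) < 1 := by
    have h := (tendsto_self_mul_const_pow_of_lt_one hθ0.le hθ1).const_mul (s * (2 * M))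
    filter_upwards [h.eventually_lt_const (by rw [mul_zero]; exact one_pos)] with m hm
    push_cast
    linarith
  have hE9 : ∀ᶠ m : ℕ in atTop, θ ^ m < 1 / 2 := hθT.eventually_lt_const (by norm_num)
  obtain ⟨m, hm1, hm2, hm3, hm4, hm5, hm6, hm7, hm8, hm9⟩ := (hhull.and
    ((eventually_ge_atTop 2).and (hE3.and (hE4.and (hE5.and (hE6.and (hE7.and
    (hE8.and hE9)))))))).exists
  have hN2 : 2 ≤ s * m := by nlinarith [Nat.one_le_iff_ne_zero.mpr hs]
  have hN0 : s * m ≠ 0 := by omega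
  have hθm : 0 < θ ^ m := by positivity
  obtain ⟨ω, hω1, hω2⟩ := hrot (s * m) (M * θ ^ m) (by positivity) hm4.le hm5
  -- Specifying a tube by its data avoids carrying the proof fields, which are available only for
  -- pairs `(ξ, α)` in `I`.
  set Good : ℂ × ℂ → TubePair → Prop := fun q T' => T'.dir = g.symm (sheetDir Λ q.1 q.2) ∧
    T'.center = q.2 / sheetScale Λ q.1 ∧ T'.r = K * θ ^ m ∧ T'.R = 2 * K * θ ^ m with hGood
  set I : Set (ℂ × ℂ) := {q | q.1 ∈ t ∧ q.2 ^ (s * m) * ω q.1 = 1} with hI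
  have hI1 : ∀ q ∈ I, ‖q.2‖ = 1 := fun q hq =>
    norm_eq_one_of_pow_mul_eq_one (hω1 _ hq.1) hN0 hq.2
  have hIξ : ∀ q ∈ I, ‖q.1‖ < 1 := fun q hq => ht _ hq.1
  have hinner : ∀ (p z : EuclideanSpace ℂ (Fin 2)), inner ℂ (g.symm p) z = inner ℂ p (g z) :=
    fun p z => by rw [← g.inner_map_map, g.apply_symm_apply]
  have htube : ∀ (p z : EuclideanSpace ℂ (Fin 2)) (c : ℂ) (ρ : ℝ),
      z ∈ sphereTube (g.symm p) c ρ ↔ g z ∈ sphereTube p c ρ := by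
    intro p z c ρ
    simp only [sphereTube, Set.mem_ofPred_eq, hinner, g.norm_map]
  have hGoodex : ∀ q ∈ I, ∃ T', Good q T' := by
    intro q hq
    have h1 := one_lt_sheetScale hΛ (hIξ q hq)
    refine ⟨⟨g.symm (sheetDir Λ q.1 q.2), q.2 / sheetScale Λ q.1, K * θ ^ m, 2 * K * θ ^ m, ?_, ?_,
      by positivity, by nlinarith, hm3⟩, rfl, rfl, rfl, rfl⟩
    · rw [g.symm.norm_map, norm_sheetDir hΛ (hIξ q hq) (hI1 q hq)]
    · rw [norm_div, hI1 q hq, Complex.norm_real, Real.norm_eq_abs, abs_of_pos (by linarith)]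
      exact (div_lt_one (by linarith)).mpr h1
  have hGooduniq : ∀ q, {T' | Good q T'}.Subsingleton := by
    rintro q ⟨d, c, r, R, _, _, _, _, _⟩ ⟨h1, h2, h3, h4⟩ ⟨d', c', r', R', _, _, _, _, _⟩
      ⟨h1', h2', h3', h4'⟩
    simp only at h1 h2 h3 h4 h1' h2' h3' h4'
    subst h1 h2 h3 h4 h1' h2' h3' h4'
    rfl
  have houter : ∀ q ∈ I, ∀ T', Good q T' → ∀ z ∈ T'.outer,
      ‖Λ * moebiusCoord q.1 (euclPair.symm (g z)) - q.2‖ ≤ M * θ ^ m := by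
    rintro q hq T' ⟨h1, h2, h3, h4⟩ z hz
    rw [TubePair.outer, h1, h2, h4, htube, ← euclPair.apply_symm_apply (g z)] at hz
    refine (norm_sub_le_of_mem_sphereTube_sheetDir hΛ (hIξ q hq) (hI1 q hq) (by positivity)
      hz).trans ?_
    rw [← mul_assoc]
    exact mul_le_mul_of_nonneg_right (hMt _ hq.1) hθm.le
  have hv1 : ∀ z : EuclideanSpace ℂ (Fin 2), ‖z‖ = 1 → ‖euclPair (euclPair.symm (g z))‖ = 1 :=
    fun z hz => by rw [euclPair.apply_symm_apply, g.norm_map, hz]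
  have hfst : ∀ z : EuclideanSpace ℂ (Fin 2), (euclPair.symm (g z)).1 = inner ℂ T.dir z :=
    fun z => by rw [← hg]; simp
  refine ⟨⋃ q ∈ I, {T' | Good q T'}, ?_, ?_, ?_, ?_, ?_⟩
  · refine Set.Finite.biUnion ?_ fun q _ => (hGooduniq q).finite
    refine ((t.finite_toSet.biUnion fun ξ _ => (finite_pow_mul_eq_one (ω ξ) hN0).image
      fun α => (ξ, α))).subset fun q hq => ?_
    exact Set.mem_biUnion hq.1 ⟨q.2, hq.2, rfl⟩
  · obtain ⟨ξ, hξ⟩ := htne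
    obtain ⟨α, α', hne, hα, hα'⟩ := exists_ne_pow_mul_eq_one (hω1 ξ hξ) hN2
    obtain ⟨T₁, hT₁⟩ := hGoodex (ξ, α) ⟨hξ, hα⟩
    obtain ⟨T₂, hT₂⟩ := hGoodex (ξ, α') ⟨hξ, hα'⟩
    refine ⟨T₁, Set.mem_biUnion (show (ξ, α) ∈ I from ⟨hξ, hα⟩) hT₁, T₂,
      Set.mem_biUnion (show (ξ, α') ∈ I from ⟨hξ, hα'⟩) hT₂, fun h => hne ?_⟩
    have h1 := hT₁.2.1
    rw [h, hT₂.2.1] at h1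
    have hs0 : (sheetScale Λ ξ : ℂ) ≠ 0 :=
      Complex.ofReal_ne_zero.mpr (by linarith [one_lt_sheetScale hΛ (ht ξ hξ)])
    exact ((div_left_inj' hs0).mp h1).symm
  · intro T₁ hT₁ T₂ hT₂ hne
    obtain ⟨q₁, hq₁, h₁⟩ := Set.mem_iUnion₂.mp hT₁
    obtain ⟨q₂, hq₂, h₂⟩ := Set.mem_iUnion₂.mp hT₂
    refine Set.disjoint_left.mpr fun z hz₁ hz₂ => ?_
    have hy₁ := houter q₁ hq₁ T₁ h₁ z hz₁
    have hy₂ := houter q₂ hq₂ T₂ h₂ z hz₂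
    -- On the same sheet family, the spacing `1 / N` of the roots exceeds twice the width; on
    -- different ones, the choice of `ω` forbids a collision.
    by_cases hξ : q₁.1 = q₂.1
    · have hα : q₁.2 ≠ q₂.2 := fun h => hne (hGooduniq q₁ h₁ (by
        rw [Prod.ext hξ h]; exact h₂))
      have hω0 : ω q₁.1 ≠ 0 := norm_ne_zero_iff.mp (by rw [hω1 _ hq₁.1]; exact one_ne_zero)
      have hpow : q₁.2 ^ (s * m) = q₂.2 ^ (s * m) := by
        refine mul_right_cancel₀ hω0 ?_
        rw [hq₁.2, hξ, hq₂.2]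
      have h3 := one_div_le_norm_sub_of_pow_eq hN0 (hI1 _ hq₂) hpow hα
      rw [hξ, norm_sub_rev] at hy₁
      have h4 := norm_sub_le_norm_sub_add_norm_sub q₁.2
        (Λ * moebiusCoord q₂.1 (euclPair.symm (g z))) q₂.2
      have hNpos : (0 : ℝ) < ((s * m : ℕ) : ℝ) := Nat.cast_pos.mpr (by omega)
      have h5 : 1 / ((s * m : ℕ) : ℝ) ≤ 2 * (M * θ ^ m) := by linarith
      rw [div_le_iff₀ hNpos] at h5
      linarith
    · exact hω2 _ hq₁.1 _ hq₂.1 hξ ⟨euclPair.symm (g z), q₁.2, q₂.2, hv1 z hz₁.1, hI1 _ hq₁,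
        hI1 _ hq₂, hq₁.2, hq₂.2, hy₁, hy₂⟩
  · intro T' hT'
    obtain ⟨q, hq, h⟩ := Set.mem_iUnion₂.mp hT'
    refine ⟨fun z hz => ⟨hz.1, ?_⟩, fun z hz w hw => ?_⟩
    · have hy := houter q hq T' h z hz
      rw [← hfst]
      refine hside q.1 hq.1 _ (hv1 z hz.1) ?_
      have h2 := norm_sub_norm_le q.2 (q.2 - Λ * moebiusCoord q.1 (euclPair.symm (g z)))
      rw [sub_sub_cancel, hI1 q hq, norm_sub_rev] at h2
      linarith
    · rw [TubePair.outer, h.2.1, h.2.2.2] at hz hw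
      exact dist_le_of_mem_sphereTube_sheetDir hΛ (hIξ q hq) (hI1 q hq) T'.norm_dir
        (by positivity) hε.le (by linarith) hz hw
  · intro z hz
    have h1 := hm1 ω hω1 (euclPair.symm (g z)) (hv1 z hz.1) (by rw [hfst]; exact hz.2)
    have h2 := mem_polynomialHull_image (g.symm.toLinearEquiv : _ →ₗ[ℂ] _) h1
    have h3 : (g.symm.toLinearEquiv : EuclideanSpace ℂ (Fin 2) →ₗ[ℂ] EuclideanSpace ℂ (Fin 2))
        (euclPair (((1 - δ : ℝ) : ℂ) • euclPair.symm (g z))) = ((1 - δ : ℝ) : ℂ) • z := by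
      rw [map_smul, euclPair.apply_symm_apply, map_smul]
      congr 1
      exact g.symm_apply_apply z
    rw [h3] at h2
    refine polynomialHull_mono ?_ h2
    rintro _ ⟨_, ⟨v, ⟨hv, ξ, hξ, hlt⟩, rfl⟩, rfl⟩
    obtain ⟨α, hα, hα1, hyα⟩ := exists_root_near hN0 (hω1 ξ hξ) hm9.le hlt
    have hq : (ξ, α) ∈ I := ⟨hξ, hα⟩
    obtain ⟨T', hT'⟩ := hGoodex _ hq
    refine Set.mem_biUnion (Set.mem_biUnion hq hT') ?_
    rw [TubePair.core, hT'.1, hT'.2.1, hT'.2.2.1]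
    show g.symm (euclPair v) ∈ _
    rw [htube, g.apply_symm_apply]
    refine mem_sphereTube_sheetDir hΛ (ht ξ hξ) hα1 hv hyα (by positivity) ?_
    have h4 : 0 < 1 - 1 / sheetScale Λ ξ := by
      have := one_lt_sheetScale hΛ (ht ξ hξ)
      rw [sub_pos, div_lt_one (by linarith)]
      exact this
    have h5 := (div_le_iff₀ h4).mp (hKt ξ hξ)
    have h6 := mul_le_mul_of_nonneg_right h5 hθm.le
    linarith

end Division

theorem mainTheorem1 (β : ℝ) (hβ0 : 0 < β) (hβ1 : β < 1) :
    ∃ E : Set (EuclideanSpace ℂ (Fin 2)),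
      IsCantorSet E ∧
      E ⊆ Metric.sphere (0 : EuclideanSpace ℂ (Fin 2)) 1 ∧
      Metric.closedBall (0 : EuclideanSpace ℂ (Fin 2)) β ⊆ polynomialHull E :=
  exists_isCantorSet_of_divisible TubePair.divisible hβ0 hβ1
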